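/- Let $n\ge 1$, $z_0\in(0,1)$, $\mu\in\mathbb R$. Let $\check\lambda_1,\dots,\check\lambda_n\in C^2[0,1]$ with $\check\lambda_1(x)>\dots>\check\lambda_n(x)>0$ on $[0,1]$, and $\check A\in (C[0,1])^{n\times n}$. For $z\in[0,1]$ define the folded coefficients $$\lambda_i(z)=\frac{\check\lambda_i(z_0-z_0z)}{z_0^2},\qquad \lambda_{n+i}(z)=\frac{\check\lambda_i(z_0+(1-z_0)z)}{(1-z_0)^2}\qquad(1\le i\le n),$$ $\Lambda=\operatorname{diag}(\lambda_1,\dots,\lambda_{2n})$, $A(z)=\operatorname{bdiag}\bigl(\check A(z_0-z_0z),\check A(z_0+(1-z_0)z)\bigr)$, and assume $\lambda_1(z)>\dots>\lambda_{2n}(z)$ for all $z\in[0,1]$. Put $$S_1=\begin{bmatrix}-\frac{z_0}{1-z_0}I_n\\ I_n\end{bmatrix},\qquad S_2=\begin{bmatrix}I_n\\ I_n\end{bmatrix}.$$ Then there exist piecewise continuous, strictly lower triangular matrix functions $\widetilde A_0,\widetilde A_1:[0,1]\to\mathbb R^{2n\times 2n}$ and a piecewise continuous solution $K(z,\zeta)\in\mathbb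 R^{2n\times2n}$ on the triangle $0\le\zeta\le z\le1$ of the kernel equations $$\begin{aligned} &\Lambda(z)K_{zz}(z,\zeta)-(K(z,\zeta)\Lambda(\zeta))_{\zeta\zeta}=K(z,\zeta)(A(\zeta)+\mu I),&&0<\zeta<z<1,\\ &\Lambda(z)\tfrac{d}{dz}K(z,z)+\Lambda(z)K_z(z,z)+K_\zeta(z,z)\Lambda(z)+K(z,z)\Lambda'(z)=-(A(z)+\mu I),&&0<z<1,\\ &K(z,z)\Lambda(z)-\Lambda(z)K(z,z)=0,&&0\le z\le1,\\ &K(0,0)=0,\\ &K(z,0)\Lambda(0)S_1+\widetilde A_1(z)S_1=0,&&0\le z\le1,\\ &K_\zeta(z,0)\Lambda(0)S_2+K(z,0)\Lambda'(0)S_2-\widetilde A_0(z)S_2=0,&&0<z\le1. \end{aligned}$$ Here "piecewise continuous solution" means the following. For each entry of $K$ the closed triangle has a finite subdivision into cells $\{a\le z\le b,\ \alpha(z)\le\zeta\le\beta(z)\}$ with $\alpha,\beta\in C^1[a,b]$ and $\alpha<\beta$ on $(a,b)$, such that in each open cell the entry has classical first partial derivatives, and the entry and these derivatives are continuous in the open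 cell and extend continuously to the closed cell; the value at each point of the triangle is the one given by the extension from one of the closed cells containing the point. The partial differential equation holds entrywise in the sense of distributions on the whole open triangle, and the derivatives $K_z(z,z)$, $K_\zeta(z,z)$, $K_\zeta(z,0)$ in the boundary conditions exist as one-sided derivatives from within the triangle. -/

import Mathlib

open Set MeasureTheory Topology Filter
open scoped ContDiff Matrix

noncomputable section

namespace FoldedKernel

/-- The closed triangle `0 ≤ ζ ≤ z ≤ 1` of points `(z, ζ)`. -/
def closedTriangle : Set (ℝ × ℝ) := {p | 0 ≤ p.2 ∧ p.2 ≤ p.1 ∧ p.1 ≤ 1}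

/-- The open triangle `0 < ζ < z < 1` of points `(z, ζ)`. -/
def openTriangle : Set (ℝ × ℝ) := {p | 0 < p.2 ∧ p.2 < p.1 ∧ p.1 < 1}

/-! ### The folded system

Columns and rows `1, …, 2n` are indexed by `Fin (n + n)`: the index `Fin.castAdd n j` is `j ≤ n`
(left part), the index `Fin.natAdd n j` is `j + n` (right part). -/

/-- The folded diffusion coefficients `λ₁, …, λ₂ₙ` for the folding point `z₀`. -/
def foldedDiffusion {n : ℕ} (z₀ : ℝ) (lam : Fin n → ℝ → ℝ) (i : Fin (n + n)) (z : ℝ) : ℝ :=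
  Fin.addCases (fun j : Fin n => lam j (z₀ - z₀ * z) / z₀ ^ 2)
    (fun j : Fin n => lam j (z₀ + (1 - z₀) * z) / (1 - z₀) ^ 2) i

/-- The folded diffusion matrix `Λ(z) = diag(λ₁(z), …, λ₂ₙ(z))`. -/
def Lambda {n : ℕ} (z₀ : ℝ) (lam : Fin n → ℝ → ℝ) (z : ℝ) :
    Matrix (Fin (n + n)) (Fin (n + n)) ℝ :=
  Matrix.diagonal fun i => foldedDiffusion z₀ lam i z

/-- The derivative `Λ'(z)` on `[0, 1]` (one-sided at the end points). -/
def LambdaDeriv {n : ℕ} (z₀ : ℝ) (lam : Fin n → ℝ → ℝ) (z : ℝ) :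
    Matrix (Fin (n + n)) (Fin (n + n)) ℝ :=
  Matrix.diagonal fun i => derivWithin (foldedDiffusion z₀ lam i) (Icc 0 1) z

/-- The folded reaction matrix
`A(z) = bdiag(Ǎ(z₀ - z₀ z), Ǎ(z₀ + (1 - z₀) z))`. -/
def foldedReaction {n : ℕ} (z₀ : ℝ) (Ac : ℝ → Matrix (Fin n) (Fin n) ℝ) (z : ℝ) :
    Matrix (Fin (n + n)) (Fin (n + n)) ℝ :=
  (Matrix.fromBlocks (Ac (z₀ - z₀ * z)) 0 0 (Ac (z₀ + (1 - z₀) * z))).submatrix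
    finSumFinEquiv.symm finSumFinEquiv.symm

/-- `S₁ = col(-(z₀ / (1 - z₀)) Iₙ, Iₙ)`. -/
def S₁ (n : ℕ) (z₀ : ℝ) : Matrix (Fin (n + n)) (Fin n) ℝ :=
  (Matrix.fromRows (-(z₀ / (1 - z₀)) • (1 : Matrix (Fin n) (Fin n) ℝ)) 1).submatrix
    finSumFinEquiv.symm id

/-- `S₂ = col(Iₙ, Iₙ)`. -/
def S₂ (n : ℕ) : Matrix (Fin (n + n)) (Fin n) ℝ :=
  (Matrix.fromRows (1 : Matrix (Fin n) (Fin n) ℝ) 1).submatrix finSumFinEquiv.symm id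

/-- `M(z)` vanishes on and above the diagonal for every `z ∈ [0, 1]`. -/
def IsStrictlyLowerTriangular {m : ℕ} (M : ℝ → Matrix (Fin m) (Fin m) ℝ) : Prop :=
  ∀ z ∈ Icc (0 : ℝ) 1, ∀ i j, i ≤ j → M z i j = 0

/-! ### Piecewise regularity -/

/-- `f` is piecewise continuous on `[0, 1]`: continuous off finitely many points, where it has
finite one-sided limits. -/
def PiecewiseContinuousOnUnit (f : ℝ → ℝ) : Prop :=
  ∃ S : Finset ℝ, ContinuousOn f (Icc 0 1 \ (S : Set ℝ)) ∧
    ∀ x ∈ S, (∃ l, Tendsto f (𝓝[Ioo 0 1 ∩ Iio x] x) (𝓝 l)) ∧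
      ∃ r, Tendsto f (𝓝[Ioo 0 1 ∩ Ioi x] x) (𝓝 r)

/-- A planar cell bounded by two vertical lines and the graphs of two `C¹` functions. -/
structure Cell where
  (a b : ℝ)
  (lower upper : ℝ → ℝ)
  a_lt_b : a < b
  lower_contDiffOn : ContDiffOn ℝ 1 lower (Icc a b)
  upper_contDiffOn : ContDiffOn ℝ 1 upper (Icc a b)
  lower_lt_upper : ∀ z ∈ Ioo a b, lower z < upper z

/-- The open cell. -/
def Cell.inner (c : Cell) : Set (ℝ × ℝ) :=
  {p | p.1 ∈ Ioo c.a c.b ∧ p.2 ∈ Ioo (c.lower p.1) (c.upper p.1)}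

/-- The closed cell. -/
def Cell.closed (c : Cell) : Set (ℝ × ℝ) :=
  {p | p.1 ∈ Icc c.a c.b ∧ p.2 ∈ Icc (c.lower p.1) (c.upper p.1)}

/-- The cells form a finite subdivision of `T`. -/
def IsSubdivision {m : ℕ} (c : Fin m → Cell) (T : Set (ℝ × ℝ)) : Prop :=
  (⋃ k, (c k).closed) = T ∧ Pairwise fun k l => Disjoint (c k).inner (c l).inner

/-- `f` is piecewise continuous with respect to the cells `c`: on every open cell it coincides with
a function that is continuous on the closed cell, and at every point its value is the one
prescribed by one of the closed cells that contain the point. -/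
def PiecewiseContinuousWrt {m : ℕ} (c : Fin m → Cell) (f : ℝ → ℝ → ℝ) : Prop :=
  ∃ g : Fin m → ℝ × ℝ → ℝ,
    (∀ k, ContinuousOn (g k) (c k).closed ∧ ∀ p ∈ (c k).inner, f p.1 p.2 = g k p) ∧
    ∀ p ∈ ⋃ k, (c k).closed, ∃ k, p ∈ (c k).closed ∧ f p.1 p.2 = g k p

/-- `f` is piecewise continuous on `T` together with its first partial derivatives `fz`, `fζ`,
which are classical derivatives inside the cells. -/
def PiecewiseC1On (T : Set (ℝ × ℝ)) (f fz fζ : ℝ → ℝ → ℝ) : Prop :=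
  ∃ (m : ℕ) (c : Fin m → Cell), IsSubdivision c T ∧
    PiecewiseContinuousWrt c f ∧ PiecewiseContinuousWrt c fz ∧ PiecewiseContinuousWrt c fζ ∧
    ∀ k, ∀ p ∈ (c k).inner,
      HasDerivAt (fun s => f s p.2) (fz p.1 p.2) p.1 ∧
      HasDerivAt (fun s => f p.1 s) (fζ p.1 p.2) p.2

/-! ### The kernel equations -/

/-- `Λ(z) K_zz(z,ζ) - (K(z,ζ) Λ(ζ))_ζζ = K(z,ζ) (A(ζ) + μ I)` on `0 < ζ < z < 1` in the sense of
distributions: each entry is tested with all smooth functions compactly supported in the open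
triangle. -/
def WeakKernelPDE {n : ℕ} (z₀ : ℝ) (lam : Fin n → ℝ → ℝ) (Ac : ℝ → Matrix (Fin n) (Fin n) ℝ)
    (μ : ℝ) (K : ℝ → ℝ → Matrix (Fin (n + n)) (Fin (n + n)) ℝ) : Prop :=
  ∀ (i j : Fin (n + n)) (φ : ℝ × ℝ → ℝ), ContDiff ℝ ∞ φ → HasCompactSupport φ →
    tsupport φ ⊆ openTriangle →
    ∫ p in openTriangle,
        (K p.1 p.2 i j * iteratedDeriv 2 (fun s => foldedDiffusion z₀ lam i s * φ (s, p.2)) p.1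
          - K p.1 p.2 i j * foldedDiffusion z₀ lam j p.2
            * iteratedDeriv 2 (fun s => φ (p.1, s)) p.2)
      = ∫ p in openTriangle, (K p.1 p.2 * (foldedReaction z₀ Ac p.2 + μ • 1)) i j * φ p

/-- `K`, with first derivatives `Kz` and `Kζ`, is a piecewise continuous solution of the kernel
equations with well-posedness terms `At0`, `At1`. The derivatives at the boundary lines `ζ = z` and
`ζ = 0` are one-sided derivatives from within the triangle. -/
structure IsKernelSolution {n : ℕ} (z₀ : ℝ) (lam : Fin n → ℝ → ℝ)
    (Ac : ℝ → Matrix (Fin n) (Fin n) ℝ) (μ : ℝ)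
    (At0 At1 : ℝ → Matrix (Fin (n + n)) (Fin (n + n)) ℝ)
    (K Kz Kζ : ℝ → ℝ → Matrix (Fin (n + n)) (Fin (n + n)) ℝ) : Prop where
  piecewise : ∀ i j, PiecewiseC1On closedTriangle
    (fun z ζ => K z ζ i j) (fun z ζ => Kz z ζ i j) (fun z ζ => Kζ z ζ i j)
  pde : WeakKernelPDE z₀ lam Ac μ K
  deriv_z_diag : ∀ z ∈ Ioo (0 : ℝ) 1, ∀ i j,
    HasDerivWithinAt (fun s => K s z i j) (Kz z z i j) (Icc z 1) z
  deriv_ζ_diag : ∀ z ∈ Ioo (0 : ℝ) 1, ∀ i j,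
    HasDerivWithinAt (fun s => K z s i j) (Kζ z z i j) (Icc 0 z) z
  deriv_ζ_zero : ∀ z ∈ Ioc (0 : ℝ) 1, ∀ i j,
    HasDerivWithinAt (fun s => K z s i j) (Kζ z 0 i j) (Icc 0 z) 0
  diag_deriv : ∀ z ∈ Ioo (0 : ℝ) 1, ∃ D : Matrix (Fin (n + n)) (Fin (n + n)) ℝ,
    (∀ i j, HasDerivAt (fun s => K s s i j) (D i j) z) ∧
    Lambda z₀ lam z * D + Lambda z₀ lam z * Kz z z + Kζ z z * Lambda z₀ lam z
      + K z z * LambdaDeriv z₀ lam z = -(foldedReaction z₀ Ac z + μ • 1)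
  diag_comm : ∀ z ∈ Icc (0 : ℝ) 1, K z z * Lambda z₀ lam z - Lambda z₀ lam z * K z z = 0
  zero_zero : K 0 0 = 0
  fold₁ : ∀ z ∈ Icc (0 : ℝ) 1,
    K z 0 * Lambda z₀ lam 0 * S₁ n z₀ + At1 z * S₁ n z₀ = 0
  fold₂ : ∀ z ∈ Ioc (0 : ℝ) 1,
    Kζ z 0 * Lambda z₀ lam 0 * S₂ n + K z 0 * LambdaDeriv z₀ lam 0 * S₂ n - At0 z * S₂ n = 0

end FoldedKernel

end

/-!
The kernel equations couple the entries of `K` only within a row, so every row is solved separately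
(`RowSystem`). Fix row `i`, let `a` be the fourth root of `λᵢ` and `b` that of `λⱼ`, and let `y`
denote the travel times `∫ λ^{-1/2}`. In the coordinates `p = yᵢ(z) + yⱼ(ζ)`, `q = yᵢ(z) - yⱼ(ζ)`
the entry `K i j = a(z) b(ζ)⁻³ u(p, q)` satisfies its equation if and only if `∂p ∂q u = F`, where
`F` is a continuous linear combination of the entries of the row. Hence `u` is a sum of a function
of `p`, a function of `q` and the double integral of `F` (`waveSol`), and only the two functions of
one variable have to be found.

The equations on the diagonal prescribe `∂p u` there, which fixes the function of `p`. For `j ≠ i`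
they also say that the entry vanishes on the diagonal, which fixes the function of `q` on the values
that `q` takes on the diagonal; this needs the strict order of the `λⱼ`. For `j < i` nothing is left
to prescribe. For `j ≥ i` the function of `q` is free for `q > 0`, where the characteristics come
from the boundary `ζ = 0`. There the fold conditions for a pair of columns `j ≤ n` and `n + j`
amount to exchanging the arriving waves, with reciprocal coefficients (`foldPartner`, `foldRefl`,
`RowSystem.fold_pair`); this works because `λⱼ` and `λₙ₊ⱼ` and their derivatives at `0` come from
one coefficient at `z₀`. The conditions of the pair are imposed only if `i ≤ j`. For the other pairs
the defects are absorbed by the columns `j < i` of the two well-posedness terms, which are therefore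
strictly lower triangular (`lowerLeft`). In a pair with `j < i ≤ n + j`, no wave is sent back into
the right column.

Since `F` depends on the row itself, this is a fixed point problem (`RowSystem.step`). It is solved
in the supremum norm weighted by `exp (γ (yᵢ(z) - yᵢ(ζ)))`: this exponent does not increase along
characteristics followed back to the diagonal or to `ζ = 0`, and the integration in `q` gains a
factor `1 / γ` (`abs_ampP_sub_le`, `RowSystem.exists_step_contraction`).

For `j > i` the two definitions of the function of `q` meet at `q = 0`, that is on the
characteristic through the origin, where `K` is continuous but its derivatives may jump; this curve
separates the two cells. The equation nevertheless holds in the sense of distributions across the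
curve. For products `A(p) B(q)` of smooth functions it follows by integrating by parts
(`weakWave_product`), and it passes to uniform limits, hence to all sums of two continuous
travelling waves and a double integral (`weakWave_sum`), by the density of sums of separable
functions.
-/

noncomputable section

namespace FoldedKernel

/-! ### Preliminaries on the real line -/

/-- The projection of the real line onto `[0, 1]`. -/
def clamp (t : ℝ) : ℝ := max 0 (min t 1)

lemma continuous_clamp : Continuous clamp := by unfold clamp; fun_prop

lemma clamp_mem (t : ℝ) : clamp t ∈ Icc (0 : ℝ) 1 :=
  ⟨le_max_left _ _, max_le zero_le_one (min_le_right _ _)⟩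

lemma clamp_of_mem {t : ℝ} (ht : t ∈ Icc (0 : ℝ) 1) : clamp t = t := by
  unfold clamp; rw [min_eq_left ht.2, max_eq_right ht.1]

lemma clamp_mono : Monotone clamp := fun _ _ h => max_le_max le_rfl (min_le_min h le_rfl)

/-- A `C¹` function with derivative bounded away from `0` by a positive constant is a homeomorphism
of the line. -/
lemma exists_inverse_of_deriv_ge {f f' : ℝ → ℝ} (hf : ∀ x, HasDerivAt f (f' x) x)
    {c : ℝ} (hc : 0 < c) (hcf : ∀ x, c ≤ f' x) :
    ∃ g : ℝ → ℝ, Continuous g ∧ (∀ x, g (f x) = x) ∧ ∀ y, f (g y) = y := by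
  have hcont : Continuous f := continuous_iff_continuousAt.2 fun x => (hf x).continuousAt
  have hmono : StrictMono f :=
    strictMono_of_deriv_pos fun x => by rw [(hf x).deriv]; exact hc.trans_le (hcf x)
  have hd : ∀ x, HasDerivAt (fun x => f x - c * x) (f' x - c) x := fun x => by
    simpa using (hf x).fun_sub ((hasDerivAt_id' x).const_mul c)
  have hlin : Monotone fun x => f x - c * x :=
    monotone_of_deriv_nonneg (fun x => (hd x).differentiableAt) fun x => by
      rw [(hd x).deriv]; exact sub_nonneg.2 (hcf x)
  have htop : Tendsto f atTop atTop := by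
    refine tendsto_atTop_mono' atTop (f₁ := fun x => c * x + f 0) ?_ ?_
    · filter_upwards [eventually_ge_atTop 0] with x hx
      have := hlin hx
      simp only [mul_zero, sub_zero] at this
      linarith
    · exact tendsto_atTop_add_const_right _ _ (tendsto_id.const_mul_atTop hc)
  have hbot : Tendsto f atBot atBot := by
    refine tendsto_atBot_mono' (f₁ := fun x => c * x + f 0) atBot ?_ ?_
    · filter_upwards [eventually_le_atBot 0] with x hx
      have := hlin hx
      simp only [mul_zero, sub_zero] at this
      linarith
    · exact tendsto_atBot_add_const_right _ _ (tendsto_id.const_mul_atBot hc)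
  have hsurj : Function.Surjective f := hcont.surjective htop hbot
  let e := (hmono.orderIsoOfSurjective f hsurj)
  exact ⟨e.symm, e.symm.continuous, fun x => e.symm_apply_apply x, fun y => e.apply_symm_apply y⟩

lemma eq_of_hasDerivAt_zero {f : ℝ → ℝ} (hf : ∀ x, HasDerivAt f 0 x) (x y : ℝ) : f x = f y :=
  is_const_of_deriv_eq_zero (fun x => (hf x).differentiableAt) (fun x => (hf x).deriv) x y

/-! ### The wave equation in characteristic coordinates -/

/-- The solution of `∂p ∂q v = F` whose restrictions to the axes have derivatives `a` and `b`. -/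
def waveSol (a b : ℝ → ℝ) (F : ℝ → ℝ → ℝ) (p q : ℝ) : ℝ :=
  (∫ t in 0..p, a t) + (∫ t in 0..q, b t) + ∫ s in 0..p, ∫ t in 0..q, F s t

/-- The derivative of `waveSol` in the first characteristic direction. -/
def waveP (a : ℝ → ℝ) (F : ℝ → ℝ → ℝ) (p q : ℝ) : ℝ := a p + ∫ t in 0..q, F p t

/-- The derivative of `waveSol` in the second characteristic direction. -/
def waveQ (b : ℝ → ℝ) (F : ℝ → ℝ → ℝ) (p q : ℝ) : ℝ := b q + ∫ s in 0..p, F s q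

lemma continuous_integral_right {F : ℝ → ℝ → ℝ} (hF : Continuous (Function.uncurry F))
    {α : Type*} [TopologicalSpace α] {f g h : α → ℝ} (hf : Continuous f) (hg : Continuous g)
    (hh : Continuous h) :
    Continuous fun x => ∫ t in (g x)..(h x), F (f x) t := by
  have h0 : ∀ {k : α → ℝ}, Continuous k → Continuous fun x => ∫ t in 0..(k x), F (f x) t := by
    intro k hk
    exact (intervalIntegral.continuous_parametric_primitive_of_continuous (μ := volume) (a₀ := 0)
      hF).comp (hf.prodMk hk)
  have hi : ∀ x a b, IntervalIntegrable (F (f x)) volume a b := fun x a b =>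
    (hF.comp (Continuous.prodMk_right (f x))).intervalIntegrable a b
  have : (fun x => ∫ t in (g x)..(h x), F (f x) t)
      = fun x => (∫ t in 0..(h x), F (f x) t) - ∫ t in 0..(g x), F (f x) t := by
    funext x
    rw [intervalIntegral.integral_interval_sub_left (hi x _ _) (hi x _ _)]
  rw [this]
  exact (h0 hh).sub (h0 hg)

lemma continuous_integral_left {F : ℝ → ℝ → ℝ} (hF : Continuous (Function.uncurry F))
    {α : Type*} [TopologicalSpace α] {f g h : α → ℝ} (hf : Continuous f) (hg : Continuous g)
    (hh : Continuous h) :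
    Continuous fun x => ∫ s in (g x)..(h x), F s (f x) :=
  continuous_integral_right (F := fun q p => F p q) (hF.comp continuous_swap) hf hg hh

section waveSol

variable {a b : ℝ → ℝ} {F : ℝ → ℝ → ℝ}

lemma continuous_waveP (ha : Continuous a) (hF : Continuous (Function.uncurry F)) :
    Continuous fun x : ℝ × ℝ => waveP a F x.1 x.2 :=
  (ha.comp continuous_fst).add
    (continuous_integral_right hF continuous_fst continuous_const continuous_snd)

lemma continuous_waveQ (hb : Continuous b) (hF : Continuous (Function.uncurry F)) :
    Continuous fun x : ℝ × ℝ => waveQ b F x.1 x.2 :=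
  (hb.comp continuous_snd).add
    (continuous_integral_left hF continuous_snd continuous_const continuous_fst)

lemma hasDerivAt_waveSol_left (ha : Continuous a) (hF : Continuous (Function.uncurry F))
    (p q : ℝ) : HasDerivAt (fun p => waveSol a b F p q) (waveP a F p q) p := by
  have h1 : HasDerivAt (fun p => ∫ t in 0..p, a t) (a p) p :=
    (ha.integral_hasStrictDerivAt 0 p).hasDerivAt
  have hc : Continuous fun s => ∫ t in 0..q, F s t :=
    continuous_integral_right hF continuous_id continuous_const continuous_const
  have h2 : HasDerivAt (fun p => ∫ s in 0..p, ∫ t in 0..q, F s t) (∫ t in 0..q, F p t) p :=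
    (hc.integral_hasStrictDerivAt 0 p).hasDerivAt
  exact (h1.add_const _).add h2

lemma waveSol_swap (hF : Continuous (Function.uncurry F)) (p q : ℝ) :
    waveSol a b F p q = waveSol b a (fun s t => F t s) q p := by
  unfold waveSol
  rw [intervalIntegral_intervalIntegral_swap, add_comm (∫ t in 0..p, a t)]
  exact (hF.continuousOn.integrableOn_compact (isCompact_uIcc.prod isCompact_uIcc)).mono_set
    (prod_mono uIoc_subset_uIcc uIoc_subset_uIcc)

lemma hasDerivAt_waveSol_right (hb : Continuous b) (hF : Continuous (Function.uncurry F))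
    (p q : ℝ) : HasDerivAt (fun q => waveSol a b F p q) (waveQ b F p q) q := by
  simp_rw [waveSol_swap (a := a) (b := b) hF p]
  exact hasDerivAt_waveSol_left (F := fun s t => F t s) hb (hF.comp continuous_swap) q p

lemma hasStrictFDerivAt_waveSol (ha : Continuous a) (hb : Continuous b)
    (hF : Continuous (Function.uncurry F)) (x : ℝ × ℝ) :
    HasStrictFDerivAt (Function.uncurry (waveSol a b F))
      ((ContinuousLinearMap.toSpanSingleton ℝ (waveP a F x.1 x.2)).coprod
        (ContinuousLinearMap.toSpanSingleton ℝ (waveQ b F x.1 x.2))) x := by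
  have hl : Continuous fun c : ℝ => ContinuousLinearMap.toSpanSingleton ℝ c :=
    (ContinuousLinearMap.toSpanSingletonCLE (𝕜 := ℝ) (E := ℝ)).continuous
  refine hasStrictFDerivAt_uncurry_coprod (𝕜 := ℝ) (f := waveSol a b F)
    (f₁ := fun p q => ContinuousLinearMap.toSpanSingleton ℝ (waveP a F p q))
    (f₂ := fun p q => ContinuousLinearMap.toSpanSingleton ℝ (waveQ b F p q))
    (Eventually.of_forall fun y => (hasDerivAt_waveSol_left ha hF y.1 y.2).hasFDerivAt)
    (Eventually.of_forall fun y => (hasDerivAt_waveSol_right hb hF y.1 y.2).hasFDerivAt) ?_ ?_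
  · exact (hl.comp (continuous_waveP ha hF)).continuousAt
  · exact (hl.comp (continuous_waveQ hb hF)).continuousAt

lemma continuous_waveSol (ha : Continuous a) (hb : Continuous b)
    (hF : Continuous (Function.uncurry F)) : Continuous (Function.uncurry (waveSol a b F)) :=
  continuous_iff_continuousAt.2 fun x => (hasStrictFDerivAt_waveSol ha hb hF x).continuousAt

/-- The chain rule for `waveSol` along a curve. -/
lemma hasDerivWithinAt_waveSol_comp (ha : Continuous a) (hb : Continuous b)
    (hF : Continuous (Function.uncurry F)) {p q : ℝ → ℝ} {p' q' t : ℝ} {s : Set ℝ}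
    (hp : HasDerivWithinAt p p' s t) (hq : HasDerivWithinAt q q' s t) :
    HasDerivWithinAt (fun t => waveSol a b F (p t) (q t))
      (waveP a F (p t) (q t) * p' + waveQ b F (p t) (q t) * q') s t := by
  have h := (hasStrictFDerivAt_waveSol ha hb hF (p t, q t)).hasFDerivAt.comp_hasDerivWithinAt t
    (hp.prodMk hq)
  refine h.congr_deriv ?_
  simp [mul_comm]

end waveSol

/-! ### Travel times -/

/-- The fourth root `m` of a diffusion coefficient on `[0, 1]` with its first two derivatives. All
three functions are continuous on the whole line, `m` being constant outside `[0, 1]`; the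
derivatives are derivatives of `m` on `[0, 1]` only. -/
structure Profile where
  (m d d2 : ℝ → ℝ)
  continuous_m : Continuous m
  continuous_d : Continuous d
  continuous_d2 : Continuous d2
  pos : ∀ z, 0 < m z
  clamp_eq : ∀ z, m (clamp z) = m z
  hasDeriv : ∀ z ∈ Icc (0 : ℝ) 1, HasDerivWithinAt m (d z) (Icc 0 1) z
  hasDeriv2 : ∀ z ∈ Icc (0 : ℝ) 1, HasDerivWithinAt d (d2 z) (Icc 0 1) z

namespace Profile

variable (a b : Profile)

lemma ne_zero (z : ℝ) : a.m z ≠ 0 := (a.pos z).ne'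

/-- The travel time `∫₀ᶻ λ^{-1/2}` of waves with speed `λ^{1/2} = m²`. -/
def y (z : ℝ) : ℝ := ∫ t in 0..z, (a.m t ^ 2)⁻¹

lemma continuous_inv_sq : Continuous fun t => (a.m t ^ 2)⁻¹ :=
  (a.continuous_m.pow 2).inv₀ fun t => pow_ne_zero 2 (a.ne_zero t)

lemma hasDerivAt_y (z : ℝ) : HasDerivAt a.y (a.m z ^ 2)⁻¹ z :=
  (a.continuous_inv_sq.integral_hasStrictDerivAt 0 z).hasDerivAt

lemma continuous_y : Continuous a.y :=
  continuous_iff_continuousAt.2 fun z => (a.hasDerivAt_y z).continuousAt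

@[simp] lemma y_zero : a.y 0 = 0 := by simp [y]

lemma strictMono_y : StrictMono a.y :=
  strictMono_of_deriv_pos fun z => by
    rw [(a.hasDerivAt_y z).deriv]; have := a.pos z; positivity

lemma hasDerivAt_m {z : ℝ} (hz : z ∈ Ioo (0 : ℝ) 1) : HasDerivAt a.m (a.d z) z :=
  (a.hasDeriv z (Ioo_subset_Icc_self hz)).hasDerivAt (Icc_mem_nhds hz.1 hz.2)

lemma hasDerivAt_d {z : ℝ} (hz : z ∈ Ioo (0 : ℝ) 1) : HasDerivAt a.d (a.d2 z) z :=
  (a.hasDeriv2 z (Ioo_subset_Icc_self hz)).hasDerivAt (Icc_mem_nhds hz.1 hz.2)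

/-- A continuous function that is positive on the line and constant outside `[0, 1]` is bounded
below by a positive constant. -/
lemma exists_pos_le {f : ℝ → ℝ} (hf : Continuous f) (hpos : ∀ z, 0 < f z)
    (hc : ∀ z, f (clamp z) = f z) : ∃ c, 0 < c ∧ ∀ z, c ≤ f z := by
  obtain ⟨z₀, -, hz₀⟩ := (isCompact_Icc (a := (0 : ℝ)) (b := 1)).exists_isMinOn
    (nonempty_Icc.2 zero_le_one) hf.continuousOn
  exact ⟨f z₀, hpos _, fun z => hc z ▸ hz₀ (clamp_mem z)⟩

lemma exists_inverse_y :
    ∃ g : ℝ → ℝ, Continuous g ∧ (∀ x, g (a.y x) = x) ∧ ∀ x, a.y (g x) = x := by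
  obtain ⟨c, hc, hcf⟩ := exists_pos_le a.continuous_inv_sq
    (fun z => by have := a.pos z; positivity) (fun z => by rw [a.clamp_eq])
  exact exists_inverse_of_deriv_ge a.hasDerivAt_y hc hcf

/-- The inverse of the travel time. -/
def yInv : ℝ → ℝ := a.exists_inverse_y.choose

lemma continuous_yInv : Continuous a.yInv := a.exists_inverse_y.choose_spec.1

@[simp] lemma yInv_y (z : ℝ) : a.yInv (a.y z) = z := a.exists_inverse_y.choose_spec.2.1 z

@[simp] lemma y_yInv (x : ℝ) : a.y (a.yInv x) = x := a.exists_inverse_y.choose_spec.2.2 x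

lemma yInv_zero : a.yInv 0 = 0 := by simpa using a.yInv_y 0

lemma strictMono_yInv : StrictMono a.yInv := fun x x' h => by
  rw [← a.strictMono_y.lt_iff_lt]; simpa using h

/-- The characteristic coordinate `p` of the point `(z, ζ)`. -/
def p (z ζ : ℝ) : ℝ := a.y z + b.y ζ

/-- The characteristic coordinate `q` of the point `(z, ζ)`. -/
def q (z ζ : ℝ) : ℝ := a.y z - b.y ζ

lemma continuous_p : Continuous fun x : ℝ × ℝ => p a b x.1 x.2 :=
  (a.continuous_y.comp continuous_fst).add (b.continuous_y.comp continuous_snd)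

lemma continuous_q : Continuous fun x : ℝ × ℝ => q a b x.1 x.2 :=
  (a.continuous_y.comp continuous_fst).sub (b.continuous_y.comp continuous_snd)

lemma hasDerivAt_p_left (z ζ : ℝ) : HasDerivAt (fun z => p a b z ζ) (a.m z ^ 2)⁻¹ z :=
  (a.hasDerivAt_y z).add_const _

lemma hasDerivAt_p_right (z ζ : ℝ) : HasDerivAt (fun ζ => p a b z ζ) (b.m ζ ^ 2)⁻¹ ζ :=
  (b.hasDerivAt_y ζ).const_add _

lemma hasDerivAt_q_left (z ζ : ℝ) : HasDerivAt (fun z => q a b z ζ) (a.m z ^ 2)⁻¹ z :=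
  (a.hasDerivAt_y z).sub_const _

lemma hasDerivAt_q_right (z ζ : ℝ) : HasDerivAt (fun ζ => q a b z ζ) (-(b.m ζ ^ 2)⁻¹) ζ :=
  (b.hasDerivAt_y ζ).const_sub _

/-- The kernel is `w` times its amplitude. With this weight, the equation for the amplitude in the
characteristic coordinates has no terms of first order. -/
def w (z ζ : ℝ) : ℝ := a.m z * (b.m ζ ^ 3)⁻¹

lemma w_pos (z ζ : ℝ) : 0 < w a b z ζ := by
  have := a.pos z; have := b.pos ζ; unfold w; positivity

lemma continuous_w : Continuous fun x : ℝ × ℝ => w a b x.1 x.2 :=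
  (a.continuous_m.comp continuous_fst).mul
    (((b.continuous_m.comp continuous_snd).pow 3).inv₀ fun _ => pow_ne_zero 3 (b.ne_zero _))

/-- The zero-order coefficient `λ m'' / m` created by passing to the travel time. -/
def c (z : ℝ) : ℝ := a.m z ^ 3 * a.d2 z

lemma continuous_c : Continuous a.c := (a.continuous_m.pow 3).mul a.continuous_d2

end Profile

/-! ### The weak equation -/

/-- Integration by parts, twice, against a function supported inside the unit interval. -/
lemma integral_mul_second_deriv {f f₁ f₂ g g₁ g₂ : ℝ → ℝ} (hf : Continuous f)
    (hf₂ : Continuous f₂) (hg : Continuous g) (hg₂ : Continuous g₂)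
    (hf' : ∀ z ∈ Ioo (0 : ℝ) 1, HasDerivAt f (f₁ z) z)
    (hf'' : ∀ z ∈ Ioo (0 : ℝ) 1, HasDerivAt f₁ (f₂ z) z)
    (hg' : ∀ z ∈ Ioo (0 : ℝ) 1, HasDerivAt g (g₁ z) z)
    (hg'' : ∀ z ∈ Ioo (0 : ℝ) 1, HasDerivAt g₁ (g₂ z) z)
    {S : Set ℝ} (hS : IsCompact S) (hS1 : S ⊆ Ioo 0 1)
    (h0 : ∀ z ∉ S, g z = 0) (h1 : ∀ z ∉ S, g₁ z = 0) (h2 : ∀ z ∉ S, g₂ z = 0) :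
    ∫ z, f z * g₂ z = ∫ z, f₂ z * g z := by
  have hcs : HasCompactSupport g := HasCompactSupport.intro hS h0
  have hcs2 : HasCompactSupport g₂ := HasCompactSupport.intro hS h2
  have hi1 : Integrable fun z => f z * g₂ z :=
    (hf.mul hg₂).integrable_of_hasCompactSupport (hcs2.mul_left)
  have hi2 : Integrable fun z => f₂ z * g z :=
    (hf₂.mul hg).integrable_of_hasCompactSupport (hcs.mul_left)
  have hi3 : Integrable fun z => f z * g₁ z - f₁ z * g z := by
    have hz : ∀ z ∉ S, f z * g₁ z - f₁ z * g z = 0 := fun z hz => by simp [h0 z hz, h1 z hz]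
    refine Continuous.integrable_of_hasCompactSupport ?_ (HasCompactSupport.intro hS hz)
    refine continuous_iff_continuousAt.2 fun z => ?_
    by_cases hzS : z ∈ S
    · have hz1 := hS1 hzS
      exact ((hf' z hz1).continuousAt.mul (hg'' z hz1).continuousAt).sub
        ((hf'' z hz1).continuousAt.mul (hg' z hz1).continuousAt)
    · refine ContinuousAt.congr (f := fun _ => (0 : ℝ)) continuousAt_const ?_
      filter_upwards [hS.isClosed.isOpen_compl.mem_nhds hzS] with t ht
      rw [hz t ht]
  have key : ∫ z, (f z * g₂ z - f₂ z * g z) = 0 := by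
    refine integral_eq_zero_of_hasDerivAt_of_integrable
      (f := fun z => f z * g₁ z - f₁ z * g z) (fun z => ?_) (hi1.sub hi2) hi3
    by_cases hzS : z ∈ S
    · have hz1 := hS1 hzS
      refine (((hf' z hz1).mul (hg'' z hz1)).sub ((hf'' z hz1).mul (hg' z hz1))).congr_deriv ?_
      ring
    · rw [h0 z hzS, h2 z hzS]
      simp only [mul_zero, sub_zero]
      refine (hasDerivAt_const z (0 : ℝ)).congr_of_eventuallyEq ?_
      filter_upwards [hS.isClosed.isOpen_compl.mem_nhds hzS] with t ht
      rw [h0 t ht, h1 t ht]; simp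
  rw [integral_sub hi1 hi2] at key
  linarith

section TestFunction

variable {φ : ℝ × ℝ → ℝ}

/-- The partial derivative in the first variable. -/
def dz (φ : ℝ × ℝ → ℝ) (x : ℝ × ℝ) : ℝ := fderiv ℝ φ x (1, 0)

/-- The partial derivative in the second variable. -/
def dζ (φ : ℝ × ℝ → ℝ) (x : ℝ × ℝ) : ℝ := fderiv ℝ φ x (0, 1)

lemma contDiff_dz (hφ : ContDiff ℝ ∞ φ) : ContDiff ℝ ∞ (dz φ) :=
  (hφ.fderiv_right (m := ∞) (by simp)).clm_apply contDiff_const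

lemma contDiff_dζ (hφ : ContDiff ℝ ∞ φ) : ContDiff ℝ ∞ (dζ φ) :=
  (hφ.fderiv_right (m := ∞) (by simp)).clm_apply contDiff_const

lemma hasDerivAt_dz (hφ : ContDiff ℝ ∞ φ) (z ζ : ℝ) :
    HasDerivAt (fun s => φ (s, ζ)) (dz φ (z, ζ)) z :=
  ((hφ.differentiable (by simp)) (z, ζ)).hasFDerivAt.comp_hasDerivAt z
    ((hasDerivAt_id z).prodMk (hasDerivAt_const z ζ))

lemma hasDerivAt_dζ (hφ : ContDiff ℝ ∞ φ) (z ζ : ℝ) :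
    HasDerivAt (fun s => φ (z, s)) (dζ φ (z, ζ)) ζ :=
  ((hφ.differentiable (by simp)) (z, ζ)).hasFDerivAt.comp_hasDerivAt ζ
    ((hasDerivAt_const ζ z).prodMk (hasDerivAt_id ζ))

lemma tsupport_dz : tsupport (dz φ) ⊆ tsupport φ := tsupport_fderiv_apply_subset ℝ _

lemma tsupport_dζ : tsupport (dζ φ) ⊆ tsupport φ := tsupport_fderiv_apply_subset ℝ _

lemma dz_eq_zero {x : ℝ × ℝ} (hx : x ∉ tsupport φ) : dz φ x = 0 :=
  image_eq_zero_of_notMem_tsupport fun h => hx (tsupport_dz h)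

lemma dζ_eq_zero {x : ℝ × ℝ} (hx : x ∉ tsupport φ) : dζ φ x = 0 :=
  image_eq_zero_of_notMem_tsupport fun h => hx (tsupport_dζ h)

lemma dz_dz_eq_zero {x : ℝ × ℝ} (hx : x ∉ tsupport φ) : dz (dz φ) x = 0 :=
  dz_eq_zero fun h => hx (tsupport_dz h)

lemma dζ_dζ_eq_zero {x : ℝ × ℝ} (hx : x ∉ tsupport φ) : dζ (dζ φ) x = 0 :=
  dζ_eq_zero fun h => hx (tsupport_dζ h)

end TestFunction

namespace Profile

variable (a b : Profile) (φ : ℝ × ℝ → ℝ)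

/-- The first `z`-derivative of `λ φ`, where `λ = m⁴`. -/
def lamTest₁ (x : ℝ × ℝ) : ℝ := 4 * a.m x.1 ^ 3 * a.d x.1 * φ x + a.m x.1 ^ 4 * dz φ x

/-- The second `z`-derivative of `λ φ`, where `λ = m⁴`. -/
def lamTest₂ (x : ℝ × ℝ) : ℝ :=
  (12 * a.m x.1 ^ 2 * a.d x.1 ^ 2 + 4 * a.m x.1 ^ 3 * a.d2 x.1) * φ x
    + 8 * a.m x.1 ^ 3 * a.d x.1 * dz φ x + a.m x.1 ^ 4 * dz (dz φ) x

variable {φ}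

lemma hasDerivAt_lamTest (hφ : ContDiff ℝ ∞ φ) {z : ℝ} (hz : z ∈ Ioo (0 : ℝ) 1) (ζ : ℝ) :
    HasDerivAt (fun s => a.m s ^ 4 * φ (s, ζ)) (a.lamTest₁ φ (z, ζ)) z := by
  refine (((a.hasDerivAt_m hz).pow 4).mul (hasDerivAt_dz hφ z ζ)).congr_deriv ?_
  simp [lamTest₁]

lemma hasDerivAt_lamTest₁ (hφ : ContDiff ℝ ∞ φ) {z : ℝ} (hz : z ∈ Ioo (0 : ℝ) 1) (ζ : ℝ) :
    HasDerivAt (fun s => a.lamTest₁ φ (s, ζ)) (a.lamTest₂ φ (z, ζ)) z := by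
  refine ((((((a.hasDerivAt_m hz).pow 3).const_mul 4).mul (a.hasDerivAt_d hz)).mul
    (hasDerivAt_dz hφ z ζ)).add (((a.hasDerivAt_m hz).pow 4).mul
      (hasDerivAt_dz (contDiff_dz hφ) z ζ))).congr_deriv ?_
  simp [lamTest₂]
  ring

lemma continuous_lamTest₂ (hφ : ContDiff ℝ ∞ φ) : Continuous (a.lamTest₂ φ) := by
  have h0 := hφ.continuous
  have h1 := (contDiff_dz hφ).continuous
  have h2 := (contDiff_dz (contDiff_dz hφ)).continuous
  have := a.continuous_m
  have := a.continuous_d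
  have := a.continuous_d2
  unfold lamTest₂
  fun_prop

lemma lamTest₂_eq_zero {x : ℝ × ℝ} (hx : x ∉ tsupport φ) : a.lamTest₂ φ x = 0 := by
  simp [lamTest₂, image_eq_zero_of_notMem_tsupport hx, dz_eq_zero hx, dz_dz_eq_zero hx]

lemma lamTest₁_eq_zero {x : ℝ × ℝ} (hx : x ∉ tsupport φ) : a.lamTest₁ φ x = 0 := by
  simp [lamTest₁, image_eq_zero_of_notMem_tsupport hx, dz_eq_zero hx]

variable (φ)

/-- The function that multiplies the amplitude `u` in the weak equation `WeakWave`. -/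
def weakU (x : ℝ × ℝ) : ℝ :=
  w a b x.1 x.2 * (a.lamTest₂ φ x - b.m x.2 ^ 4 * dζ (dζ φ) x - (a.c x.1 - b.c x.2) * φ x)

/-- The weak form of `∂p ∂q u = f`, tested with `φ` in the coordinates `(z, ζ)`. -/
def WeakWave (u f : ℝ → ℝ → ℝ) : Prop :=
  ∫ x : ℝ × ℝ, (u (p a b x.1 x.2) (q a b x.1 x.2) * weakU a b φ x
    - f (p a b x.1 x.2) (q a b x.1 x.2) * (4 * w a b x.1 x.2 * φ x)) = 0

variable {φ}

lemma continuous_weakU (hφ : ContDiff ℝ ∞ φ) : Continuous (weakU a b φ) := by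
  have h0 := hφ.continuous
  have h2 := (contDiff_dζ (contDiff_dζ hφ)).continuous
  have h3 := a.continuous_lamTest₂ hφ
  have h4 := continuous_w a b
  have := a.continuous_c
  have := b.continuous_c
  have := b.continuous_m
  unfold weakU
  fun_prop

lemma weakU_eq_zero {x : ℝ × ℝ} (hx : x ∉ tsupport φ) : weakU a b φ x = 0 := by
  simp [weakU, lamTest₂_eq_zero a hx, image_eq_zero_of_notMem_tsupport hx, dζ_dζ_eq_zero hx]

lemma isCompact_slice_left (hc : HasCompactSupport φ) (ζ : ℝ) :
    IsCompact {z | (z, ζ) ∈ tsupport φ} := by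
  refine (hc.isCompact.image continuous_fst).of_isClosed_subset
    ((isClosed_tsupport φ).preimage (by fun_prop)) fun z hz => ⟨(z, ζ), hz, rfl⟩

lemma isCompact_slice_right (hc : HasCompactSupport φ) (z : ℝ) :
    IsCompact {ζ | (z, ζ) ∈ tsupport φ} := by
  refine (hc.isCompact.image continuous_snd).of_isClosed_subset
    ((isClosed_tsupport φ).preimage (by fun_prop)) fun ζ hζ => ⟨(z, ζ), hζ, rfl⟩

lemma integrable_of_tsupport {g : ℝ × ℝ → ℝ} (hg : Continuous g) (hc : HasCompactSupport φ)
    (h : ∀ x ∉ tsupport φ, g x = 0) : Integrable g :=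
  hg.integrable_of_hasCompactSupport (HasCompactSupport.intro hc h)

section Product

variable {A A₁ A₂ B B₁ B₂ : ℝ → ℝ}

/-- Integration by parts in `z` for a product of waves `A(p) B(q)`. -/
lemma integral_product_left (hA₂ : Continuous A₂) (hB₂ : Continuous B₂)
    (hA : ∀ t, HasDerivAt A (A₁ t) t) (hA' : ∀ t, HasDerivAt A₁ (A₂ t) t)
    (hB : ∀ t, HasDerivAt B (B₁ t) t) (hB' : ∀ t, HasDerivAt B₁ (B₂ t) t)
    (hφ : ContDiff ℝ ∞ φ) (hc : HasCompactSupport φ) (hT : tsupport φ ⊆ openTriangle) (ζ : ℝ) :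
    ∫ z, a.m z * (A (p a b z ζ) * B (q a b z ζ)) * a.lamTest₂ φ (z, ζ)
      = ∫ z, (a.d2 z * (A (p a b z ζ) * B (q a b z ζ)) + (a.m z ^ 3)⁻¹ *
          (A₂ (p a b z ζ) * B (q a b z ζ) + 2 * A₁ (p a b z ζ) * B₁ (q a b z ζ)
            + A (p a b z ζ) * B₂ (q a b z ζ))) * (a.m z ^ 4 * φ (z, ζ)) := by
  have cA : Continuous A := continuous_iff_continuousAt.2 fun t => (hA t).continuousAt
  have cA₁ : Continuous A₁ := continuous_iff_continuousAt.2 fun t => (hA' t).continuousAt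
  have cB : Continuous B := continuous_iff_continuousAt.2 fun t => (hB t).continuousAt
  have cB₁ : Continuous B₁ := continuous_iff_continuousAt.2 fun t => (hB' t).continuousAt
  have cp : Continuous fun z => p a b z ζ := (continuous_p a b).comp (.prodMk_left ζ)
  have cq : Continuous fun z => q a b z ζ := (continuous_q a b).comp (.prodMk_left ζ)
  have cm := a.continuous_m
  have cd2 := a.continuous_d2
  have cφ : Continuous fun z => φ (z, ζ) := hφ.continuous.comp (.prodMk_left ζ)
  refine integral_mul_second_deriv (S := {z | (z, ζ) ∈ tsupport φ})
    (f₁ := fun z => a.d z * (A (p a b z ζ) * B (q a b z ζ)) + (a.m z)⁻¹ *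
      (A₁ (p a b z ζ) * B (q a b z ζ) + A (p a b z ζ) * B₁ (q a b z ζ)))
    (g₁ := fun z => a.lamTest₁ φ (z, ζ)) (by fun_prop) ?_ (by fun_prop)
    ((a.continuous_lamTest₂ hφ).comp (.prodMk_left ζ)) ?_ ?_
    (fun z hz => a.hasDerivAt_lamTest hφ hz ζ) (fun z hz => a.hasDerivAt_lamTest₁ hφ hz ζ)
    (isCompact_slice_left hc ζ) ?_ ?_ ?_ ?_
  · have : Continuous fun z => (a.m z ^ 3)⁻¹ :=
      (cm.pow 3).inv₀ fun z => pow_ne_zero 3 (a.ne_zero z)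
    fun_prop
  · intro z hz
    have hp := hasDerivAt_p_left a b z ζ
    have hq := hasDerivAt_q_left a b z ζ
    refine ((a.hasDerivAt_m hz).mul (((hA _).comp z hp).mul ((hB _).comp z hq))).congr_deriv ?_
    have := a.ne_zero z
    simp only [Function.comp_apply, Pi.mul_apply]
    field_simp
  · intro z hz
    have hp := hasDerivAt_p_left a b z ζ
    have hq := hasDerivAt_q_left a b z ζ
    refine (((a.hasDerivAt_d hz).mul (((hA _).comp z hp).mul ((hB _).comp z hq))).add
      (((a.hasDerivAt_m hz).inv (a.ne_zero z)).mul
        ((((hA' _).comp z hp).mul ((hB _).comp z hq)).add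
          (((hA _).comp z hp).mul ((hB' _).comp z hq))))).congr_deriv ?_
    have := a.ne_zero z
    simp only [Function.comp_apply, Pi.mul_apply, Pi.add_apply, Pi.inv_apply]
    field_simp
    ring
  · intro z hz
    have h := hT hz
    exact ⟨h.1.trans h.2.1, h.2.2⟩
  · intro z hz
    simp [image_eq_zero_of_notMem_tsupport hz]
  · intro z hz
    exact a.lamTest₁_eq_zero hz
  · intro z hz
    exact a.lamTest₂_eq_zero hz

/-- Integration by parts in `ζ` for a product of waves `A(p) B(q)`. -/
lemma integral_product_right (hA₂ : Continuous A₂) (hB₂ : Continuous B₂)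
    (hA : ∀ t, HasDerivAt A (A₁ t) t) (hA' : ∀ t, HasDerivAt A₁ (A₂ t) t)
    (hB : ∀ t, HasDerivAt B (B₁ t) t) (hB' : ∀ t, HasDerivAt B₁ (B₂ t) t)
    (hφ : ContDiff ℝ ∞ φ) (hc : HasCompactSupport φ) (hT : tsupport φ ⊆ openTriangle) (z : ℝ) :
    ∫ ζ, b.m ζ * (A (p a b z ζ) * B (q a b z ζ)) * dζ (dζ φ) (z, ζ)
      = ∫ ζ, (b.d2 ζ * (A (p a b z ζ) * B (q a b z ζ)) + (b.m ζ ^ 3)⁻¹ *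
          (A₂ (p a b z ζ) * B (q a b z ζ) - 2 * A₁ (p a b z ζ) * B₁ (q a b z ζ)
            + A (p a b z ζ) * B₂ (q a b z ζ))) * φ (z, ζ) := by
  have cA : Continuous A := continuous_iff_continuousAt.2 fun t => (hA t).continuousAt
  have cA₁ : Continuous A₁ := continuous_iff_continuousAt.2 fun t => (hA' t).continuousAt
  have cB : Continuous B := continuous_iff_continuousAt.2 fun t => (hB t).continuousAt
  have cB₁ : Continuous B₁ := continuous_iff_continuousAt.2 fun t => (hB' t).continuousAt
  have cp : Continuous fun ζ => p a b z ζ := (continuous_p a b).comp (.prodMk_right z)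
  have cq : Continuous fun ζ => q a b z ζ := (continuous_q a b).comp (.prodMk_right z)
  have cm := b.continuous_m
  have cd2 := b.continuous_d2
  have cφ : Continuous fun ζ => φ (z, ζ) := hφ.continuous.comp (.prodMk_right z)
  refine integral_mul_second_deriv (S := {ζ | (z, ζ) ∈ tsupport φ})
    (f₁ := fun ζ => b.d ζ * (A (p a b z ζ) * B (q a b z ζ)) + (b.m ζ)⁻¹ *
      (A₁ (p a b z ζ) * B (q a b z ζ) - A (p a b z ζ) * B₁ (q a b z ζ)))
    (g₁ := fun ζ => dζ φ (z, ζ)) (by fun_prop) ?_ cφ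
    ((contDiff_dζ (contDiff_dζ hφ)).continuous.comp (.prodMk_right z)) ?_ ?_
    (fun ζ hζ => hasDerivAt_dζ hφ z ζ) (fun ζ hζ => hasDerivAt_dζ (contDiff_dζ hφ) z ζ)
    (isCompact_slice_right hc z) ?_ ?_ ?_ ?_
  · have : Continuous fun z => (b.m z ^ 3)⁻¹ :=
      (cm.pow 3).inv₀ fun z => pow_ne_zero 3 (b.ne_zero z)
    fun_prop
  · intro ζ hζ
    have hp := hasDerivAt_p_right a b z ζ
    have hq := hasDerivAt_q_right a b z ζ
    refine ((b.hasDerivAt_m hζ).mul (((hA _).comp ζ hp).mul ((hB _).comp ζ hq))).congr_deriv ?_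
    have := b.ne_zero ζ
    simp only [Function.comp_apply, Pi.mul_apply]
    field_simp
    ring
  · intro ζ hζ
    have hp := hasDerivAt_p_right a b z ζ
    have hq := hasDerivAt_q_right a b z ζ
    refine (((b.hasDerivAt_d hζ).mul (((hA _).comp ζ hp).mul ((hB _).comp ζ hq))).add
      (((b.hasDerivAt_m hζ).inv (b.ne_zero ζ)).mul
        ((((hA' _).comp ζ hp).mul ((hB _).comp ζ hq)).sub
          (((hA _).comp ζ hp).mul ((hB' _).comp ζ hq))))).congr_deriv ?_
    have := b.ne_zero ζ
    simp only [Function.comp_apply, Pi.mul_apply, Pi.sub_apply, Pi.inv_apply]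
    field_simp
    ring
  · intro ζ hζ
    have h := hT hζ
    exact ⟨h.1, h.2.1.trans h.2.2⟩
  · intro ζ hζ
    exact image_eq_zero_of_notMem_tsupport hζ
  · intro ζ hζ
    exact dζ_eq_zero hζ
  · intro ζ hζ
    exact dζ_dζ_eq_zero hζ

lemma weakWave_product (hA₂ : Continuous A₂) (hB₂ : Continuous B₂)
    (hA : ∀ t, HasDerivAt A (A₁ t) t) (hA' : ∀ t, HasDerivAt A₁ (A₂ t) t)
    (hB : ∀ t, HasDerivAt B (B₁ t) t) (hB' : ∀ t, HasDerivAt B₁ (B₂ t) t)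
    (hφ : ContDiff ℝ ∞ φ) (hc : HasCompactSupport φ) (hT : tsupport φ ⊆ openTriangle) :
    WeakWave a b φ (fun p q => A p * B q) (fun p q => A₁ p * B₁ q) := by
  have cA : Continuous A := continuous_iff_continuousAt.2 fun t => (hA t).continuousAt
  have cA₁ : Continuous A₁ := continuous_iff_continuousAt.2 fun t => (hA' t).continuousAt
  have cB : Continuous B := continuous_iff_continuousAt.2 fun t => (hB t).continuousAt
  have cB₁ : Continuous B₁ := continuous_iff_continuousAt.2 fun t => (hB' t).continuousAt
  have cp := continuous_p a b
  have cq := continuous_q a b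
  have cw := continuous_w a b
  have ca := a.continuous_c
  have cb := b.continuous_c
  have cbm := b.continuous_m
  have cφ := hφ.continuous
  have cφ2 := (contDiff_dζ (contDiff_dζ hφ)).continuous
  have cl := a.continuous_lamTest₂ hφ
  -- the four double integrals produced by the two integrations by parts
  let f₁ : ℝ × ℝ → ℝ := fun x => w a b x.1 x.2 *
    (A (p a b x.1 x.2) * B (q a b x.1 x.2)) * a.lamTest₂ φ x
  let f₂ : ℝ × ℝ → ℝ := fun x => w a b x.1 x.2 *
    (A (p a b x.1 x.2) * B (q a b x.1 x.2)) * (b.m x.2 ^ 4 * dζ (dζ φ) x)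
  let g₁ : ℝ × ℝ → ℝ := fun x => w a b x.1 x.2 *
    (a.c x.1 * (A (p a b x.1 x.2) * B (q a b x.1 x.2)) +
      (A₂ (p a b x.1 x.2) * B (q a b x.1 x.2) + 2 * A₁ (p a b x.1 x.2) * B₁ (q a b x.1 x.2)
            + A (p a b x.1 x.2) * B₂ (q a b x.1 x.2))) * φ x
  let g₂ : ℝ × ℝ → ℝ := fun x => w a b x.1 x.2 *
    (b.c x.2 * (A (p a b x.1 x.2) * B (q a b x.1 x.2)) +
      (A₂ (p a b x.1 x.2) * B (q a b x.1 x.2) - 2 * A₁ (p a b x.1 x.2) * B₁ (q a b x.1 x.2)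
            + A (p a b x.1 x.2) * B₂ (q a b x.1 x.2))) * φ x
  have if₁ : Integrable f₁ := integrable_of_tsupport (by fun_prop) hc fun x hx => by
    simp [f₁, a.lamTest₂_eq_zero hx]
  have if₂ : Integrable f₂ := integrable_of_tsupport (by fun_prop) hc fun x hx => by
    simp [f₂, dζ_dζ_eq_zero hx]
  have ig₁ : Integrable g₁ := integrable_of_tsupport (by fun_prop) hc fun x hx => by
    simp [g₁, image_eq_zero_of_notMem_tsupport hx]
  have ig₂ : Integrable g₂ := integrable_of_tsupport (by fun_prop) hc fun x hx => by
    simp [g₂, image_eq_zero_of_notMem_tsupport hx]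
  have e₁ : ∫ x, f₁ x = ∫ x, g₁ x := by
    rw [Measure.volume_eq_prod] at if₁ ig₁ ⊢
    rw [integral_prod_symm f₁ if₁, integral_prod_symm g₁ ig₁]
    congr 1
    funext ζ
    have h := integral_product_left a b hA₂ hB₂ hA hA' hB hB' hφ hc hT ζ
    have hb := b.ne_zero ζ
    calc ∫ z, f₁ (z, ζ) = (b.m ζ ^ 3)⁻¹ * ∫ z, a.m z * (A (p a b z ζ) * B (q a b z ζ)) *
          a.lamTest₂ φ (z, ζ) := by
          rw [← integral_const_mul]
          congr 1; funext z; simp only [f₁, w]; ring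
      _ = ∫ z, g₁ (z, ζ) := by
          rw [h, ← integral_const_mul]
          congr 1; funext z
          have := a.ne_zero z
          simp only [g₁, w, c]; field_simp
  have e₂ : ∫ x, f₂ x = ∫ x, g₂ x := by
    rw [Measure.volume_eq_prod] at if₂ ig₂ ⊢
    rw [integral_prod f₂ if₂, integral_prod g₂ ig₂]
    congr 1
    funext z
    have h := integral_product_right a b hA₂ hB₂ hA hA' hB hB' hφ hc hT z
    calc ∫ ζ, f₂ (z, ζ) = a.m z * ∫ ζ, b.m ζ * (A (p a b z ζ) * B (q a b z ζ)) *
          dζ (dζ φ) (z, ζ) := by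
          rw [← integral_const_mul]
          congr 1; funext ζ
          have := b.ne_zero ζ
          simp only [f₂, w]; field_simp
      _ = ∫ ζ, g₂ (z, ζ) := by
          rw [h, ← integral_const_mul]
          congr 1; funext ζ
          have := b.ne_zero ζ
          simp only [g₂, w, c]; field_simp
  have e : ∫ x, ((f₁ x - f₂ x) - (g₁ x - g₂ x)) = 0 := by
    rw [integral_sub (f := fun x => f₁ x - f₂ x) (g := fun x => g₁ x - g₂ x) (if₁.sub if₂)
      (ig₁.sub ig₂), integral_sub if₁ if₂, integral_sub ig₁ ig₂,
      e₁, e₂, sub_self]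
  unfold WeakWave
  rw [← e]
  congr 1; funext x
  simp only [f₁, f₂, g₁, g₂, weakU]
  ring

end Product

end Profile

namespace Profile

variable {a b : Profile} {φ : ℝ × ℝ → ℝ}

lemma continuous_weakWave_integrand (a b : Profile) (hφ : ContDiff ℝ ∞ φ) {u f : ℝ → ℝ → ℝ}
    (hu : Continuous (Function.uncurry u)) (hf : Continuous (Function.uncurry f)) :
    Continuous fun x : ℝ × ℝ => u (p a b x.1 x.2) (q a b x.1 x.2) * weakU a b φ x
      - f (p a b x.1 x.2) (q a b x.1 x.2) * (4 * w a b x.1 x.2 * φ x) := by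
  have hpq := (continuous_p a b).prodMk (continuous_q a b)
  have h1 : Continuous fun x : ℝ × ℝ => u (p a b x.1 x.2) (q a b x.1 x.2) := hu.comp hpq
  have h2 : Continuous fun x : ℝ × ℝ => f (p a b x.1 x.2) (q a b x.1 x.2) := hf.comp hpq
  have h3 := continuous_weakU a b hφ
  have h4 := continuous_w a b
  have h5 := hφ.continuous
  fun_prop

lemma integrable_weakWave (a b : Profile) (hφ : ContDiff ℝ ∞ φ) (hc : HasCompactSupport φ)
    {u f : ℝ → ℝ → ℝ}
    (hu : Continuous (Function.uncurry u)) (hf : Continuous (Function.uncurry f)) :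
    Integrable fun x : ℝ × ℝ => u (p a b x.1 x.2) (q a b x.1 x.2) * weakU a b φ x
      - f (p a b x.1 x.2) (q a b x.1 x.2) * (4 * w a b x.1 x.2 * φ x) :=
  integrable_of_tsupport (continuous_weakWave_integrand a b hφ hu hf) hc fun x hx => by
    simp [weakU_eq_zero a b hx, image_eq_zero_of_notMem_tsupport hx]

lemma WeakWave.add {u f u' f' : ℝ → ℝ → ℝ} (hφ : ContDiff ℝ ∞ φ) (hc : HasCompactSupport φ)
    (hu : Continuous (Function.uncurry u)) (hf : Continuous (Function.uncurry f))
    (hu' : Continuous (Function.uncurry u')) (hf' : Continuous (Function.uncurry f'))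
    (h : WeakWave a b φ u f) (h' : WeakWave a b φ u' f') :
    WeakWave a b φ (fun p q => u p q + u' p q) (fun p q => f p q + f' p q) := by
  unfold WeakWave at *
  have := integral_add (integrable_weakWave a b hφ hc hu hf)
    (integrable_weakWave a b hφ hc hu' hf')
  rw [h, h', add_zero] at this
  rw [← this]
  congr 1; funext x; ring

lemma WeakWave.const_mul {u f : ℝ → ℝ → ℝ} (r : ℝ) (h : WeakWave a b φ u f) :
    WeakWave a b φ (fun p q => r * u p q) (fun p q => r * f p q) := by
  unfold WeakWave at *
  rw [← mul_zero r, ← h, ← integral_const_mul]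
  congr 1; funext x; ring

/-- The weak equation is stable under locally uniform limits. -/
lemma weakWave_of_approx {u f : ℝ → ℝ → ℝ} (hφ : ContDiff ℝ ∞ φ) (hc : HasCompactSupport φ)
    (hu : Continuous (Function.uncurry u)) (hf : Continuous (Function.uncurry f))
    (h : ∀ R > 0, ∀ ε > 0, ∃ u' f' : ℝ → ℝ → ℝ, Continuous (Function.uncurry u') ∧
      Continuous (Function.uncurry f') ∧ WeakWave a b φ u' f' ∧
      ∀ p q, |p| ≤ R → |q| ≤ R → |u p q - u' p q| ≤ ε ∧ |f p q - f' p q| ≤ ε) :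
    WeakWave a b φ u f := by
  have iU : Integrable fun x => |weakU a b φ x| :=
    (integrable_of_tsupport (continuous_weakU a b hφ) hc fun x hx => weakU_eq_zero a b hx).abs
  have iφ : Integrable fun x : ℝ × ℝ => |4 * w a b x.1 x.2 * φ x| := by
    have h4 := continuous_w a b
    have h5 := hφ.continuous
    refine (integrable_of_tsupport (φ := φ) (by fun_prop) hc fun x hx => ?_).abs
    simp [image_eq_zero_of_notMem_tsupport hx]
  obtain ⟨R₁, hR₁⟩ := hc.isCompact.exists_bound_of_continuousOn (continuous_p a b).continuousOn
  obtain ⟨R₂, hR₂⟩ := hc.isCompact.exists_bound_of_continuousOn (continuous_q a b).continuousOn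
  set C := ∫ x : ℝ × ℝ, (|weakU a b φ x| + |4 * w a b x.1 x.2 * φ x|) with hC
  have hC0 : 0 ≤ C := integral_nonneg fun x => by positivity
  set I := ∫ x : ℝ × ℝ, (u (p a b x.1 x.2) (q a b x.1 x.2) * weakU a b φ x
    - f (p a b x.1 x.2) (q a b x.1 x.2) * (4 * w a b x.1 x.2 * φ x)) with hI
  have key : ∀ ε > 0, |I| ≤ ε * C := by
    intro ε hε
    obtain ⟨u', f', hu', hf', hw, happ⟩ := h (max 1 (max R₁ R₂)) (by positivity) ε hε
    have hi := integrable_weakWave a b hφ hc hu hf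
    have hi' := integrable_weakWave a b hφ hc hu' hf'
    have e : I = ∫ x : ℝ × ℝ, ((u (p a b x.1 x.2) (q a b x.1 x.2) * weakU a b φ x
        - f (p a b x.1 x.2) (q a b x.1 x.2) * (4 * w a b x.1 x.2 * φ x))
        - (u' (p a b x.1 x.2) (q a b x.1 x.2) * weakU a b φ x
        - f' (p a b x.1 x.2) (q a b x.1 x.2) * (4 * w a b x.1 x.2 * φ x))) := by
      rw [integral_sub hi hi', hw, sub_zero]
    rw [e, hC, ← integral_const_mul]
    rw [← Real.norm_eq_abs]
    refine norm_integral_le_of_norm_le ((iU.add iφ).const_mul ε)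
      (Eventually.of_forall fun x => ?_)
    by_cases hx : x ∈ tsupport φ
    · have b1 : |p a b x.1 x.2| ≤ max 1 (max R₁ R₂) :=
        (hR₁ x hx).trans ((le_max_left _ _).trans (le_max_right _ _))
      have b2 : |q a b x.1 x.2| ≤ max 1 (max R₁ R₂) :=
        (hR₂ x hx).trans ((le_max_right _ _).trans (le_max_right _ _))
      obtain ⟨h1, h2⟩ := happ _ _ b1 b2
      rw [Real.norm_eq_abs]
      calc _ = |(u (p a b x.1 x.2) (q a b x.1 x.2) - u' (p a b x.1 x.2) (q a b x.1 x.2))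
              * weakU a b φ x - (f (p a b x.1 x.2) (q a b x.1 x.2)
              - f' (p a b x.1 x.2) (q a b x.1 x.2)) * (4 * w a b x.1 x.2 * φ x)| := by
            congr 1; ring
        _ ≤ ε * |weakU a b φ x| + ε * |4 * w a b x.1 x.2 * φ x| := by
            refine (abs_sub _ _).trans ?_
            rw [abs_mul, abs_mul]
            gcongr
        _ = _ := by ring
    · simp [weakU_eq_zero a b hx, image_eq_zero_of_notMem_tsupport hx]
  have h0 : |I| ≤ 0 := by
    refine le_of_forall_pos_le_add fun ε hε => ?_
    have := key (ε / (C + 1)) (by positivity)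
    refine this.trans ?_
    rw [div_mul_eq_mul_div, div_le_iff₀ (by positivity)]
    nlinarith
  exact abs_eq_zero.1 (le_antisymm h0 (abs_nonneg _))

lemma exists_hasDerivAt_approx {A : ℝ → ℝ} (hA : Continuous A) {ε : ℝ} (hε : 0 < ε) :
    ∃ B B₁ B₂ : ℝ → ℝ, Continuous B₂ ∧ (∀ t, HasDerivAt B (B₁ t) t) ∧
      (∀ t, HasDerivAt B₁ (B₂ t) t) ∧ ∀ t, |A t - B t| ≤ ε := by
  obtain ⟨g, hg, happ, -⟩ := hA.exists_contDiff_approx 2 (continuous_const (y := ε))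
    (fun _ => hε)
  have hg' : ContDiff ℝ (1 + 1) g := by convert hg using 1; norm_num
  have hd : ContDiff ℝ 1 (deriv g) := (contDiff_succ_iff_deriv.1 hg').2.2
  refine ⟨g, deriv g, deriv (deriv g), hd.continuous_deriv le_rfl,
    fun t => (hg.differentiable (by norm_num) t).hasDerivAt,
    fun t => (hd.differentiable (by norm_num) t).hasDerivAt, fun t => ?_⟩
  have := (happ t).le
  rwa [Real.dist_eq, abs_sub_comm] at this

lemma weakWave_left (hφ : ContDiff ℝ ∞ φ) (hc : HasCompactSupport φ)
    (hT : tsupport φ ⊆ openTriangle) {A : ℝ → ℝ} (hA : Continuous A) :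
    WeakWave a b φ (fun p _ => A p) (fun _ _ => 0) := by
  refine weakWave_of_approx hφ hc (hA.comp continuous_fst) continuous_const fun R _ ε hε => ?_
  obtain ⟨B, B₁, B₂, hB₂, hB, hB', happ⟩ := exists_hasDerivAt_approx hA hε
  have cB : Continuous B := continuous_iff_continuousAt.2 fun t => (hB t).continuousAt
  refine ⟨fun p _ => B p, fun _ _ => 0, cB.comp continuous_fst, continuous_const, ?_,
    fun p q _ _ => ⟨happ p, by simpa using hε.le⟩⟩
  simpa using weakWave_product a b (B := fun _ => 1) (B₁ := fun _ => 0) (B₂ := fun _ => 0) hB₂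
    continuous_const hB hB' (fun t => hasDerivAt_const t 1) (fun t => hasDerivAt_const t 0) hφ hc hT

lemma weakWave_right (hφ : ContDiff ℝ ∞ φ) (hc : HasCompactSupport φ)
    (hT : tsupport φ ⊆ openTriangle) {A : ℝ → ℝ} (hA : Continuous A) :
    WeakWave a b φ (fun _ q => A q) (fun _ _ => 0) := by
  refine weakWave_of_approx hφ hc (hA.comp continuous_snd) continuous_const fun R _ ε hε => ?_
  obtain ⟨B, B₁, B₂, hB₂, hB, hB', happ⟩ := exists_hasDerivAt_approx hA hε
  have cB : Continuous B := continuous_iff_continuousAt.2 fun t => (hB t).continuousAt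
  refine ⟨fun _ q => B q, fun _ _ => 0, cB.comp continuous_snd, continuous_const, ?_,
    fun p q _ _ => ⟨happ q, by simpa using hε.le⟩⟩
  simpa using weakWave_product a b (A := fun _ => 1) (A₁ := fun _ => 0) (A₂ := fun _ => 0)
    continuous_const hB₂ (fun t => hasDerivAt_const t 1) (fun t => hasDerivAt_const t 0) hB hB'
    hφ hc hT

lemma continuous_doubleIntegral {F : ℝ → ℝ → ℝ} (hF : Continuous (Function.uncurry F)) :
    Continuous (Function.uncurry fun p q => ∫ s in 0..p, ∫ t in 0..q, F s t) := by
  have := continuous_waveSol (a := fun _ => 0) (b := fun _ => 0) continuous_const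
    continuous_const hF
  simpa [waveSol, Function.uncurry_def] using this

/-- The separable functions `f(p) g(q)` with `f`, `g` of class `C¹`. -/
def separable : Submonoid C(ℝ × ℝ, ℝ) where
  carrier := {F | ∃ f g : ℝ → ℝ, ContDiff ℝ 1 f ∧ ContDiff ℝ 1 g ∧ ∀ x, F x = f x.1 * g x.2}
  one_mem' := ⟨fun _ => 1, fun _ => 1, contDiff_const, contDiff_const, fun x => by simp⟩
  mul_mem' := by
    rintro F G ⟨f, g, hf, hg, h⟩ ⟨f', g', hf', hg', h'⟩
    exact ⟨fun s => f s * f' s, fun t => g t * g' t, hf.mul hf', hg.mul hg', fun x => by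
      rw [ContinuousMap.mul_apply, h, h']; ring⟩

/-- On a square every continuous function is a uniform limit of sums of separable ones. -/
lemma exists_separable_approx (F : C(ℝ × ℝ, ℝ)) {R ε : ℝ} (hε : 0 < ε) :
    ∃ G ∈ Submodule.span ℝ (separable : Set C(ℝ × ℝ, ℝ)),
      ∀ p q, |p| ≤ R → |q| ≤ R → |F (p, q) - G (p, q)| ≤ ε := by
  have hsep : (Algebra.adjoin ℝ (separable : Set C(ℝ × ℝ, ℝ))).SeparatesPoints := by
    intro x y hxy
    by_cases h1 : x.1 = y.1
    · have h2 : x.2 ≠ y.2 := fun h2 => hxy (Prod.ext h1 h2)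
      exact ⟨_, ⟨⟨Prod.snd, continuous_snd⟩, Algebra.subset_adjoin
        ⟨fun _ => 1, id, contDiff_const, contDiff_id, fun x => by simp⟩, rfl⟩, h2⟩
    · exact ⟨_, ⟨⟨Prod.fst, continuous_fst⟩, Algebra.subset_adjoin
        ⟨id, fun _ => 1, contDiff_id, contDiff_const, fun x => by simp⟩, rfl⟩, h1⟩
  obtain ⟨G, hG, happ⟩ :=
    ContinuousMap.exists_mem_subalgebra_near_continuous_of_isCompact_of_separatesPoints hsep F
      ((isCompact_Icc (a := -R) (b := R)).prod (isCompact_Icc (a := -R) (b := R))) hε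
  refine ⟨G, ?_, fun p q hp hq => ?_⟩
  · have := Algebra.adjoin_eq_span ℝ (separable : Set C(ℝ × ℝ, ℝ))
    rw [Submonoid.closure_eq] at this
    rw [← this]; exact hG
  · have := (happ (p, q) ⟨abs_le.1 hp, abs_le.1 hq⟩).le
    rwa [Real.norm_eq_abs, abs_sub_comm] at this

lemma weakWave_doubleIntegral_of_span (hφ : ContDiff ℝ ∞ φ) (hc : HasCompactSupport φ)
    (hT : tsupport φ ⊆ openTriangle) {G : C(ℝ × ℝ, ℝ)}
    (hG : G ∈ Submodule.span ℝ (separable : Set C(ℝ × ℝ, ℝ))) :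
    WeakWave a b φ (fun p q => ∫ s in 0..p, ∫ t in 0..q, G (s, t)) (fun p q => G (p, q)) := by
  have cG : ∀ G : C(ℝ × ℝ, ℝ), Continuous (Function.uncurry fun p q => G (p, q)) :=
    fun G => G.continuous
  have hi : ∀ (G : C(ℝ × ℝ, ℝ)) s u v, IntervalIntegrable (fun t => G (s, t)) volume u v :=
    fun G s u v => (G.continuous.comp (.prodMk_right s)).intervalIntegrable u v
  have hi' : ∀ (G : C(ℝ × ℝ, ℝ)) r u v,
      IntervalIntegrable (fun s => ∫ t in 0..r, G (s, t)) volume u v := fun G r u v =>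
    (continuous_integral_right (cG G) continuous_id continuous_const
      continuous_const).intervalIntegrable u v
  induction hG using Submodule.span_induction with
  | mem G hG =>
    obtain ⟨f, g, hf, hg, h⟩ := hG
    have hf' := fun t => (hf.continuous.integral_hasStrictDerivAt 0 t).hasDerivAt
    have hg' := fun t => (hg.continuous.integral_hasStrictDerivAt 0 t).hasDerivAt
    have := weakWave_product a b (hf.continuous_deriv le_rfl) (hg.continuous_deriv le_rfl)
      hf' (fun t => (hf.differentiable (by norm_num) t).hasDerivAt)
      hg' (fun t => (hg.differentiable (by norm_num) t).hasDerivAt) hφ hc hT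
    simpa [h] using this
  | zero => simp [WeakWave]
  | add G G' _ _ h h' =>
    have := h.add hφ hc (continuous_doubleIntegral (cG G)) (cG G)
      (continuous_doubleIntegral (cG G')) (cG G') h'
    convert this using 4 with p q
    · rw [← intervalIntegral.integral_add (hi' _ _ _ _) (hi' _ _ _ _)]
      congr 1; funext s
      exact intervalIntegral.integral_add (hi _ _ _ _) (hi _ _ _ _)
    · rfl
  | smul r G _ h =>
    have := h.const_mul r
    convert this using 4 with p q
    · rw [← intervalIntegral.integral_const_mul]
      congr 1; funext s
      exact intervalIntegral.integral_const_mul _ _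
    · rfl

lemma weakWave_doubleIntegral (hφ : ContDiff ℝ ∞ φ) (hc : HasCompactSupport φ)
    (hT : tsupport φ ⊆ openTriangle) {F : ℝ → ℝ → ℝ} (hF : Continuous (Function.uncurry F)) :
    WeakWave a b φ (fun p q => ∫ s in 0..p, ∫ t in 0..q, F s t) F := by
  refine weakWave_of_approx hφ hc (continuous_doubleIntegral hF) hF fun R hR ε hε => ?_
  obtain ⟨G, hG, happ⟩ := exists_separable_approx ⟨Function.uncurry F, hF⟩ (R := R)
    (ε := ε / (R * R + 1)) (by positivity)
  have cG : Continuous (Function.uncurry fun p q => G (p, q)) := G.continuous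
  refine ⟨_, _, continuous_doubleIntegral cG, cG,
    weakWave_doubleIntegral_of_span hφ hc hT hG, fun p q hp hq => ⟨?_, ?_⟩⟩
  · have hmem : ∀ {r s : ℝ}, |r| ≤ R → s ∈ uIoc 0 r → |s| ≤ R := by
      intro r s hr hs
      refine le_trans ?_ hr
      rcases le_total 0 r with h | h
      · rw [uIoc_of_le h] at hs
        rw [abs_of_pos hs.1, abs_of_nonneg h]; exact hs.2
      · rw [uIoc_of_ge h] at hs
        rw [abs_of_nonpos hs.2, abs_of_nonpos h]; linarith [hs.1]
    have hiF : ∀ s u v, IntervalIntegrable (fun t => F s t) volume u v := fun s u v =>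
      (hF.comp (.prodMk_right s)).intervalIntegrable u v
    have hiG : ∀ s u v, IntervalIntegrable (fun t => G (s, t)) volume u v := fun s u v =>
      (G.continuous.comp (.prodMk_right s)).intervalIntegrable u v
    have hiF' : IntervalIntegrable (fun s => ∫ t in 0..q, F s t) volume 0 p :=
      (continuous_integral_right hF continuous_id continuous_const
        continuous_const).intervalIntegrable _ _
    have hiG' : IntervalIntegrable (fun s => ∫ t in 0..q, G (s, t)) volume 0 p :=
      (continuous_integral_right cG continuous_id continuous_const
        continuous_const).intervalIntegrable _ _
    rw [← intervalIntegral.integral_sub hiF' hiG']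
    have hin : ∀ s ∈ uIoc 0 p, ‖(∫ t in 0..q, F s t) - ∫ t in 0..q, G (s, t)‖
        ≤ ε / (R * R + 1) * R := by
      intro s hs
      rw [← intervalIntegral.integral_sub (hiF _ _ _) (hiG _ _ _)]
      refine (intervalIntegral.norm_integral_le_of_norm_le_const fun t ht =>
        happ s t (hmem hp hs) (hmem hq ht)).trans ?_
      rw [sub_zero]; gcongr
    refine (intervalIntegral.norm_integral_le_of_norm_le_const hin).trans ?_
    rw [sub_zero]
    calc ε / (R * R + 1) * R * |p| ≤ ε / (R * R + 1) * R * R := by gcongr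
      _ = ε * (R * R) / (R * R + 1) := by ring
      _ ≤ ε := by rw [div_le_iff₀ (by positivity)]; nlinarith
  · refine (happ p q hp hq).trans ?_
    rw [div_le_iff₀ (by positivity)]
    nlinarith [mul_pos hR hR]

/-- A sum of two travelling waves and a double integral of `F` solves `∂p ∂q u = F` weakly; no
differentiability of the travelling waves is needed. -/
lemma weakWave_sum (hφ : ContDiff ℝ ∞ φ) (hc : HasCompactSupport φ)
    (hT : tsupport φ ⊆ openTriangle) {A B : ℝ → ℝ} (hA : Continuous A) (hB : Continuous B)
    {F : ℝ → ℝ → ℝ} (hF : Continuous (Function.uncurry F)) :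
    WeakWave a b φ (fun p q => A p + B q + ∫ s in 0..p, ∫ t in 0..q, F s t) F := by
  have h0 : Continuous (Function.uncurry fun _ _ : ℝ => (0 : ℝ)) := continuous_const
  have cA : Continuous (Function.uncurry fun p _ : ℝ => A p) := hA.comp continuous_fst
  have cB : Continuous (Function.uncurry fun _ q : ℝ => B q) := hB.comp continuous_snd
  have h1 := (weakWave_left (a := a) (b := b) hφ hc hT hA).add hφ hc cA h0 cB h0
    (weakWave_right hφ hc hT hB)
  have cAB : Continuous (Function.uncurry fun p q : ℝ => A p + B q) := cA.add cB
  have h00 : Continuous (Function.uncurry fun _ _ : ℝ => (0 : ℝ) + 0) := continuous_const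
  have h2 := h1.add hφ hc cAB h00 (continuous_doubleIntegral hF) hF
    (weakWave_doubleIntegral hφ hc hT hF)
  simpa using h2

end Profile

namespace Profile

variable {a b : Profile} {φ : ℝ × ℝ → ℝ}

lemma isOpen_openTriangle : IsOpen openTriangle :=
  (isOpen_lt continuous_const continuous_snd).inter
    ((isOpen_lt continuous_snd continuous_fst).inter (isOpen_lt continuous_fst continuous_const))

/-- In the coordinates `(z, ζ)`, the weak wave equation for the amplitude `u` is the weak kernel
equation for `w u`. -/
lemma WeakWave.kernel_equation {u f : ℝ → ℝ → ℝ} (hφ : ContDiff ℝ ∞ φ) (hc : HasCompactSupport φ)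
    (hT : tsupport φ ⊆ openTriangle)
    (hu : Continuous (Function.uncurry u)) (hf : Continuous (Function.uncurry f))
    (h : WeakWave a b φ u f) {lam lam' : ℝ → ℝ} (hlam : ∀ z ∈ Ioo (0 : ℝ) 1, lam z = a.m z ^ 4)
    (hlam' : ∀ z ∈ Ioo (0 : ℝ) 1, lam' z = b.m z ^ 4) {K S : ℝ → ℝ → ℝ}
    (hK : ∀ x ∈ openTriangle, K x.1 x.2 = w a b x.1 x.2 * u (p a b x.1 x.2) (q a b x.1 x.2))
    (hS : ∀ x ∈ openTriangle, S x.1 x.2 = w a b x.1 x.2 *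
      ((a.c x.1 - b.c x.2) * u (p a b x.1 x.2) (q a b x.1 x.2)
        + 4 * f (p a b x.1 x.2) (q a b x.1 x.2))) :
    ∫ x in openTriangle, (K x.1 x.2 * iteratedDeriv 2 (fun s => lam s * φ (s, x.2)) x.1
        - K x.1 x.2 * lam' x.2 * iteratedDeriv 2 (fun s => φ (x.1, s)) x.2)
      = ∫ x in openTriangle, S x.1 x.2 * φ x := by
  have hpq := (continuous_p a b).prodMk (continuous_q a b)
  have cu : Continuous fun x : ℝ × ℝ => u (p a b x.1 x.2) (q a b x.1 x.2) := hu.comp hpq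
  have cf : Continuous fun x : ℝ × ℝ => f (p a b x.1 x.2) (q a b x.1 x.2) := hf.comp hpq
  have cw := continuous_w a b
  have ca := a.continuous_c
  have cb := b.continuous_c
  have cbm := b.continuous_m
  have cφ := hφ.continuous
  have cφ2 := (contDiff_dζ (contDiff_dζ hφ)).continuous
  have cl := a.continuous_lamTest₂ hφ
  let L : ℝ × ℝ → ℝ := fun x => w a b x.1 x.2 * u (p a b x.1 x.2) (q a b x.1 x.2) *
    (a.lamTest₂ φ x - b.m x.2 ^ 4 * dζ (dζ φ) x)
  let R : ℝ × ℝ → ℝ := fun x => w a b x.1 x.2 *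
      ((a.c x.1 - b.c x.2) * u (p a b x.1 x.2) (q a b x.1 x.2)
        + 4 * f (p a b x.1 x.2) (q a b x.1 x.2)) * φ x
  have zL : ∀ x ∉ tsupport φ, L x = 0 := fun x hx => by
    simp [L, a.lamTest₂_eq_zero hx, dζ_dζ_eq_zero hx]
  have zR : ∀ x ∉ tsupport φ, R x = 0 := fun x hx => by
    simp [R, image_eq_zero_of_notMem_tsupport hx]
  have iL : Integrable L := integrable_of_tsupport (by fun_prop) hc zL
  have iR : Integrable R := integrable_of_tsupport (by fun_prop) hc zR
  have hm : MeasurableSet openTriangle := isOpen_openTriangle.measurableSet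
  have hLR : ∫ x, L x = ∫ x, R x := by
    rw [← sub_eq_zero, ← integral_sub iL iR, ← h]
    congr 1; funext x
    simp only [L, R, weakU]
    ring
  have e1 : ∫ x in openTriangle, L x = ∫ x, L x :=
    setIntegral_eq_integral_of_forall_compl_eq_zero fun x hx => zL x fun h => hx (hT h)
  have e2 : ∫ x in openTriangle, R x = ∫ x, R x :=
    setIntegral_eq_integral_of_forall_compl_eq_zero fun x hx => zR x fun h => hx (hT h)
  have e3 : ∫ x in openTriangle, S x.1 x.2 * φ x = ∫ x in openTriangle, R x :=
    setIntegral_congr_fun hm fun x hx => by simp only [R, hS x hx]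
  rw [e3, e2, ← hLR, ← e1]
  refine setIntegral_congr_fun hm fun x hx => ?_
  have h1 : x.1 ∈ Ioo (0 : ℝ) 1 := ⟨hx.1.trans hx.2.1, hx.2.2⟩
  have h2 : x.2 ∈ Ioo (0 : ℝ) 1 := ⟨hx.1, hx.2.1.trans hx.2.2⟩
  have d1 : iteratedDeriv 2 (fun s => lam s * φ (s, x.2)) x.1 = a.lamTest₂ φ x := by
    have ev : (fun s => lam s * φ (s, x.2)) =ᶠ[𝓝 x.1] fun s => a.m s ^ 4 * φ (s, x.2) := by
      filter_upwards [isOpen_Ioo.mem_nhds h1] with s hs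
      rw [hlam s hs]
    rw [ev.iteratedDeriv_eq 2, iteratedDeriv_succ, iteratedDeriv_one]
    have ev' : deriv (fun s => a.m s ^ 4 * φ (s, x.2)) =ᶠ[𝓝 x.1]
        fun s => a.lamTest₁ φ (s, x.2) := by
      filter_upwards [isOpen_Ioo.mem_nhds h1] with s hs
      exact (a.hasDerivAt_lamTest hφ hs x.2).deriv
    rw [ev'.deriv_eq]
    exact (a.hasDerivAt_lamTest₁ hφ h1 x.2).deriv
  have d2 : iteratedDeriv 2 (fun s => φ (x.1, s)) x.2 = dζ (dζ φ) x := by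
    rw [iteratedDeriv_succ, iteratedDeriv_one]
    have : deriv (fun s => φ (x.1, s)) = fun s => dζ φ (x.1, s) :=
      funext fun s => (hasDerivAt_dζ hφ x.1 s).deriv
    rw [this]
    exact (hasDerivAt_dζ (contDiff_dζ hφ) x.1 x.2).deriv
  simp only [L]
  rw [d1, d2, hK x hx, hlam' _ h2]
  ring

end Profile

/-! ### Piecewise smooth fields on the triangle -/

/-- `f` is differentiable in each variable on the unit square, one-sidedly on the boundary, with
partial derivatives `fz`, `fζ`; all three functions are continuous on the whole plane. -/
structure IsC1OnSquare (f fz fζ : ℝ → ℝ → ℝ) : Prop where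
  continuous : Continuous (Function.uncurry f)
  continuous_z : Continuous (Function.uncurry fz)
  continuous_ζ : Continuous (Function.uncurry fζ)
  hasDeriv_z : ∀ z ∈ Icc (0 : ℝ) 1, ∀ ζ, HasDerivWithinAt (fun s => f s ζ) (fz z ζ) (Icc 0 1) z
  hasDeriv_ζ : ∀ z, ∀ ζ ∈ Icc (0 : ℝ) 1, HasDerivWithinAt (fun s => f z s) (fζ z ζ) (Icc 0 1) ζ

/-- The cell between the graphs of two `C¹` functions over `[0, 1]`. -/
def unitCell (l u : ℝ → ℝ) (hl : ContDiff ℝ 1 l) (hu : ContDiff ℝ 1 u)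
    (h : ∀ z ∈ Ioo (0 : ℝ) 1, l z < u z) : Cell where
  a := 0
  b := 1
  lower := l
  upper := u
  a_lt_b := zero_lt_one
  lower_contDiffOn := hl.contDiffOn
  upper_contDiffOn := hu.contDiffOn
  lower_lt_upper := h

section unitCell

variable {l u : ℝ → ℝ} {hl : ContDiff ℝ 1 l} {hu : ContDiff ℝ 1 u}
  {h : ∀ z ∈ Ioo (0 : ℝ) 1, l z < u z}

lemma inner_subset_closed {x : ℝ × ℝ} (hx : x ∈ (unitCell l u hl hu h).inner) :
    x ∈ (unitCell l u hl hu h).closed :=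
  ⟨Ioo_subset_Icc_self hx.1, Ioo_subset_Icc_self hx.2⟩

lemma isOpen_unitCell_inner : IsOpen (unitCell l u hl hu h).inner := by
  have := hl.continuous
  have := hu.continuous
  exact (isOpen_Ioo.preimage continuous_fst).inter
    ((isOpen_lt (f := fun x : ℝ × ℝ => l x.1) (by fun_prop) continuous_snd).inter
      (isOpen_lt (g := fun x : ℝ × ℝ => u x.1) continuous_snd (by fun_prop)))

lemma hasDerivAt_of_eqOn_inner {f fz fζ g gz gζ : ℝ → ℝ → ℝ} (hg : IsC1OnSquare g gz gζ)
    (h01 : ∀ x ∈ (unitCell l u hl hu h).inner, x.2 ∈ Ioo (0 : ℝ) 1)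
    (hf : ∀ x ∈ (unitCell l u hl hu h).inner, f x.1 x.2 = g x.1 x.2)
    (hfz : ∀ x ∈ (unitCell l u hl hu h).inner, fz x.1 x.2 = gz x.1 x.2)
    (hfζ : ∀ x ∈ (unitCell l u hl hu h).inner, fζ x.1 x.2 = gζ x.1 x.2)
    {x : ℝ × ℝ} (hx : x ∈ (unitCell l u hl hu h).inner) :
    HasDerivAt (fun s => f s x.2) (fz x.1 x.2) x.1 ∧
      HasDerivAt (fun s => f x.1 s) (fζ x.1 x.2) x.2 := by
  have hn := isOpen_unitCell_inner.mem_nhds hx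
  have h1 : x.1 ∈ Ioo (0 : ℝ) 1 := hx.1
  have h2 := h01 x hx
  constructor
  · rw [hfz x hx]
    refine ((hg.hasDeriv_z x.1 (Ioo_subset_Icc_self h1) x.2).hasDerivAt
      (Icc_mem_nhds h1.1 h1.2)).congr_of_eventuallyEq ?_
    have : Tendsto (fun s : ℝ => (s, x.2)) (𝓝 x.1) (𝓝 x) :=
      (Continuous.prodMk_left x.2).continuousAt
    filter_upwards [this hn] with s hs
    exact hf _ hs
  · rw [hfζ x hx]
    refine ((hg.hasDeriv_ζ x.1 x.2 (Ioo_subset_Icc_self h2)).hasDerivAt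
      (Icc_mem_nhds h2.1 h2.2)).congr_of_eventuallyEq ?_
    have : Tendsto (fun s : ℝ => (x.1, s)) (𝓝 x.2) (𝓝 x) :=
      (Continuous.prodMk_right x.1).continuousAt
    filter_upwards [this hn] with s hs
    exact hf _ hs

end unitCell

/-- A field that agrees with a smooth one on the triangle is piecewise smooth with a single cell. -/
lemma piecewiseC1On_of_eqOn {f fz fζ g gz gζ : ℝ → ℝ → ℝ} (hg : IsC1OnSquare g gz gζ)
    (hf : ∀ x ∈ closedTriangle, f x.1 x.2 = g x.1 x.2)
    (hfz : ∀ x ∈ closedTriangle, fz x.1 x.2 = gz x.1 x.2)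
    (hfζ : ∀ x ∈ closedTriangle, fζ x.1 x.2 = gζ x.1 x.2) :
    PiecewiseC1On closedTriangle f fz fζ := by
  let c : Cell := unitCell (fun _ => 0) (fun z => z) contDiff_const contDiff_id fun z hz => hz.1
  have hcl : c.closed = closedTriangle := by
    ext x
    constructor
    · rintro ⟨h1, h2⟩; exact ⟨h2.1, h2.2, h1.2⟩
    · rintro ⟨h1, h2, h3⟩; exact ⟨⟨h1.trans h2, h3⟩, h1, h2⟩
  have hin : ∀ x ∈ c.inner, x ∈ closedTriangle := fun x hx => hcl ▸ inner_subset_closed hx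
  have hun : (⋃ _ : Fin 1, c.closed) = closedTriangle := by rw [iUnion_const, hcl]
  have hpc : ∀ {f g : ℝ → ℝ → ℝ}, Continuous (Function.uncurry g) →
      (∀ x ∈ closedTriangle, f x.1 x.2 = g x.1 x.2) →
      PiecewiseContinuousWrt (fun _ : Fin 1 => c) f := by
    intro f g hg h
    refine ⟨fun _ => Function.uncurry g, fun _ => ⟨hg.continuousOn, fun x hx => h x (hin x hx)⟩,
      fun x hx => ⟨0, ?_, ?_⟩⟩
    · rw [hun] at hx; rwa [hcl]
    · rw [hun] at hx; exact h x hx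
  refine ⟨1, fun _ => c, ⟨hun, fun k l hkl => (hkl (Subsingleton.elim k l)).elim⟩,
    hpc hg.continuous hf, hpc hg.continuous_z hfz, hpc hg.continuous_ζ hfζ, fun _ x hx => ?_⟩
  have h01 : ∀ x ∈ c.inner, x.2 ∈ Ioo (0 : ℝ) 1 :=
    fun x hx => ⟨hx.2.1, lt_trans (hx.2.2 : x.2 < x.1) hx.1.2⟩
  exact hasDerivAt_of_eqOn_inner hg h01
    (fun x hx => hf x (hin x hx)) (fun x hx => hfz x (hin x hx)) (fun x hx => hfζ x (hin x hx)) hx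

/-- A field that agrees with one smooth field below a `C¹` curve through the triangle, and with
another one above the curve, is piecewise smooth with two cells. -/
lemma piecewiseC1On_of_eqOn_curve {f fz fζ g gz gζ k kz kζ : ℝ → ℝ → ℝ}
    (hg : IsC1OnSquare g gz gζ) (hk : IsC1OnSquare k kz kζ)
    {κ : ℝ → ℝ} (hκ : ContDiff ℝ 1 κ) (hκ0 : κ 0 = 0) (hκ1 : ∀ z ∈ Ioc (0 : ℝ) 1, κ z ∈ Ioo 0 z)
    (hf : ∀ x ∈ closedTriangle, x.2 ≤ κ x.1 → f x.1 x.2 = g x.1 x.2)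
    (hfz : ∀ x ∈ closedTriangle, x.2 ≤ κ x.1 → fz x.1 x.2 = gz x.1 x.2)
    (hfζ : ∀ x ∈ closedTriangle, x.2 ≤ κ x.1 → fζ x.1 x.2 = gζ x.1 x.2)
    (hf' : ∀ x ∈ closedTriangle, κ x.1 < x.2 → f x.1 x.2 = k x.1 x.2)
    (hfz' : ∀ x ∈ closedTriangle, κ x.1 < x.2 → fz x.1 x.2 = kz x.1 x.2)
    (hfζ' : ∀ x ∈ closedTriangle, κ x.1 < x.2 → fζ x.1 x.2 = kζ x.1 x.2) :
    PiecewiseC1On closedTriangle f fz fζ := by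
  let c₁ : Cell := unitCell (fun _ => 0) κ contDiff_const hκ
    fun z hz => (hκ1 z (Ioo_subset_Ioc_self hz)).1
  let c₂ : Cell := unitCell κ (fun z => z) hκ contDiff_id
    fun z hz => (hκ1 z (Ioo_subset_Ioc_self hz)).2
  let c : Fin 2 → Cell := ![c₁, c₂]
  have hκ01 : ∀ z ∈ Icc (0 : ℝ) 1, 0 ≤ κ z ∧ κ z ≤ z := by
    intro z hz
    rcases hz.1.eq_or_lt with rfl | h
    · simp [hκ0]
    · exact ⟨(hκ1 z ⟨h, hz.2⟩).1.le, (hκ1 z ⟨h, hz.2⟩).2.le⟩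
  have hcl₁ : ∀ x, x ∈ c₁.closed ↔ x ∈ closedTriangle ∧ x.2 ≤ κ x.1 := by
    intro x
    constructor
    · rintro ⟨h1, h2⟩; exact ⟨⟨h2.1, h2.2.trans (hκ01 _ h1).2, h1.2⟩, h2.2⟩
    · rintro ⟨⟨h1, h2, h3⟩, h4⟩; exact ⟨⟨h1.trans h2, h3⟩, h1, h4⟩
  have hcl₂ : ∀ x, x ∈ c₂.closed ↔ x ∈ closedTriangle ∧ κ x.1 ≤ x.2 := by
    intro x
    constructor
    · rintro ⟨h1, h2⟩; exact ⟨⟨(hκ01 _ h1).1.trans h2.1, h2.2, h1.2⟩, h2.1⟩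
    · rintro ⟨⟨h1, h2, h3⟩, h4⟩; exact ⟨⟨h1.trans h2, h3⟩, h4, h2⟩
  have hin₁ : ∀ x ∈ c₁.inner, x ∈ closedTriangle ∧ x.2 ≤ κ x.1 :=
    fun x hx => (hcl₁ x).1 (inner_subset_closed hx)
  have hin₂ : ∀ x ∈ c₂.inner, x ∈ closedTriangle ∧ κ x.1 < x.2 :=
    fun x hx => ⟨((hcl₂ x).1 (inner_subset_closed hx)).1, hx.2.1⟩
  have hun : (⋃ k : Fin 2, (c k).closed) = closedTriangle := by
    ext x
    simp only [mem_iUnion, Fin.exists_fin_two]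
    change x ∈ c₁.closed ∨ x ∈ c₂.closed ↔ _
    rw [hcl₁, hcl₂, ← and_or_left]
    exact and_iff_left (le_total _ _)
  have hpc : ∀ {f g k : ℝ → ℝ → ℝ}, Continuous (Function.uncurry g) →
      Continuous (Function.uncurry k) →
      (∀ x ∈ closedTriangle, x.2 ≤ κ x.1 → f x.1 x.2 = g x.1 x.2) →
      (∀ x ∈ closedTriangle, κ x.1 < x.2 → f x.1 x.2 = k x.1 x.2) →
      PiecewiseContinuousWrt c f := by
    intro f g k hg hk h h'
    refine ⟨![Function.uncurry g, Function.uncurry k], ?_, fun x hx => ?_⟩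
    · rw [Fin.forall_fin_two]
      exact ⟨⟨hg.continuousOn, fun x hx => h x (hin₁ x hx).1 (hin₁ x hx).2⟩,
        hk.continuousOn, fun x hx => h' x (hin₂ x hx).1 (hin₂ x hx).2⟩
    · rw [hun] at hx
      rw [Fin.exists_fin_two]
      rcases le_or_gt x.2 (κ x.1) with hle | hlt
      · exact Or.inl ⟨(hcl₁ x).2 ⟨hx, hle⟩, h x hx hle⟩
      · exact Or.inr ⟨(hcl₂ x).2 ⟨hx, hlt.le⟩, h' x hx hlt⟩
  have hd : ∀ x, x ∈ c₁.inner → x ∈ c₂.inner → False :=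
    fun x h1 h2 => absurd h2.2.1 (not_lt.2 (hin₁ x h1).2)
  have h01₁ : ∀ x ∈ c₁.inner, x.2 ∈ Ioo (0 : ℝ) 1 := fun x hx =>
    ⟨hx.2.1, lt_of_lt_of_le hx.2.2 ((hκ01 _ (Ioo_subset_Icc_self hx.1)).2.trans hx.1.2.le)⟩
  have h01₂ : ∀ x ∈ c₂.inner, x.2 ∈ Ioo (0 : ℝ) 1 := fun x hx =>
    ⟨lt_of_le_of_lt (hκ01 _ (Ioo_subset_Icc_self hx.1)).1 hx.2.1,
      lt_trans (hx.2.2 : x.2 < x.1) hx.1.2⟩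
  refine ⟨2, c, ⟨hun, ?_⟩, hpc hg.continuous hk.continuous hf hf',
    hpc hg.continuous_z hk.continuous_z hfz hfz', hpc hg.continuous_ζ hk.continuous_ζ hfζ hfζ', ?_⟩
  · intro i j hij
    fin_cases i <;> fin_cases j
    · exact (hij rfl).elim
    · exact disjoint_left.2 fun x h1 h2 => hd x h1 h2
    · exact disjoint_left.2 fun x h1 h2 => hd x h2 h1
    · exact (hij rfl).elim
  · rw [Fin.forall_fin_two]
    constructor
    · intro x hx
      exact hasDerivAt_of_eqOn_inner hg h01₁
        (fun x hx => hf x (hin₁ x hx).1 (hin₁ x hx).2)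
        (fun x hx => hfz x (hin₁ x hx).1 (hin₁ x hx).2)
        (fun x hx => hfζ x (hin₁ x hx).1 (hin₁ x hx).2) hx
    · intro x hx
      exact hasDerivAt_of_eqOn_inner hk h01₂
        (fun x hx => hf' x (hin₂ x hx).1 (hin₂ x hx).2)
        (fun x hx => hfz' x (hin₂ x hx).1 (hin₂ x hx).2)
        (fun x hx => hfζ' x (hin₂ x hx).1 (hin₂ x hx).2) hx

/-! ### Kernels built from waves -/

namespace Profile

variable (a b : Profile) (α β : ℝ → ℝ) (F : ℝ → ℝ → ℝ)

/-- The kernel with amplitude `waveSol α β F`. -/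
def waveKernel (z ζ : ℝ) : ℝ := w a b z ζ * waveSol α β F (p a b z ζ) (q a b z ζ)

/-- The `z`-derivative of `waveKernel`. -/
def waveKernelZ (z ζ : ℝ) : ℝ :=
  a.d z * (b.m ζ ^ 3)⁻¹ * waveSol α β F (p a b z ζ) (q a b z ζ)
    + w a b z ζ * ((waveP α F (p a b z ζ) (q a b z ζ) + waveQ β F (p a b z ζ) (q a b z ζ))
      * (a.m z ^ 2)⁻¹)

/-- The `ζ`-derivative of `waveKernel`. -/
def waveKernelζ (z ζ : ℝ) : ℝ :=
  -(3 * a.m z * b.d ζ * (b.m ζ ^ 4)⁻¹) * waveSol α β F (p a b z ζ) (q a b z ζ)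
    + w a b z ζ * ((waveP α F (p a b z ζ) (q a b z ζ) - waveQ β F (p a b z ζ) (q a b z ζ))
      * (b.m ζ ^ 2)⁻¹)

variable {α β F}

lemma isC1OnSquare_waveKernel (hα : Continuous α) (hβ : Continuous β)
    (hF : Continuous (Function.uncurry F)) :
    IsC1OnSquare (waveKernel a b α β F) (waveKernelZ a b α β F) (waveKernelζ a b α β F) := by
  have hpq := (continuous_p a b).prodMk (continuous_q a b)
  have cS : Continuous fun x : ℝ × ℝ => waveSol α β F (p a b x.1 x.2) (q a b x.1 x.2) :=
    (continuous_waveSol hα hβ hF).comp hpq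
  have cP : Continuous fun x : ℝ × ℝ => waveP α F (p a b x.1 x.2) (q a b x.1 x.2) :=
    (continuous_waveP hα hF).comp hpq
  have cQ : Continuous fun x : ℝ × ℝ => waveQ β F (p a b x.1 x.2) (q a b x.1 x.2) :=
    (continuous_waveQ hβ hF).comp hpq
  have cw := continuous_w a b
  have cam := a.continuous_m
  have cad := a.continuous_d
  have cbd := b.continuous_d
  have ca2 := a.continuous_inv_sq
  have cb2 := b.continuous_inv_sq
  have cb3 : Continuous fun ζ => (b.m ζ ^ 3)⁻¹ :=
    (b.continuous_m.pow 3).inv₀ fun z => pow_ne_zero 3 (b.ne_zero z)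
  have cb4 : Continuous fun ζ => (b.m ζ ^ 4)⁻¹ :=
    (b.continuous_m.pow 4).inv₀ fun z => pow_ne_zero 4 (b.ne_zero z)
  have ca2' : Continuous fun x : ℝ × ℝ => (a.m x.1 ^ 2)⁻¹ := ca2.comp continuous_fst
  have cb2' : Continuous fun x : ℝ × ℝ => (b.m x.2 ^ 2)⁻¹ := cb2.comp continuous_snd
  have cb3' : Continuous fun x : ℝ × ℝ => (b.m x.2 ^ 3)⁻¹ := cb3.comp continuous_snd
  have cb4' : Continuous fun x : ℝ × ℝ => (b.m x.2 ^ 4)⁻¹ := cb4.comp continuous_snd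
  refine ⟨cw.mul cS, ?_, ?_, fun z hz ζ => ?_, fun z ζ hζ => ?_⟩
  · change Continuous fun x : ℝ × ℝ => waveKernelZ a b α β F x.1 x.2
    unfold waveKernelZ; fun_prop
  · change Continuous fun x : ℝ × ℝ => waveKernelζ a b α β F x.1 x.2
    unfold waveKernelζ; fun_prop
  · have hw : HasDerivWithinAt (fun s => w a b s ζ) (a.d z * (b.m ζ ^ 3)⁻¹) (Icc 0 1) z :=
      (a.hasDeriv z hz).mul_const _
    refine (hw.mul (hasDerivWithinAt_waveSol_comp hα hβ hF
      (hasDerivAt_p_left a b z ζ).hasDerivWithinAt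
      (hasDerivAt_q_left a b z ζ).hasDerivWithinAt)).congr_deriv ?_
    simp only [waveKernelZ]
    ring
  · have hm := b.ne_zero ζ
    have hw : HasDerivWithinAt (fun s => w a b z s) (-(3 * a.m z * b.d ζ * (b.m ζ ^ 4)⁻¹))
        (Icc 0 1) ζ := by
      refine ((((b.hasDeriv ζ hζ).pow 3).inv (pow_ne_zero 3 hm)).const_mul (a.m z)).congr_deriv ?_
      simp only [Pi.pow_apply]
      field_simp
      simp
      ring
    refine (hw.mul (hasDerivWithinAt_waveSol_comp hα hβ hF
      (hasDerivAt_p_right a b z ζ).hasDerivWithinAt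
      (hasDerivAt_q_right a b z ζ).hasDerivWithinAt)).congr_deriv ?_
    simp only [waveKernelζ]
    ring

end Profile

namespace Profile

variable (a b : Profile)

/-! ### Geometry of the characteristic coordinates -/

lemma y_clamp_sub_le {s t : ℝ} (h : s ≤ t) :
    a.y (clamp t) - a.y (clamp s) ≤ a.y t - a.y s := by
  have hm := a.strictMono_y.monotone
  rcases le_total t 0 with ht | ht
  · have e1 : clamp t = clamp s := by
      unfold clamp
      rw [max_eq_left ((min_le_left _ _).trans ht),
        max_eq_left ((min_le_left _ _).trans (h.trans ht))]
    rw [e1, sub_self]; exact sub_nonneg.2 (hm h)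
  · rcases le_total 1 s with hs | hs
    · have e1 : clamp t = clamp s := by
        unfold clamp
        rw [min_eq_right hs, min_eq_right (hs.trans h)]
      rw [e1, sub_self]; exact sub_nonneg.2 (hm h)
    · have h1 : clamp t ≤ t := max_le ht (min_le_left _ _)
      have h2 : s ≤ clamp s := by
        unfold clamp; rw [min_eq_left hs]; exact le_max_right _ _
      exact sub_le_sub (hm h1) (hm h2)

lemma inv_sq_le_inv_sq {a b : Profile} {z : ℝ} (h : b.m z ≤ a.m z) :
    (a.m z ^ 2)⁻¹ ≤ (b.m z ^ 2)⁻¹ := by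
  have := b.pos z
  gcongr

lemma inv_sq_lt_inv_sq {a b : Profile} {z : ℝ} (h : b.m z < a.m z) :
    (a.m z ^ 2)⁻¹ < (b.m z ^ 2)⁻¹ := by
  have := b.pos z
  gcongr

/-- A slower wave needs more time. -/
lemma y_sub_le_of_le {a b : Profile} (hab : ∀ z, b.m z ≤ a.m z) {s t : ℝ} (h : s ≤ t) :
    a.y t - a.y s ≤ b.y t - b.y s := by
  have hmono : Monotone fun z => b.y z - a.y z := by
    have hd : ∀ z, HasDerivAt (fun z => b.y z - a.y z) ((b.m z ^ 2)⁻¹ - (a.m z ^ 2)⁻¹) z :=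
      fun z => (b.hasDerivAt_y z).sub (a.hasDerivAt_y z)
    refine monotone_of_deriv_nonneg (fun z => (hd z).differentiableAt) fun z => ?_
    rw [(hd z).deriv]
    exact sub_nonneg.2 (inv_sq_le_inv_sq (hab z))
  have := hmono h
  simp only at this
  linarith

lemma hasDerivAt_p_diag (z : ℝ) :
    HasDerivAt (fun z => p a b z z) ((a.m z ^ 2)⁻¹ + (b.m z ^ 2)⁻¹) z :=
  (a.hasDerivAt_y z).add (b.hasDerivAt_y z)

lemma hasDerivAt_q_diag (z : ℝ) :
    HasDerivAt (fun z => q a b z z) ((a.m z ^ 2)⁻¹ - (b.m z ^ 2)⁻¹) z :=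
  (a.hasDerivAt_y z).sub (b.hasDerivAt_y z)

lemma exists_inverse_p :
    ∃ g : ℝ → ℝ, Continuous g ∧ (∀ z, g (p a b z z) = z) ∧ ∀ t, p a b (g t) (g t) = t := by
  obtain ⟨c, hc, hcf⟩ := exists_pos_le (f := fun z => (a.m z ^ 2)⁻¹ + (b.m z ^ 2)⁻¹)
    (a.continuous_inv_sq.add b.continuous_inv_sq)
    (fun z => by have := a.pos z; have := b.pos z; positivity)
    (fun z => by simp only [a.clamp_eq, b.clamp_eq])
  exact exists_inverse_of_deriv_ge (hasDerivAt_p_diag a b) hc hcf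

/-- Two profiles whose speeds are ordered in one way or the other. -/
def Comparable : Prop := (∀ z, b.m z < a.m z) ∨ ∀ z, a.m z < b.m z

lemma exists_inverse_q :
    ∃ g : ℝ → ℝ, Continuous g ∧
      (Comparable a b → (∀ z, g (q a b z z) = z) ∧ ∀ t, q a b (g t) (g t) = t) := by
  by_cases hab : Comparable a b
  · rcases hab with h | h
    · obtain ⟨c, hc, hcf⟩ := exists_pos_le (f := fun z => (b.m z ^ 2)⁻¹ - (a.m z ^ 2)⁻¹)
        (b.continuous_inv_sq.sub a.continuous_inv_sq)
        (fun z => sub_pos.2 (inv_sq_lt_inv_sq (h z)))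
        (fun z => by simp only [a.clamp_eq, b.clamp_eq])
      obtain ⟨g, hg, h1, h2⟩ := exists_inverse_of_deriv_ge (f := fun z => b.y z - a.y z)
        (fun z => (b.hasDerivAt_y z).sub (a.hasDerivAt_y z)) hc hcf
      refine ⟨fun t => g (-t), hg.comp continuous_neg, fun _ => ⟨fun z => ?_, fun t => ?_⟩⟩
      · simp only [q, neg_sub]; exact h1 z
      · have := h2 (-t)
        simp only [q]; linarith
    · obtain ⟨c, hc, hcf⟩ := exists_pos_le (f := fun z => (a.m z ^ 2)⁻¹ - (b.m z ^ 2)⁻¹)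
        (a.continuous_inv_sq.sub b.continuous_inv_sq)
        (fun z => sub_pos.2 (inv_sq_lt_inv_sq (h z)))
        (fun z => by simp only [a.clamp_eq, b.clamp_eq])
      obtain ⟨g, hg, h1, h2⟩ := exists_inverse_of_deriv_ge (hasDerivAt_q_diag a b) hc hcf
      exact ⟨g, hg, fun _ => ⟨h1, h2⟩⟩
  · exact ⟨fun _ => 0, continuous_const, fun h => (hab h).elim⟩

/-- The point `z` at which the diagonal `ζ = z` has the characteristic coordinate `p`. -/
def pInv : ℝ → ℝ := (exists_inverse_p a b).choose

/-- The point `z` at which the diagonal `ζ = z` has the characteristic coordinate `q`, for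
comparable speeds; unspecified otherwise. -/
def qInv : ℝ → ℝ := (exists_inverse_q a b).choose

lemma continuous_pInv : Continuous (pInv a b) := (exists_inverse_p a b).choose_spec.1

@[simp] lemma pInv_p (z : ℝ) : pInv a b (p a b z z) = z :=
  (exists_inverse_p a b).choose_spec.2.1 z

@[simp] lemma p_pInv (t : ℝ) : p a b (pInv a b t) (pInv a b t) = t :=
  (exists_inverse_p a b).choose_spec.2.2 t

lemma continuous_qInv : Continuous (qInv a b) := (exists_inverse_q a b).choose_spec.1

variable {a b} in
lemma qInv_q (h : Comparable a b) (z : ℝ) : qInv a b (q a b z z) = z :=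
  ((exists_inverse_q a b).choose_spec.2 h).1 z

variable {a b} in
lemma q_qInv (h : Comparable a b) (t : ℝ) : q a b (qInv a b t) (qInv a b t) = t :=
  ((exists_inverse_q a b).choose_spec.2 h).2 t

lemma strictMono_pInv : StrictMono (pInv a b) := by
  have hp : StrictMono fun z => p a b z z := a.strictMono_y.add b.strictMono_y
  intro s t h
  rw [← hp.lt_iff_lt]
  simpa using h

/-- The diagonal as a graph over the coordinate `p`. -/
def diagQ (t : ℝ) : ℝ := q a b (pInv a b t) (pInv a b t)

/-- The diagonal as a graph over the coordinate `q`, for comparable speeds. -/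
def diagP (t : ℝ) : ℝ := p a b (qInv a b t) (qInv a b t)

lemma continuous_diagQ : Continuous (diagQ a b) :=
  (continuous_q a b).comp ((continuous_pInv a b).prodMk (continuous_pInv a b))

lemma continuous_diagP : Continuous (diagP a b) :=
  (continuous_p a b).comp ((continuous_qInv a b).prodMk (continuous_qInv a b))

@[simp] lemma diagQ_p (z : ℝ) : diagQ a b (p a b z z) = q a b z z := by simp [diagQ]

variable {a b} in
lemma diagP_q (h : Comparable a b) (z : ℝ) : diagP a b (q a b z z) = p a b z z := by
  simp [diagP, qInv_q h]

variable {a b} in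
lemma diagQ_diagP (h : Comparable a b) (t : ℝ) : diagQ a b (diagP a b t) = t := by
  simp [diagP, diagQ, q_qInv h]

variable {a b} in
lemma diagP_diagQ (h : Comparable a b) (t : ℝ) : diagP a b (diagQ a b t) = t := by
  simp [diagP, diagQ, qInv_q h]

/-- The travel time from `ζ` to `z` at the speed of the profile `a`, as a function of `p` and `q`.
It does not increase along any characteristic followed back to the diagonal or to the boundary
`ζ = 0`, and it is the same function of `(z, ζ)` for all columns `b` of a row. -/
def time (p q : ℝ) : ℝ := (p + q) / 2 - a.y (b.yInv ((p - q) / 2))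

lemma time_p_q (z ζ : ℝ) : time a b (p a b z ζ) (q a b z ζ) = a.y z - a.y ζ := by
  have h1 : (p a b z ζ + q a b z ζ) / 2 = a.y z := by unfold p q; ring
  have h2 : (p a b z ζ - q a b z ζ) / 2 = b.y ζ := by unfold p q; ring
  rw [time, h1, h2, yInv_y]

lemma time_self (t : ℝ) : time a b t t = t := by
  simp [time, yInv_zero]

lemma time_le_time_sub (p : ℝ) {q' q : ℝ} (h : q' ≤ q) :
    time a b p q' ≤ time a b p q - (q - q') / 2 := by
  have := a.strictMono_y.monotone (b.strictMono_yInv.monotone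
    (show (p - q) / 2 ≤ (p - q') / 2 by linarith))
  unfold time
  linarith

variable {a b} in
lemma time_mono_left (hab : ∀ z, b.m z ≤ a.m z) {p' p : ℝ} (h : p' ≤ p) (q : ℝ) :
    time a b p' q ≤ time a b p q := by
  have := y_sub_le_of_le hab (b.strictMono_yInv.monotone
    (show (p' - q) / 2 ≤ (p - q) / 2 by linarith))
  rw [y_yInv, y_yInv] at this
  unfold time
  linarith

variable {a b} in
lemma time_anti_left (hab : ∀ z, a.m z ≤ b.m z) {p' p : ℝ} (h : p' ≤ p) (q : ℝ) :
    time a b p q ≤ time a b p' q := by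
  have := y_sub_le_of_le hab (b.strictMono_yInv.monotone
    (show (p' - q) / 2 ≤ (p - q) / 2 by linarith))
  rw [y_yInv, y_yInv] at this
  unfold time
  linarith

variable {a b} in
lemma diagQ_anti (hab : ∀ z, b.m z ≤ a.m z) : Antitone (diagQ a b) := fun s t h => by
  have := y_sub_le_of_le hab ((strictMono_pInv a b).monotone h)
  unfold diagQ q
  linarith

variable {a b} in
lemma diagQ_mono (hab : ∀ z, a.m z ≤ b.m z) : Monotone (diagQ a b) := fun s t h => by
  have := y_sub_le_of_le hab ((strictMono_pInv a b).monotone h)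
  unfold diagQ q
  linarith

@[simp] lemma p_zero : p a b 0 0 = 0 := by simp [p]

@[simp] lemma q_zero : q a b 0 0 = 0 := by simp [q]

@[simp] lemma diagQ_zero : diagQ a b 0 = 0 := by simpa using diagQ_p a b 0

variable {a b} in
lemma diagQ_nonpos (hab : ∀ z, b.m z ≤ a.m z) {t : ℝ} (ht : 0 ≤ t) : diagQ a b t ≤ 0 := by
  simpa using diagQ_anti hab ht

/-- The region `diagQ p ≤ q` of the characteristic coordinates is the region `ζ ≤ z`. -/
lemma yInv_le_yInv_of_diagQ_le {p q : ℝ} (h : diagQ a b p ≤ q) :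
    b.yInv ((p - q) / 2) ≤ a.yInv ((p + q) / 2) := by
  set z := pInv a b p
  have h1 : Profile.p a b z z = p := p_pInv a b p
  have h2 : Profile.q a b z z ≤ q := h
  unfold Profile.p at h1
  unfold Profile.q at h2
  have h3 : b.yInv ((p - q) / 2) ≤ z := by
    rw [← b.strictMono_y.le_iff_le, y_yInv]; linarith
  have h4 : z ≤ a.yInv ((p + q) / 2) := by
    rw [← a.strictMono_y.le_iff_le, y_yInv]; linarith
  exact h3.trans h4

lemma diagQ_le_q {z ζ : ℝ} (h : ζ ≤ z) : diagQ a b (p a b z ζ) ≤ q a b z ζ := by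
  set t := pInv a b (p a b z ζ)
  have h1 : p a b t t = p a b z ζ := p_pInv a b _
  have ha := a.strictMono_y.monotone
  have hb := b.strictMono_y.monotone
  have ht : t ≤ z := by
    by_contra hlt
    push Not at hlt
    have h2 := a.strictMono_y hlt
    have h3 := hb (h.trans hlt.le)
    unfold p at h1
    linarith
  have := ha ht
  change q a b t t ≤ q a b z ζ
  unfold p at h1
  unfold q
  linarith

variable {a b} in
/-- The characteristic from a point of the domain back to the diagonal stays in the domain, and in
the past of the point. -/
lemma past_of_mem_uIcc (hab : Comparable a b) {p q s : ℝ} (h : diagQ a b p ≤ q)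
    (hs : s ∈ uIcc (diagP a b q) p) : diagQ a b s ≤ q ∧ time a b s q ≤ time a b p q := by
  have hk := diagQ_diagP hab q
  have heq : diagQ a b p = q → diagP a b q = p := fun e => by rw [← e, diagP_diagQ hab]
  rcases hab with hlt | hlt
  · have hle : ∀ z, b.m z ≤ a.m z := fun z => (hlt z).le
    have hkp : diagP a b q ≤ p := by
      by_contra hc
      push Not at hc
      have := diagQ_anti hle hc.le
      rw [hk] at this
      exact hc.ne (heq (le_antisymm h this)).symm
    rw [uIcc_of_le hkp] at hs
    exact ⟨(diagQ_anti hle hs.1).trans hk.le, time_mono_left hle hs.2 q⟩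
  · have hle : ∀ z, a.m z ≤ b.m z := fun z => (hlt z).le
    have hkp : p ≤ diagP a b q := by
      by_contra hc
      push Not at hc
      have := diagQ_mono hle hc.le
      rw [hk] at this
      exact hc.ne (heq (le_antisymm h this))
    rw [uIcc_of_ge hkp] at hs
    exact ⟨(diagQ_mono hle hs.2).trans hk.le, time_anti_left hle hs.1 q⟩

end Profile

namespace Profile

/-! ### Amplitudes with given Cauchy data on the diagonal -/

section Amplitude

variable (a b : Profile) (U : ℝ → ℝ) (F : ℝ → ℝ → ℝ)

/-- The `p`-derivative of an amplitude with source `F` whose `p`-derivative at the point `(z, z)`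
of the diagonal is `U z`. -/
def ampP (p q : ℝ) : ℝ := U (pInv a b p) + ∫ t in (diagQ a b p)..q, F p t

/-- The datum on the `p`-axis belonging to `ampP`. -/
def axisP (p : ℝ) : ℝ := U (pInv a b p) - ∫ t in 0..(diagQ a b p), F p t

/-- The `q`-derivative on the diagonal of an amplitude that vanishes there and has the
`p`-derivative `U`: the derivative along the diagonal is zero. -/
def diagV (z : ℝ) : ℝ := -U z * (b.m z ^ 2 + a.m z ^ 2) / (b.m z ^ 2 - a.m z ^ 2)

/-- The datum on the `q`-axis of an amplitude that vanishes on the diagonal. -/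
def axisCauchy (q : ℝ) : ℝ := diagV a b U (qInv a b q) - ∫ s in 0..(diagP a b q), F s q

/-- The datum on the `q`-axis of an amplitude whose `q`-derivative on the line `p = q`, that is on
the boundary `ζ = 0`, is `R`. -/
def axisReflect (R : ℝ → ℝ) (q : ℝ) : ℝ := R q - ∫ s in 0..q, F s q

variable {a b U F} {R : ℝ → ℝ}

lemma intervalIntegrable_right (hF : Continuous (Function.uncurry F)) (s u v : ℝ) :
    IntervalIntegrable (fun t => F s t) volume u v :=
  (hF.comp (.prodMk_right s)).intervalIntegrable u v

lemma intervalIntegrable_left (hF : Continuous (Function.uncurry F)) (t u v : ℝ) :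
    IntervalIntegrable (fun s => F s t) volume u v :=
  (hF.comp (.prodMk_left t)).intervalIntegrable u v

lemma continuous_ampP (hU : Continuous U) (hF : Continuous (Function.uncurry F)) :
    Continuous fun x : ℝ × ℝ => ampP a b U F x.1 x.2 :=
  (hU.comp ((continuous_pInv a b).comp continuous_fst)).add
    (continuous_integral_right hF continuous_fst ((continuous_diagQ a b).comp continuous_fst)
      continuous_snd)

lemma continuous_axisP (hU : Continuous U) (hF : Continuous (Function.uncurry F)) :
    Continuous (axisP a b U F) :=
  (hU.comp (continuous_pInv a b)).sub
    (continuous_integral_right hF continuous_id continuous_const (continuous_diagQ a b))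

lemma Comparable.sq_sub_ne_zero (h : Comparable a b) (z : ℝ) : b.m z ^ 2 - a.m z ^ 2 ≠ 0 := by
  have ha := a.pos z
  have hb := b.pos z
  rcases h with h | h
  · have := h z; nlinarith
  · have := h z; nlinarith

lemma continuous_diagV (h : Comparable a b) (hU : Continuous U) : Continuous (diagV a b U) := by
  have := a.continuous_m
  have := b.continuous_m
  exact Continuous.div (by fun_prop) (by fun_prop) h.sq_sub_ne_zero

lemma continuous_axisCauchy (h : Comparable a b) (hU : Continuous U)
    (hF : Continuous (Function.uncurry F)) : Continuous (axisCauchy a b U F) :=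
  ((continuous_diagV h hU).comp (continuous_qInv a b)).sub
    (continuous_integral_left hF continuous_id continuous_const (continuous_diagP a b))

lemma continuous_axisReflect (hR : Continuous R) (hF : Continuous (Function.uncurry F)) :
    Continuous (axisReflect F R) :=
  hR.sub (continuous_integral_left hF continuous_id continuous_const continuous_id)

lemma waveP_axisP (hF : Continuous (Function.uncurry F)) (p q : ℝ) :
    waveP (axisP a b U F) F p q = ampP a b U F p q := by
  have hi := intervalIntegrable_right hF p
  rw [waveP, axisP, ampP,
    ← intervalIntegral.integral_interval_sub_left (a := 0) (hi _ q) (hi _ (diagQ a b p))]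
  ring

lemma waveQ_axisCauchy (hF : Continuous (Function.uncurry F)) (p q : ℝ) :
    waveQ (axisCauchy a b U F) F p q
      = diagV a b U (qInv a b q) + ∫ s in (diagP a b q)..p, F s q := by
  have hi := intervalIntegrable_left hF q
  rw [waveQ, axisCauchy,
    ← intervalIntegral.integral_interval_sub_left (a := 0) (hi _ p) (hi _ (diagP a b q))]
  ring

lemma waveQ_axisReflect_self (q : ℝ) : waveQ (axisReflect F R) F q q = R q := by
  rw [waveQ, axisReflect]; ring

lemma ampP_diag (z : ℝ) : ampP a b U F (p a b z z) (q a b z z) = U z := by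
  rw [ampP, diagQ_p, pInv_p]; simp

lemma waveQ_axisCauchy_diag (hab : Comparable a b) (hF : Continuous (Function.uncurry F)) (z : ℝ) :
    waveQ (axisCauchy a b U F) F (p a b z z) (q a b z z) = diagV a b U z := by
  rw [waveQ_axisCauchy hF, qInv_q hab, diagP_q hab]; simp

lemma continuous_ampP_left (hU : Continuous U) (hF : Continuous (Function.uncurry F)) (q : ℝ) :
    Continuous fun s => ampP a b U F s q := (continuous_ampP hU hF).comp (.prodMk_left q)

lemma continuous_ampP_self (hU : Continuous U) (hF : Continuous (Function.uncurry F)) :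
    Continuous fun s => ampP a b U F s s :=
  (continuous_ampP hU hF).comp (continuous_id.prodMk continuous_id)

lemma continuous_ampP_self_add (hU : Continuous U) (hF : Continuous (Function.uncurry F))
    (hR : Continuous R) : Continuous fun s => ampP a b U F s s + R s :=
  (continuous_ampP_self hU hF).add hR

lemma waveSol_sub_left {β : ℝ → ℝ} (hU : Continuous U)
    (hF : Continuous (Function.uncurry F)) (p₀ p q : ℝ) :
    waveSol (axisP a b U F) β F p q
      = waveSol (axisP a b U F) β F p₀ q + ∫ s in p₀..p, ampP a b U F s q := by
  rw [intervalIntegral.integral_eq_sub_of_hasDerivAt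
    (f := fun s => waveSol (axisP a b U F) β F s q) (fun s _ => ?_)
    ((continuous_ampP_left hU hF q).intervalIntegrable _ _)]
  · ring
  · have := hasDerivAt_waveSol_left (b := β) (continuous_axisP (a := a) (b := b) hU hF) hF s q
    rwa [waveP_axisP hF] at this

lemma waveSol_zero (α β : ℝ → ℝ) (F : ℝ → ℝ → ℝ) : waveSol α β F 0 0 = 0 := by simp [waveSol]

lemma waveSol_axisCauchy_diag (hab : Comparable a b) (hU : Continuous U)
    (hF : Continuous (Function.uncurry F)) (z : ℝ) :
    waveSol (axisP a b U F) (axisCauchy a b U F) F (p a b z z) (q a b z z) = 0 := by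
  have hd : ∀ z, HasDerivAt
      (fun z => waveSol (axisP a b U F) (axisCauchy a b U F) F (p a b z z) (q a b z z)) 0 z := by
    intro z
    have := hasDerivWithinAt_waveSol_comp (continuous_axisP (a := a) (b := b) hU hF)
      (continuous_axisCauchy hab hU hF) hF (hasDerivAt_p_diag a b z).hasDerivWithinAt
      (hasDerivAt_q_diag a b z).hasDerivWithinAt (s := univ)
    rw [hasDerivWithinAt_univ, waveP_axisP hF, ampP_diag, waveQ_axisCauchy_diag hab hF] at this
    refine this.congr_deriv ?_
    have h1 := hab.sq_sub_ne_zero z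
    have h2 := a.ne_zero z
    have h3 := b.ne_zero z
    rw [diagV]
    field_simp
    ring
  rw [eq_of_hasDerivAt_zero hd z 0]
  simp [waveSol_zero]

/-- An amplitude that vanishes on the diagonal is recovered from its `p`-derivative. -/
lemma waveSol_axisCauchy (hab : Comparable a b) (hU : Continuous U)
    (hF : Continuous (Function.uncurry F)) (p q : ℝ) :
    waveSol (axisP a b U F) (axisCauchy a b U F) F p q
      = ∫ s in (diagP a b q)..p, ampP a b U F s q := by
  rw [waveSol_sub_left hU hF (diagP a b q)]
  have := waveSol_axisCauchy_diag hab hU hF (qInv a b q)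
  rw [q_qInv hab] at this
  change waveSol _ _ _ (diagP a b q) q = 0 at this
  rw [this, zero_add]

lemma waveSol_axisReflect_self (hU : Continuous U) (hR : Continuous R)
    (hF : Continuous (Function.uncurry F)) (q : ℝ) :
    waveSol (axisP a b U F) (axisReflect F R) F q q
      = ∫ s in 0..q, (ampP a b U F s s + R s) := by
  rw [intervalIntegral.integral_eq_sub_of_hasDerivAt
    (f := fun s => waveSol (axisP a b U F) (axisReflect F R) F s s) (fun s _ => ?_)
    ((continuous_ampP_self_add hU hF hR).intervalIntegrable _ _)]
  · rw [waveSol_zero, sub_zero]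
  · have := hasDerivWithinAt_waveSol_comp (continuous_axisP (a := a) (b := b) hU hF)
      (continuous_axisReflect hR hF) hF (hasDerivAt_id' s).hasDerivWithinAt
      (hasDerivAt_id' s).hasDerivWithinAt (s := univ)
    rw [hasDerivWithinAt_univ, waveP_axisP hF, waveQ_axisReflect_self] at this
    simpa using this

/-- An amplitude with prescribed `q`-derivative on the boundary `ζ = 0` is recovered from that
derivative and its `p`-derivative. -/
lemma waveSol_axisReflect (hU : Continuous U) (hR : Continuous R)
    (hF : Continuous (Function.uncurry F)) (p q : ℝ) :
    waveSol (axisP a b U F) (axisReflect F R) F p q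
      = (∫ s in 0..q, (ampP a b U F s s + R s)) + ∫ s in q..p, ampP a b U F s q := by
  rw [waveSol_sub_left hU hF q, waveSol_axisReflect_self hU hR hF]

end Amplitude

/-! ### Estimates in the norm weighted by the exponential of the time -/

section Estimate

variable {a b : Profile} {U : ℝ → ℝ} {F G : ℝ → ℝ → ℝ} {M γ : ℝ}

/-- Integration in `q` gains a factor `1 / γ`, because `time` grows with `q` at least at the rate
`1 / 2`. -/
lemma abs_ampP_sub_le (hF : Continuous (Function.uncurry F)) (hG : Continuous (Function.uncurry G))
    (hγ : 0 < γ) (hM : 0 ≤ M)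
    (h : ∀ p q, diagQ a b p ≤ q → |F p q - G p q| ≤ M * Real.exp (γ * time a b p q))
    {p q : ℝ} (hpq : diagQ a b p ≤ q) :
    |ampP a b U F p q - ampP a b U G p q| ≤ 2 * M / γ * Real.exp (γ * time a b p q) := by
  have e : ampP a b U F p q - ampP a b U G p q = ∫ t in (diagQ a b p)..q, (F p t - G p t) := by
    rw [intervalIntegral.integral_sub (intervalIntegrable_right hF _ _ _)
      (intervalIntegrable_right hG _ _ _)]
    unfold ampP; ring
  set E := Real.exp (γ * time a b p q) with hE
  have hd : ∀ t, HasDerivAt (fun t => 2 * M / γ * E * Real.exp (-(γ / 2 * (q - t))))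
      (M * E * Real.exp (-(γ / 2 * (q - t)))) t := by
    intro t
    have h1 : HasDerivAt (fun t => -(γ / 2 * (q - t))) (γ / 2) t := by
      simpa using (((hasDerivAt_id' t).const_sub q).const_mul (γ / 2)).fun_neg
    refine (h1.exp.const_mul (2 * M / γ * E)).congr_deriv ?_
    field_simp
  have hc : Continuous fun t => M * E * Real.exp (-(γ / 2 * (q - t))) := by fun_prop
  rw [e, ← Real.norm_eq_abs]
  refine (intervalIntegral.norm_integral_le_of_norm_le hpq (g := fun t =>
    M * E * Real.exp (-(γ / 2 * (q - t)))) (Eventually.of_forall fun t ht => ?_)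
    (hc.intervalIntegrable _ _)).trans ?_
  · refine (h p t ht.1.le).trans ?_
    have := time_le_time_sub a b p ht.2
    rw [mul_assoc, hE, ← Real.exp_add]
    gcongr
    nlinarith
  · rw [intervalIntegral.integral_eq_sub_of_hasDerivAt (fun t _ => hd t)
      (hc.intervalIntegrable _ _)]
    have : 0 ≤ 2 * M / γ * E * Real.exp (-(γ / 2 * (q - diagQ a b p))) := by positivity
    simpa using this

lemma abs_waveSol_axisCauchy_sub_le (hab : Comparable a b) (hU : Continuous U)
    (hF : Continuous (Function.uncurry F)) (hG : Continuous (Function.uncurry G))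
    (hγ : 0 < γ) (hM : 0 ≤ M)
    (h : ∀ p q, diagQ a b p ≤ q → |F p q - G p q| ≤ M * Real.exp (γ * time a b p q))
    {p q : ℝ} (hpq : diagQ a b p ≤ q) :
    |waveSol (axisP a b U F) (axisCauchy a b U F) F p q
      - waveSol (axisP a b U G) (axisCauchy a b U G) G p q|
      ≤ 2 * M / γ * Real.exp (γ * time a b p q) * |p - diagP a b q| := by
  rw [waveSol_axisCauchy hab hU hF, waveSol_axisCauchy hab hU hG,
    ← intervalIntegral.integral_sub ((continuous_ampP_left hU hF q).intervalIntegrable _ _)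
      ((continuous_ampP_left hU hG q).intervalIntegrable _ _)]
  rw [← Real.norm_eq_abs]
  refine intervalIntegral.norm_integral_le_of_norm_le_const fun s hs => ?_
  obtain ⟨h1, h2⟩ := past_of_mem_uIcc hab hpq (uIoc_subset_uIcc hs)
  refine (abs_ampP_sub_le hF hG hγ hM h h1).trans ?_
  gcongr

lemma abs_waveSol_axisReflect_sub_le (hab : ∀ z, b.m z ≤ a.m z) (hU : Continuous U)
    {R R' : ℝ → ℝ} (hR : Continuous R) (hR' : Continuous R')
    (hF : Continuous (Function.uncurry F)) (hG : Continuous (Function.uncurry G))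
    (hγ : 0 < γ) (hM : 0 ≤ M)
    (h : ∀ p q, diagQ a b p ≤ q → |F p q - G p q| ≤ M * Real.exp (γ * time a b p q))
    {N : ℝ} (hN : 0 ≤ N) (hRR : ∀ s, 0 ≤ s → |R s - R' s| ≤ N * Real.exp (γ * s))
    {p q : ℝ} (hq : 0 ≤ q) (hpq : q ≤ p) :
    |waveSol (axisP a b U F) (axisReflect F R) F p q
      - waveSol (axisP a b U G) (axisReflect G R') G p q|
      ≤ (2 * M / γ + N) * Real.exp (γ * time a b p q) * p := by
  have i1 := fun H (hH : Continuous (Function.uncurry H)) u v =>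
    (continuous_ampP_left (a := a) (b := b) hU hH q).intervalIntegrable (μ := volume) u v
  have i2 := fun H (hH : Continuous (Function.uncurry H)) S (hS : Continuous S) u v =>
    (continuous_ampP_self_add (a := a) (b := b) hU hH hS).intervalIntegrable (μ := volume) u v
  rw [waveSol_axisReflect hU hR hF, waveSol_axisReflect hU hR' hG, add_sub_add_comm,
    ← intervalIntegral.integral_sub (i1 F hF _ _) (i1 G hG _ _),
    ← intervalIntegral.integral_sub (i2 F hF R hR _ _) (i2 G hG R' hR' _ _)]
  have htime : q ≤ time a b p q := by
    simpa [time_self] using time_mono_left hab hpq q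
  have b1 : ‖∫ s in 0..q, ((ampP a b U F s s + R s) - (ampP a b U G s s + R' s))‖
      ≤ (2 * M / γ + N) * Real.exp (γ * time a b p q) * |q - 0| := by
    refine intervalIntegral.norm_integral_le_of_norm_le_const fun s hs => ?_
    rw [uIoc_of_le hq] at hs
    have h1 := abs_ampP_sub_le (U := U) hF hG hγ hM h
      ((diagQ_nonpos hab hs.1.le).trans hs.1.le)
    rw [time_self] at h1
    rw [add_sub_add_comm, add_mul]
    have hexp : Real.exp (γ * s) ≤ Real.exp (γ * time a b p q) := by
      gcongr; exact hs.2.trans htime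
    refine (norm_add_le _ _).trans (add_le_add (h1.trans ?_) ((hRR s hs.1.le).trans ?_))
    · gcongr
    · gcongr
  have b2 : ‖∫ s in q..p, (ampP a b U F s q - ampP a b U G s q)‖
      ≤ (2 * M / γ + N) * Real.exp (γ * time a b p q) * |p - q| := by
    refine intervalIntegral.norm_integral_le_of_norm_le_const fun s hs => ?_
    rw [uIoc_of_le hpq] at hs
    refine (abs_ampP_sub_le (U := U) hF hG hγ hM h
      ((diagQ_nonpos hab (hq.trans hs.1.le)).trans hq)).trans ?_
    have := time_mono_left hab hs.2 q
    gcongr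
    exact le_add_of_nonneg_right hN
  refine (norm_add_le _ _).trans ((add_le_add b1 b2).trans ?_)
  rw [sub_zero, abs_of_nonneg hq, abs_of_nonneg (sub_nonneg.2 hpq)]
  apply le_of_eq; ring

end Estimate

end Profile

/-! ### A fixed point theorem in a weighted norm -/

/-- A self-map of the continuous functions on a compact space that is a contraction for the supremum
norm weighted by `exp (-γ σ)` has a fixed point. -/
lemma exists_fixedPoint_of_weighted {T : Type*} [TopologicalSpace T] [CompactSpace T] {N : ℕ}
    (σ : C(T, ℝ)) (γ : ℝ) (Φ : C(T, Fin N → ℝ) → C(T, Fin N → ℝ))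
    (h : ∀ X Y : C(T, Fin N → ℝ), ∀ M, 0 ≤ M →
      (∀ t j, |X t j - Y t j| ≤ M * Real.exp (γ * σ t)) →
      ∀ t j, |Φ X t j - Φ Y t j| ≤ M / 2 * Real.exp (γ * σ t)) :
    ∃ X, Φ X = X := by
  let e : C(T, ℝ) := ⟨fun t => Real.exp (γ * σ t), by fun_prop⟩
  let e' : C(T, ℝ) := ⟨fun t => Real.exp (-(γ * σ t)), by fun_prop⟩
  let Ψ : C(T, Fin N → ℝ) → C(T, Fin N → ℝ) := fun f => e' • Φ (e • f)
  have hc : ContractingWith (1 / 2) Ψ := by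
    refine ⟨by norm_num, LipschitzWith.of_dist_le_mul fun f g => ?_⟩
    rw [ContinuousMap.dist_le (by positivity)]
    intro t
    rw [dist_pi_le_iff (by positivity)]
    intro j
    have h1 : ∀ t j, |(e • f) t j - (e • g) t j| ≤ dist f g * Real.exp (γ * σ t) := by
      intro t j
      have : (e • f) t j - (e • g) t j = Real.exp (γ * σ t) * (f t j - g t j) := by
        simp [e]; ring
      rw [this, abs_mul, Real.abs_exp, mul_comm]
      gcongr
      rw [← Real.dist_eq]
      exact (dist_le_pi_dist (f t) (g t) j).trans (ContinuousMap.dist_apply_le_dist t)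
    have h2 := h _ _ _ dist_nonneg h1 t j
    have h3 : Ψ f t j - Ψ g t j
        = Real.exp (-(γ * σ t)) * (Φ (e • f) t j - Φ (e • g) t j) := by
      simp [Ψ, e']; ring
    rw [Real.dist_eq, h3, abs_mul, Real.abs_exp]
    calc Real.exp (-(γ * σ t)) * |Φ (e • f) t j - Φ (e • g) t j|
        ≤ Real.exp (-(γ * σ t)) * (dist f g / 2 * Real.exp (γ * σ t)) := by gcongr
      _ = dist f g / 2 * (Real.exp (-(γ * σ t)) * Real.exp (γ * σ t)) := by ring
      _ = _ := by rw [← Real.exp_add]; simp; ring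
  refine ⟨e • ContractingWith.fixedPoint Ψ hc, ?_⟩
  have hfix : e' • Φ (e • ContractingWith.fixedPoint Ψ hc) = ContractingWith.fixedPoint Ψ hc :=
    hc.fixedPoint_isFixedPt
  conv_rhs => rw [← hfix]
  ext t j
  simp [e, e', ← mul_assoc, ← Real.exp_add]

/-! ### The kernel equations of a single row -/

instance : CompactSpace closedTriangle := by
  refine isCompact_iff_compactSpace.1 (Metric.isCompact_of_isClosed_isBounded ?_ ?_)
  · exact (isClosed_le continuous_const continuous_snd).inter
      ((isClosed_le continuous_snd continuous_fst).inter
        (isClosed_le continuous_fst continuous_const))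
  · refine (Metric.isBounded_Icc (0 : ℝ × ℝ) 1).subset fun x hx => ?_
    exact ⟨⟨hx.1.trans hx.2.1, hx.1⟩, hx.2.2, hx.2.1.trans hx.2.2⟩

/-- A retraction of the plane onto the triangle. -/
def retract (x : ℝ × ℝ) : closedTriangle :=
  ⟨(clamp x.1, min (clamp x.2) (clamp x.1)),
    le_min (clamp_mem _).1 (clamp_mem _).1, min_le_right _ _, (clamp_mem _).2⟩

lemma continuous_retract : Continuous retract := by
  have := continuous_clamp
  exact Continuous.subtype_mk (by fun_prop) _

lemma retract_of_mem {x : ℝ × ℝ} (hx : x ∈ closedTriangle) : retract x = ⟨x, hx⟩ := by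
  have h1 : clamp x.1 = x.1 := clamp_of_mem ⟨hx.1.trans hx.2.1, hx.2.2⟩
  have h2 : clamp x.2 = x.2 := clamp_of_mem ⟨hx.1, hx.2.1.trans hx.2.2⟩
  refine Subtype.ext (Prod.ext h1 ?_)
  change min (clamp x.2) (clamp x.1) = x.2
  rw [h1, h2, min_eq_left hx.2.1]

lemma exists_bound_on_triangle {ι : Type*} [Fintype ι] {f : ι → ℝ × ℝ → ℝ}
    (hf : ∀ i, ContinuousOn (f i) closedTriangle) :
    ∃ C, 0 ≤ C ∧ ∀ i, ∀ x ∈ closedTriangle, |f i x| ≤ C := by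
  have hcpt : IsCompact closedTriangle := isCompact_iff_compactSpace.2 inferInstance
  choose C hC using fun i => hcpt.exists_bound_of_continuousOn (hf i)
  refine ⟨∑ i, |C i|, Finset.sum_nonneg fun i _ => abs_nonneg _, fun i x hx => ?_⟩
  exact (hC i x hx).trans ((le_abs_self _).trans
    (Finset.single_le_sum (f := fun i => |C i|) (fun i _ => abs_nonneg _) (Finset.mem_univ i)))

/-- The data of the kernel equations of one row: the profiles of all columns, ordered by strictly
decreasing speed, the reaction coefficients, the index of the row, and, for every column `j` not
before the row, the column `partner j` whose wave arriving at the boundary `ζ = 0` is sent back into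
column `j` with the coefficient `refl j`. -/
structure RowSystem (N : ℕ) where
  prof : Fin N → Profile
  anti : ∀ z, StrictAnti fun j => (prof j).m z
  react : Fin N → Fin N → ℝ → ℝ
  continuous_react : ∀ k j, Continuous (react k j)
  row : Fin N
  partner : Fin N → Fin N
  le_partner : ∀ j, row ≤ j → row ≤ partner j
  refl : Fin N → ℝ

namespace RowSystem

open Profile

variable {N : ℕ} (S : RowSystem N) (X Y : C(closedTriangle, Fin N → ℝ)) (j : Fin N)

/-- The profile of the row. -/
abbrev a : Profile := S.prof S.row

lemma comparable {j : Fin N} (h : j ≠ S.row) : Comparable S.a (S.prof j) := by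
  rcases lt_or_gt_of_ne h with h | h
  · exact Or.inr fun z => S.anti z h
  · exact Or.inl fun z => S.anti z h

lemma m_le_of_le {j : Fin N} (h : S.row ≤ j) (z : ℝ) : (S.prof j).m z ≤ S.a.m z :=
  (S.anti z).antitone h

lemma m_ge_of_le {j : Fin N} (h : j ≤ S.row) (z : ℝ) : S.a.m z ≤ (S.prof j).m z :=
  (S.anti z).antitone h

/-- The coefficients of the source of column `j`: the reaction terms, and the terms of order zero
that the change to the amplitude creates for `k = j`. -/
def coef (k : Fin N) (x : ℝ × ℝ) : ℝ :=
  (S.react k j x.2 - if k = j then S.a.c x.1 - (S.prof j).c x.2 else 0)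
    / (4 * w S.a (S.prof j) x.1 x.2)

/-- The source of the amplitude of column `j` on the triangle. -/
def triSource (t : closedTriangle) : ℝ := ∑ k, S.coef j k t * X t k

/-- The source of the amplitude of column `j` in characteristic coordinates, extended to the plane
by the retraction. -/
def source (p q : ℝ) : ℝ :=
  S.triSource X j (retract (S.a.yInv ((p + q) / 2), (S.prof j).yInv ((p - q) / 2)))

/-- The `p`-derivative of the amplitude of column `j` on the diagonal. Its value is forced by the
kernel equation on the diagonal and, for `j ≠ row`, the vanishing of the entry there. -/
def diagU (z : ℝ) : ℝ :=
  -S.react S.row j z / (2 * w S.a (S.prof j) z z * (S.a.m z ^ 2 + (S.prof j).m z ^ 2))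

/-- The wave sent into column `j` at the boundary `ζ = 0`. -/
def reflected (s : ℝ) : ℝ :=
  S.refl j * ampP S.a (S.prof (S.partner j)) (S.diagU (S.partner j)) (S.source X (S.partner j)) s s

/-- The datum on the `p`-axis of the amplitude of column `j`. -/
def dataP : ℝ → ℝ := axisP S.a (S.prof j) (S.diagU j) (S.source X j)

/-- The datum on the half-axis `0 ≤ q` of the amplitude of column `j`: from the reflection at the
boundary `ζ = 0`, or, left of the diagonal entry of the row, from the data on the diagonal. -/
def dataBelow : ℝ → ℝ :=
  if S.row ≤ j then axisReflect (S.source X j) (S.reflected X j)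
  else axisCauchy S.a (S.prof j) (S.diagU j) (S.source X j)

/-- The datum on the half-axis `q < 0` of the amplitude of column `j`. Only right of the diagonal
entry does the triangle contain points with `q < 0`; their characteristics meet the diagonal. -/
def dataAbove : ℝ → ℝ :=
  if S.row < j then axisCauchy S.a (S.prof j) (S.diagU j) (S.source X j) else S.dataBelow X j

/-- The kernel entry of column `j` produced by the sources belonging to `X`. -/
def kern (z ζ : ℝ) : ℝ :=
  if 0 ≤ q S.a (S.prof j) z ζ then
    waveKernel S.a (S.prof j) (S.dataP X j) (S.dataBelow X j) (S.source X j) z ζ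
  else waveKernel S.a (S.prof j) (S.dataP X j) (S.dataAbove X j) (S.source X j) z ζ

/-- The `z`-derivative of `kern`. -/
def kernZ (z ζ : ℝ) : ℝ :=
  if 0 ≤ q S.a (S.prof j) z ζ then
    waveKernelZ S.a (S.prof j) (S.dataP X j) (S.dataBelow X j) (S.source X j) z ζ
  else waveKernelZ S.a (S.prof j) (S.dataP X j) (S.dataAbove X j) (S.source X j) z ζ

/-- The `ζ`-derivative of `kern`. -/
def kernζ (z ζ : ℝ) : ℝ :=
  if 0 ≤ q S.a (S.prof j) z ζ then
    waveKernelζ S.a (S.prof j) (S.dataP X j) (S.dataBelow X j) (S.source X j) z ζ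
  else waveKernelζ S.a (S.prof j) (S.dataP X j) (S.dataAbove X j) (S.source X j) z ζ

lemma continuous_coef (k : Fin N) : Continuous (S.coef j k) := by
  have h1 := S.continuous_react k j
  have h2 := S.a.continuous_c
  have h3 := (S.prof j).continuous_c
  have h4 := continuous_w S.a (S.prof j)
  have h5 : Continuous fun x : ℝ × ℝ => S.react k j x.2
      - if k = j then S.a.c x.1 - (S.prof j).c x.2 else 0 := by
    split_ifs <;> fun_prop
  exact h5.div (by fun_prop) fun x => (mul_pos four_pos (w_pos S.a (S.prof j) _ _)).ne'

lemma continuous_triSource : Continuous (S.triSource X j) := by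
  refine continuous_finsetSum _ fun k _ => ((S.continuous_coef j k).comp
    continuous_subtype_val).mul ((continuous_apply k).comp X.continuous)

lemma continuous_source : Continuous (Function.uncurry (S.source X j)) := by
  have h1 := S.a.continuous_yInv
  have h2 := (S.prof j).continuous_yInv
  refine (S.continuous_triSource X j).comp (continuous_retract.comp ?_)
  fun_prop

lemma source_p_q {x : ℝ × ℝ} (hx : x ∈ closedTriangle) :
    S.source X j (p S.a (S.prof j) x.1 x.2) (q S.a (S.prof j) x.1 x.2)
      = ∑ k, S.coef j k x * X ⟨x, hx⟩ k := by
  have h1 : (p S.a (S.prof j) x.1 x.2 + q S.a (S.prof j) x.1 x.2) / 2 = S.a.y x.1 := by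
    unfold p q; ring
  have h2 : (p S.a (S.prof j) x.1 x.2 - q S.a (S.prof j) x.1 x.2) / 2 = (S.prof j).y x.2 := by
    unfold p q; ring
  rw [source, h1, h2, yInv_y, yInv_y, retract_of_mem hx]
  rfl

lemma continuous_diagU : Continuous (S.diagU j) := by
  have h1 := S.continuous_react S.row j
  have h2 := S.a.continuous_m
  have h3 := (S.prof j).continuous_m
  have h4 : Continuous fun z : ℝ => w S.a (S.prof j) z z :=
    (continuous_w S.a (S.prof j)).comp (continuous_id.prodMk continuous_id)
  refine Continuous.div (by fun_prop) (by fun_prop) fun z => ?_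
  have := S.a.pos z
  have := w_pos S.a (S.prof j) z z
  positivity

lemma continuous_reflected : Continuous (S.reflected X j) :=
  (continuous_ampP_self (S.continuous_diagU _) (S.continuous_source X _)).const_mul _

lemma continuous_dataP : Continuous (S.dataP X j) :=
  continuous_axisP (S.continuous_diagU j) (S.continuous_source X j)

lemma continuous_dataBelow : Continuous (S.dataBelow X j) := by
  unfold dataBelow
  split_ifs with h
  · exact continuous_axisReflect (S.continuous_reflected X j) (S.continuous_source X j)
  · exact continuous_axisCauchy (S.comparable fun e => h e.ge) (S.continuous_diagU j)
      (S.continuous_source X j)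

lemma continuous_dataAbove : Continuous (S.dataAbove X j) := by
  unfold dataAbove
  split_ifs with h
  · exact continuous_axisCauchy (S.comparable h.ne') (S.continuous_diagU j)
      (S.continuous_source X j)
  · exact S.continuous_dataBelow X j

lemma isC1_below : IsC1OnSquare
    (waveKernel S.a (S.prof j) (S.dataP X j) (S.dataBelow X j) (S.source X j))
    (waveKernelZ S.a (S.prof j) (S.dataP X j) (S.dataBelow X j) (S.source X j))
    (waveKernelζ S.a (S.prof j) (S.dataP X j) (S.dataBelow X j) (S.source X j)) :=
  isC1OnSquare_waveKernel _ _ (S.continuous_dataP X j) (S.continuous_dataBelow X j)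
    (S.continuous_source X j)

lemma isC1_above : IsC1OnSquare
    (waveKernel S.a (S.prof j) (S.dataP X j) (S.dataAbove X j) (S.source X j))
    (waveKernelZ S.a (S.prof j) (S.dataP X j) (S.dataAbove X j) (S.source X j))
    (waveKernelζ S.a (S.prof j) (S.dataP X j) (S.dataAbove X j) (S.source X j)) :=
  isC1OnSquare_waveKernel _ _ (S.continuous_dataP X j) (S.continuous_dataAbove X j)
    (S.continuous_source X j)

lemma continuous_kern : Continuous (Function.uncurry (S.kern X j)) := by
  refine Continuous.if_le (S.isC1_below X j).continuous (S.isC1_above X j).continuous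
    continuous_const (continuous_q S.a (S.prof j)) fun x hx => ?_
  simp only [waveKernel, waveSol, ← hx, intervalIntegral.integral_same]

/-- The map whose fixed points solve the kernel equations of the row. -/
def step : C(closedTriangle, Fin N → ℝ) :=
  ⟨fun t j => S.kern X j t.1.1 t.1.2, continuous_pi fun j =>
    (S.continuous_kern X j).comp continuous_subtype_val⟩

lemma q_nonneg_of_le {j : Fin N} (h : j ≤ S.row) {x : ℝ × ℝ} (hx : x ∈ closedTriangle) :
    0 ≤ q S.a (S.prof j) x.1 x.2 := by
  have h1 := y_sub_le_of_le (S.m_ge_of_le h) hx.1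
  have h2 := S.a.strictMono_y.monotone hx.2.1
  simp only [y_zero, sub_zero] at h1
  unfold q
  linarith

/-- The time elapsed since the diagonal, as a continuous function on the triangle. -/
def timeOn : C(closedTriangle, ℝ) :=
  ⟨fun t => S.a.y t.1.1 - S.a.y t.1.2, by
    have := S.a.continuous_y
    fun_prop⟩

variable {X Y}

lemma abs_source_sub_le {C M γ : ℝ} (hC : 0 ≤ C) (hM : 0 ≤ M) (hγ : 0 < γ)
    (hcoef : ∀ k, ∀ x ∈ closedTriangle, |S.coef j k x| ≤ C)
    (hXY : ∀ t k, |X t k - Y t k| ≤ M * Real.exp (γ * S.timeOn t))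
    {p q : ℝ} (hpq : diagQ S.a (S.prof j) p ≤ q) :
    |S.source X j p q - S.source Y j p q|
      ≤ N * C * M * Real.exp (γ * time S.a (S.prof j) p q) := by
  have hle := yInv_le_yInv_of_diagQ_le S.a (S.prof j) hpq
  set z := S.a.yInv ((p + q) / 2) with hz
  set ζ := (S.prof j).yInv ((p - q) / 2) with hζ
  have htime : S.timeOn (retract (z, ζ)) ≤ time S.a (S.prof j) p q := by
    have h1 := y_clamp_sub_le S.a hle
    have h2 : S.timeOn (retract (z, ζ)) = S.a.y (clamp z) - S.a.y (clamp ζ) := by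
      change S.a.y (clamp z) - S.a.y (min (clamp ζ) (clamp z)) = _
      rw [min_eq_left (clamp_mono hle)]
    have h3 : time S.a (S.prof j) p q = S.a.y z - S.a.y ζ := by
      rw [time, hz, y_yInv, hζ]
    rw [h2, h3]; exact h1
  have e : S.source X j p q - S.source Y j p q = ∑ k, S.coef j k (retract (z, ζ)) *
      (X (retract (z, ζ)) k - Y (retract (z, ζ)) k) := by
    simp only [source, triSource, ← hz, ← hζ, mul_sub, Finset.sum_sub_distrib]
  rw [e]
  calc _ ≤ ∑ k, |S.coef j k (retract (z, ζ)) *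
      (X (retract (z, ζ)) k - Y (retract (z, ζ)) k)| := Finset.abs_sum_le_sum_abs _ _
    _ ≤ ∑ _k : Fin N, C * (M * Real.exp (γ * time S.a (S.prof j) p q)) := by
        refine Finset.sum_le_sum fun k _ => ?_
        rw [abs_mul]
        gcongr
        · exact hcoef k _ (retract (z, ζ)).2
        · refine (hXY _ k).trans ?_
          gcongr
    _ = _ := by rw [Finset.sum_const, Finset.card_univ, Fintype.card_fin, nsmul_eq_mul]; ring

lemma waveKernel_sub {a b : Profile} {α β α' β' : ℝ → ℝ} {F F' : ℝ → ℝ → ℝ} {z ζ C W : ℝ}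
    (hW : |w a b z ζ| ≤ W) (h : |waveSol α β F (p a b z ζ) (q a b z ζ)
      - waveSol α' β' F' (p a b z ζ) (q a b z ζ)| ≤ C) :
    |waveKernel a b α β F z ζ - waveKernel a b α' β' F' z ζ| ≤ W * C := by
  rw [waveKernel, waveKernel, ← mul_sub, abs_mul]
  exact mul_le_mul hW h (abs_nonneg _) ((abs_nonneg _).trans hW)

/-- The map `step` is a contraction in a weighted norm. -/
lemma exists_step_contraction : ∃ γ, ∀ X Y : C(closedTriangle, Fin N → ℝ), ∀ M, 0 ≤ M →
      (∀ t j, |X t j - Y t j| ≤ M * Real.exp (γ * S.timeOn t)) →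
      ∀ t j, |S.step X t j - S.step Y t j| ≤ M / 2 * Real.exp (γ * S.timeOn t) := by
  obtain ⟨C, hC0, hC⟩ := exists_bound_on_triangle (ι := Fin N × Fin N)
    (f := fun i => S.coef i.1 i.2) fun i => (S.continuous_coef i.1 i.2).continuousOn
  obtain ⟨W, hW0, hW⟩ := exists_bound_on_triangle
    (f := fun (j : Fin N) x => w S.a (S.prof j) x.1 x.2)
    fun j => (continuous_w S.a (S.prof j)).continuousOn
  obtain ⟨L, hL0, hL⟩ := exists_bound_on_triangle
    (f := fun (j : Fin N) x => p S.a (S.prof j) x.1 x.2)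
    fun j => (continuous_p S.a (S.prof j)).continuousOn
  obtain ⟨L', hL0', hL'⟩ := exists_bound_on_triangle
    (f := fun (j : Fin N) x => p S.a (S.prof j) x.1 x.2
      - diagP S.a (S.prof j) (q S.a (S.prof j) x.1 x.2))
    fun j => ((continuous_p S.a (S.prof j)).sub ((continuous_diagP S.a (S.prof j)).comp
      (continuous_q S.a (S.prof j)))).continuousOn
  set Θ := ∑ j, |S.refl j| with hΘ
  have hΘ0 : 0 ≤ Θ := Finset.sum_nonneg fun j _ => abs_nonneg _
  have hrefl : ∀ j, |S.refl j| ≤ Θ := fun j =>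
    Finset.single_le_sum (f := fun i => |S.refl i|) (fun i _ => abs_nonneg _) (Finset.mem_univ j)
  set D := W * (2 * (N * C) * (1 + Θ) * (L + L')) with hD
  have hD0 : 0 ≤ D := by positivity
  have hγ : 0 < 2 * D + 1 := by positivity
  refine ⟨2 * D + 1, fun X Y M hM hXY t j => ?_⟩
  set γ := 2 * D + 1 with hγdef
  have hx := t.2
  set x := t.1 with hxdef
  have hsrc : ∀ j p q, diagQ S.a (S.prof j) p ≤ q → |S.source X j p q - S.source Y j p q|
      ≤ N * C * M * Real.exp (γ * time S.a (S.prof j) p q) := fun j p q h =>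
    S.abs_source_sub_le j hC0 hM hγ (fun k x hx => hC (j, k) x hx) hXY h
  have hNCM : 0 ≤ N * C * M := by positivity
  have htime : time S.a (S.prof j) (p S.a (S.prof j) x.1 x.2) (q S.a (S.prof j) x.1 x.2)
      = S.timeOn t := time_p_q _ _ _ _
  have hdom : diagQ S.a (S.prof j) (p S.a (S.prof j) x.1 x.2) ≤ q S.a (S.prof j) x.1 x.2 :=
    diagQ_le_q _ _ hx.2.1
  have hgoal : W * (2 * (N * C * M) / γ * (1 + Θ) * Real.exp (γ * S.timeOn t) * (L + L'))
      ≤ M / 2 * Real.exp (γ * S.timeOn t) := by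
    have e : W * (2 * (N * C * M) / γ * (1 + Θ) * Real.exp (γ * S.timeOn t) * (L + L'))
        = D / γ * (M * Real.exp (γ * S.timeOn t)) := by rw [hD]; ring
    have h2 : D / γ ≤ 1 / 2 := by rw [div_le_div_iff₀ hγ two_pos]; linarith
    rw [e]
    calc _ ≤ 1 / 2 * (M * Real.exp (γ * S.timeOn t)) := by gcongr
      _ = _ := by ring
  refine le_trans ?_ hgoal
  have hcauchy : j ≠ S.row →
      |waveSol (S.dataP X j) (axisCauchy S.a (S.prof j) (S.diagU j) (S.source X j))
          (S.source X j) (p S.a (S.prof j) x.1 x.2) (q S.a (S.prof j) x.1 x.2)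
        - waveSol (S.dataP Y j) (axisCauchy S.a (S.prof j) (S.diagU j) (S.source Y j))
          (S.source Y j) (p S.a (S.prof j) x.1 x.2) (q S.a (S.prof j) x.1 x.2)|
      ≤ 2 * (N * C * M) / γ * (1 + Θ) * Real.exp (γ * S.timeOn t) * (L + L') := by
    intro hj
    have h1 := abs_waveSol_axisCauchy_sub_le (S.comparable hj) (S.continuous_diagU j)
      (S.continuous_source X j) (S.continuous_source Y j) hγ hNCM (hsrc j) hdom
    rw [htime] at h1
    refine h1.trans ?_
    have h2 := hL' j x hx
    have h3 : 2 * (N * C * M) / γ ≤ 2 * (N * C * M) / γ * (1 + Θ) :=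
      le_mul_of_one_le_right (by positivity) (by linarith)
    gcongr
    linarith
  have hreflect : S.row ≤ j → 0 ≤ q S.a (S.prof j) x.1 x.2 →
      |waveSol (S.dataP X j) (axisReflect (S.source X j) (S.reflected X j))
          (S.source X j) (p S.a (S.prof j) x.1 x.2) (q S.a (S.prof j) x.1 x.2)
        - waveSol (S.dataP Y j) (axisReflect (S.source Y j) (S.reflected Y j))
          (S.source Y j) (p S.a (S.prof j) x.1 x.2) (q S.a (S.prof j) x.1 x.2)|
      ≤ 2 * (N * C * M) / γ * (1 + Θ) * Real.exp (γ * S.timeOn t) * (L + L') := by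
    intro hj hq
    have hy : 0 ≤ (S.prof j).y x.2 := by
      simpa using (S.prof j).strictMono_y.monotone hx.1
    have hRR : ∀ s, 0 ≤ s → |S.reflected X j s - S.reflected Y j s|
        ≤ Θ * (2 * (N * C * M) / γ) * Real.exp (γ * s) := by
      intro s hs
      have hp := S.m_le_of_le (S.le_partner j hj)
      have h1 := abs_ampP_sub_le (U := S.diagU (S.partner j)) (S.continuous_source X (S.partner j))
        (S.continuous_source Y (S.partner j)) hγ hNCM (hsrc _) ((diagQ_nonpos hp hs).trans hs)
      rw [time_self] at h1
      rw [reflected, reflected, ← mul_sub, abs_mul, mul_assoc]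
      gcongr
      exact hrefl j
    have h1 := abs_waveSol_axisReflect_sub_le (S.m_le_of_le hj) (S.continuous_diagU j)
      (S.continuous_reflected X j) (S.continuous_reflected Y j)
      (S.continuous_source X j) (S.continuous_source Y j) hγ hNCM (hsrc j)
      (N := Θ * (2 * (N * C * M) / γ)) (by positivity) hRR hq
      (show q S.a (S.prof j) x.1 x.2 ≤ p S.a (S.prof j) x.1 x.2 by unfold p q; linarith)
    rw [htime] at h1
    refine h1.trans ?_
    have h2 := (le_abs_self _).trans (hL j x hx)
    calc _ = 2 * (N * C * M) / γ * (1 + Θ) * Real.exp (γ * S.timeOn t)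
          * p S.a (S.prof j) x.1 x.2 := by ring
      _ ≤ _ := by gcongr; linarith
  change |S.kern X j x.1 x.2 - S.kern Y j x.1 x.2| ≤ _
  unfold kern
  split_ifs with hq
  · refine waveKernel_sub (hW j x hx) ?_
    unfold dataBelow
    split_ifs with hj
    · exact hreflect hj hq
    · exact hcauchy fun e => hj e.ge
  · have hj : S.row < j := by
      by_contra hj
      exact hq (S.q_nonneg_of_le (not_lt.1 hj) hx)
    refine waveKernel_sub (hW j x hx) ?_
    simp only [dataAbove, if_pos hj]
    exact hcauchy hj.ne'

/-- The integral equations of the row are solvable. -/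
lemma exists_step_fixed : ∃ X, S.step X = X := by
  obtain ⟨γ, h⟩ := S.exists_step_contraction
  exact exists_fixedPoint_of_weighted S.timeOn γ S.step h

end RowSystem

/-! ### The characteristic through the origin -/

namespace Profile

lemma hasDerivAt_yInv (b : Profile) (x : ℝ) : HasDerivAt b.yInv (b.m (b.yInv x) ^ 2) x := by
  have h := HasDerivAt.of_local_left_inverse b.continuous_yInv.continuousAt
    (b.hasDerivAt_y (b.yInv x)) (inv_ne_zero (pow_ne_zero 2 (b.ne_zero _)))
    (Eventually.of_forall fun x => b.y_yInv x)
  rwa [inv_inv] at h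

/-- The characteristic through the origin. -/
def originCurve (a b : Profile) (z : ℝ) : ℝ := b.yInv (a.y z)

variable {a b : Profile}

lemma contDiff_originCurve : ContDiff ℝ 1 (originCurve a b) := by
  have hd : ∀ z, HasDerivAt (originCurve a b) (b.m (b.yInv (a.y z)) ^ 2 * (a.m z ^ 2)⁻¹) z :=
    fun z => (b.hasDerivAt_yInv _).comp z (a.hasDerivAt_y z)
  refine contDiff_one_iff_deriv.2 ⟨fun z => (hd z).differentiableAt, ?_⟩
  rw [funext fun z => (hd z).deriv]
  exact ((b.continuous_m.comp (b.continuous_yInv.comp a.continuous_y)).pow 2).mul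
    a.continuous_inv_sq

lemma le_originCurve_iff {z ζ : ℝ} : ζ ≤ originCurve a b z ↔ 0 ≤ q a b z ζ := by
  rw [originCurve, ← b.strictMono_y.le_iff_le, y_yInv, q, sub_nonneg]

lemma q_diag_neg (h : ∀ z, b.m z < a.m z) {z : ℝ} (hz : 0 < z) : q a b z z < 0 := by
  have hle : q a b z z ≤ 0 := by
    have := y_sub_le_of_le (fun z => (h z).le) hz.le
    simp only [y_zero, sub_zero] at this
    unfold q; linarith
  refine lt_of_le_of_ne hle fun e => ?_
  have hc : Comparable a b := Or.inl h
  have h1 := qInv_q hc z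
  have h2 := qInv_q hc 0
  rw [e] at h1
  rw [q_zero, h1] at h2
  exact hz.ne' h2

lemma originCurve_mem (h : ∀ z, b.m z < a.m z) {z : ℝ} (hz : 0 < z) :
    originCurve a b z ∈ Ioo 0 z := by
  constructor
  · rw [originCurve, ← b.strictMono_y.lt_iff_lt, y_yInv, y_zero, ← a.y_zero]
    exact a.strictMono_y hz
  · have := q_diag_neg h hz
    rw [originCurve, ← b.strictMono_y.lt_iff_lt, y_yInv]
    unfold q at this
    linarith

end Profile

namespace RowSystem

open Profile

variable {N : ℕ} (S : RowSystem N) (X : C(closedTriangle, Fin N → ℝ)) (j : Fin N)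

/-! ### Regularity of the kernel entries -/

variable {j} in
lemma kern_below {z ζ : ℝ} (h : 0 ≤ q S.a (S.prof j) z ζ) : S.kern X j z ζ =
    waveKernel S.a (S.prof j) (S.dataP X j) (S.dataBelow X j) (S.source X j) z ζ := if_pos h

variable {j} in
lemma kernZ_below {z ζ : ℝ} (h : 0 ≤ q S.a (S.prof j) z ζ) : S.kernZ X j z ζ =
    waveKernelZ S.a (S.prof j) (S.dataP X j) (S.dataBelow X j) (S.source X j) z ζ := if_pos h

variable {j} in
lemma kernζ_below {z ζ : ℝ} (h : 0 ≤ q S.a (S.prof j) z ζ) : S.kernζ X j z ζ =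
    waveKernelζ S.a (S.prof j) (S.dataP X j) (S.dataBelow X j) (S.source X j) z ζ := if_pos h

variable {j} in
lemma kern_above {z ζ : ℝ} (h : q S.a (S.prof j) z ζ < 0) : S.kern X j z ζ =
    waveKernel S.a (S.prof j) (S.dataP X j) (S.dataAbove X j) (S.source X j) z ζ :=
  if_neg h.not_ge

variable {j} in
lemma kernZ_above {z ζ : ℝ} (h : q S.a (S.prof j) z ζ < 0) : S.kernZ X j z ζ =
    waveKernelZ S.a (S.prof j) (S.dataP X j) (S.dataAbove X j) (S.source X j) z ζ :=
  if_neg h.not_ge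

variable {j} in
lemma kernζ_above {z ζ : ℝ} (h : q S.a (S.prof j) z ζ < 0) : S.kernζ X j z ζ =
    waveKernelζ S.a (S.prof j) (S.dataP X j) (S.dataAbove X j) (S.source X j) z ζ :=
  if_neg h.not_ge

lemma piecewiseC1On_kern :
    PiecewiseC1On closedTriangle (S.kern X j) (S.kernZ X j) (S.kernζ X j) := by
  by_cases hj : S.row < j
  · have hlt : ∀ z, (S.prof j).m z < S.a.m z := fun z => S.anti z hj
    refine piecewiseC1On_of_eqOn_curve (S.isC1_below X j) (S.isC1_above X j)
      (contDiff_originCurve (a := S.a) (b := S.prof j)) (by simp [originCurve, yInv_zero])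
      (fun z hz => originCurve_mem hlt hz.1) ?_ ?_ ?_ ?_ ?_ ?_
    · exact fun x _ h => S.kern_below X (le_originCurve_iff.1 h)
    · exact fun x _ h => S.kernZ_below X (le_originCurve_iff.1 h)
    · exact fun x _ h => S.kernζ_below X (le_originCurve_iff.1 h)
    · exact fun x _ h => S.kern_above X (lt_of_not_ge fun h' => h.not_ge (le_originCurve_iff.2 h'))
    · exact fun x _ h => S.kernZ_above X (lt_of_not_ge fun h' => h.not_ge (le_originCurve_iff.2 h'))
    · exact fun x _ h => S.kernζ_above X (lt_of_not_ge fun h' => h.not_ge (le_originCurve_iff.2 h'))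
  · have hj' : j ≤ S.row := not_lt.1 hj
    exact piecewiseC1On_of_eqOn (S.isC1_below X j)
      (fun x hx => S.kern_below X (S.q_nonneg_of_le hj' hx))
      (fun x hx => S.kernZ_below X (S.q_nonneg_of_le hj' hx))
      (fun x hx => S.kernζ_below X (S.q_nonneg_of_le hj' hx))

lemma hasDerivWithinAt_kern_z_diag {z : ℝ} (hz : z ∈ Ioo (0 : ℝ) 1) :
    HasDerivWithinAt (fun s => S.kern X j s z) (S.kernZ X j z z) (Icc z 1) z := by
  have hsub : Icc z 1 ⊆ Icc (0 : ℝ) 1 := Icc_subset_Icc_left hz.1.le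
  by_cases hj : S.row < j
  · have hneg := q_diag_neg (fun z => S.anti z hj) hz.1
    rw [S.kernZ_above X hneg]
    refine (((S.isC1_above X j).hasDeriv_z z (Ioo_subset_Icc_self hz) z).mono
      hsub).congr_of_eventuallyEq ?_ (S.kern_above X hneg)
    have hc : Continuous fun s => q S.a (S.prof j) s z :=
      (continuous_q _ _).comp (.prodMk_left z)
    filter_upwards [nhdsWithin_le_nhds (hc.continuousAt.eventually (gt_mem_nhds hneg))] with s hs
    exact S.kern_above X hs
  · have hq : ∀ s ∈ Icc z 1, 0 ≤ q S.a (S.prof j) s z := fun s hs =>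
      S.q_nonneg_of_le (not_lt.1 hj) (x := (s, z)) ⟨hz.1.le, hs.1, hs.2⟩
    have hzz : z ∈ Icc z 1 := ⟨le_rfl, hz.2.le⟩
    rw [S.kernZ_below X (hq z hzz)]
    exact (((S.isC1_below X j).hasDeriv_z z (Ioo_subset_Icc_self hz) z).mono hsub).congr
      (fun s hs => S.kern_below X (hq s hs)) (S.kern_below X (hq z hzz))

lemma hasDerivWithinAt_kern_ζ_diag {z : ℝ} (hz : z ∈ Ioo (0 : ℝ) 1) :
    HasDerivWithinAt (fun s => S.kern X j z s) (S.kernζ X j z z) (Icc 0 z) z := by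
  have hsub : Icc 0 z ⊆ Icc (0 : ℝ) 1 := Icc_subset_Icc_right hz.2.le
  by_cases hj : S.row < j
  · have hneg := q_diag_neg (fun z => S.anti z hj) hz.1
    rw [S.kernζ_above X hneg]
    refine (((S.isC1_above X j).hasDeriv_ζ z z (Ioo_subset_Icc_self hz)).mono
      hsub).congr_of_eventuallyEq ?_ (S.kern_above X hneg)
    have hc : Continuous fun s => q S.a (S.prof j) z s :=
      (continuous_q _ _).comp (.prodMk_right z)
    filter_upwards [nhdsWithin_le_nhds (hc.continuousAt.eventually (gt_mem_nhds hneg))] with s hs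
    exact S.kern_above X hs
  · have hq : ∀ s ∈ Icc 0 z, 0 ≤ q S.a (S.prof j) z s := fun s hs =>
      S.q_nonneg_of_le (not_lt.1 hj) (x := (z, s)) ⟨hs.1, hs.2, hz.2.le⟩
    have hzz : z ∈ Icc 0 z := ⟨hz.1.le, le_rfl⟩
    rw [S.kernζ_below X (hq z hzz)]
    exact (((S.isC1_below X j).hasDeriv_ζ z z (Ioo_subset_Icc_self hz)).mono hsub).congr
      (fun s hs => S.kern_below X (hq s hs)) (S.kern_below X (hq z hzz))

lemma q_zero_right (z : ℝ) : q S.a (S.prof j) z 0 = S.a.y z := by simp [q]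

lemma p_zero_right (z : ℝ) : p S.a (S.prof j) z 0 = S.a.y z := by simp [p]

lemma y_nonneg {z : ℝ} (hz : 0 ≤ z) : 0 ≤ S.a.y z := by
  simpa using S.a.strictMono_y.monotone hz

lemma hasDerivWithinAt_kern_ζ_zero {z : ℝ} (hz : z ∈ Ioc (0 : ℝ) 1) :
    HasDerivWithinAt (fun s => S.kern X j z s) (S.kernζ X j z 0) (Icc 0 z) 0 := by
  have hsub : Icc 0 z ⊆ Icc (0 : ℝ) 1 := Icc_subset_Icc_right hz.2
  have hpos : 0 < q S.a (S.prof j) z 0 := by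
    rw [q_zero_right, ← S.a.y_zero]; exact S.a.strictMono_y hz.1
  rw [S.kernζ_below X hpos.le]
  refine (((S.isC1_below X j).hasDeriv_ζ z 0 ⟨le_rfl, zero_le_one⟩).mono
    hsub).congr_of_eventuallyEq ?_ (S.kern_below X hpos.le)
  have hc : Continuous fun s => q S.a (S.prof j) z s :=
    (continuous_q _ _).comp (.prodMk_right z)
  filter_upwards [nhdsWithin_le_nhds (hc.continuousAt.eventually (lt_mem_nhds hpos))] with s hs
  exact S.kern_below X (le_of_lt hs)

lemma continuousOn_kern_zero : ContinuousOn (fun z => S.kern X j z 0) (Icc 0 1) :=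
  ((S.continuous_kern X j).comp (.prodMk_left 0)).continuousOn

lemma continuousOn_kernζ_zero : ContinuousOn (fun z => S.kernζ X j z 0) (Icc 0 1) := by
  refine ((S.isC1_below X j).continuous_ζ.comp (.prodMk_left 0)).continuousOn.congr fun z hz => ?_
  exact S.kernζ_below X (by rw [q_zero_right]; exact S.y_nonneg hz.1)

/-! ### The kernel entries on the diagonal -/

variable {j} in
lemma kern_diag_eq_zero (hj : j ≠ S.row) {z : ℝ} (hz : z ∈ Icc (0 : ℝ) 1) :
    S.kern X j z z = 0 := by
  have hv := waveSol_axisCauchy_diag (S.comparable hj) (S.continuous_diagU j)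
    (S.continuous_source X j) z
  rcases lt_or_gt_of_ne hj with h | h
  · rw [S.kern_below X (S.q_nonneg_of_le h.le (x := (z, z)) ⟨hz.1, le_rfl, hz.2⟩), waveKernel,
      dataBelow, if_neg h.not_ge, dataP, hv, mul_zero]
  · rcases hz.1.eq_or_lt with rfl | h0
    · rw [S.kern_below X (by simp), waveKernel]
      simp [waveSol_zero]
    · rw [S.kern_above X (q_diag_neg (fun z => S.anti z h) h0), waveKernel,
        dataAbove, if_pos h, dataP, hv, mul_zero]

lemma kern_zero_zero : S.kern X j 0 0 = 0 := by
  rw [S.kern_below X (by simp), waveKernel]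
  simp [waveSol_zero]

variable {j} in
/-- Off the column of the row index, the derivatives on the diagonal come from the Cauchy data. -/
lemma kern_deriv_diag (hj : j ≠ S.row) {z : ℝ} (hz : z ∈ Ioo (0 : ℝ) 1) :
    S.kernZ X j z z = w S.a (S.prof j) z z * ((S.diagU j z + diagV S.a (S.prof j) (S.diagU j) z)
        * (S.a.m z ^ 2)⁻¹) ∧
      S.kernζ X j z z = w S.a (S.prof j) z z *
        ((S.diagU j z - diagV S.a (S.prof j) (S.diagU j) z) * ((S.prof j).m z ^ 2)⁻¹) := by
  have hF := S.continuous_source X j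
  have hv := waveSol_axisCauchy_diag (S.comparable hj) (S.continuous_diagU j) hF z
  have hQ := waveQ_axisCauchy_diag (U := S.diagU j) (S.comparable hj) hF z
  have hP : waveP (axisP S.a (S.prof j) (S.diagU j) (S.source X j)) (S.source X j)
      (p S.a (S.prof j) z z) (q S.a (S.prof j) z z) = S.diagU j z := by
    rw [waveP_axisP hF, ampP_diag]
  rcases lt_or_gt_of_ne hj with h | h
  · have hq := S.q_nonneg_of_le h.le (x := (z, z)) ⟨hz.1.le, le_rfl, hz.2.le⟩
    rw [S.kernZ_below X hq, S.kernζ_below X hq, waveKernelZ, waveKernelζ,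
      dataBelow, if_neg h.not_ge, dataP, hv, hQ, hP]
    simp
  · have hq := q_diag_neg (fun z => S.anti z h) hz.1
    rw [S.kernZ_above X hq, S.kernζ_above X hq, waveKernelZ, waveKernelζ,
      dataAbove, if_pos h, dataP, hv, hQ, hP]
    simp

/-- The equation on the diagonal. -/
lemma exists_deriv_diag {z : ℝ} (hz : z ∈ Ioo (0 : ℝ) 1) :
    ∃ D, HasDerivAt (fun s => S.kern X j s s) D z ∧
      S.a.m z ^ 4 * D + S.a.m z ^ 4 * S.kernZ X j z z + S.kernζ X j z z * (S.prof j).m z ^ 4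
        + S.kern X j z z * (4 * (S.prof j).m z ^ 3 * (S.prof j).d z) = -S.react S.row j z := by
  have ha := S.a.ne_zero z
  have hb := (S.prof j).ne_zero z
  have hsum : S.a.m z ^ 2 + (S.prof j).m z ^ 2 ≠ 0 := by
    have := S.a.pos z; positivity
  by_cases hj : j = S.row
  · subst hj
    have hq : ∀ s, q S.a S.a s s = 0 := fun s => sub_self _
    have hk : ∀ s, S.kern X S.row s s = waveKernel S.a S.a (S.dataP X S.row)
        (S.dataBelow X S.row) (S.source X S.row) s s := fun s => S.kern_below X (hq s).ge
    have hF := S.continuous_source X S.row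
    have hP : waveP (S.dataP X S.row) (S.source X S.row) (p S.a S.a z z) (q S.a S.a z z)
        = S.diagU S.row z := by
      rw [dataP, waveP_axisP hF, ampP_diag]
    have hv := hasDerivWithinAt_waveSol_comp (S.continuous_dataP X S.row)
      (S.continuous_dataBelow X S.row) hF (hasDerivAt_p_diag S.a S.a z).hasDerivWithinAt
      (hasDerivAt_q_diag S.a S.a z).hasDerivWithinAt (s := univ)
    rw [hasDerivWithinAt_univ, hP] at hv
    have hm := S.a.hasDerivAt_m hz
    have hd := (hm.mul ((hm.pow 3).inv (pow_ne_zero 3 ha))).mul hv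
    refine ⟨_, hd.congr_of_eventuallyEq (Eventually.of_forall fun s => hk s), ?_⟩
    rw [hk z, S.kernZ_below X (hq z).ge, S.kernζ_below X (hq z).ge, waveKernelZ, waveKernelζ,
      waveKernel, hP]
    simp only [diagU, w, Pi.mul_apply, Pi.inv_apply, Pi.pow_apply]
    field_simp
    push_cast
    ring
  · refine ⟨0, ?_, ?_⟩
    · refine (hasDerivAt_const z (0 : ℝ)).congr_of_eventuallyEq ?_
      filter_upwards [isOpen_Ioo.mem_nhds hz] with s hs
      exact S.kern_diag_eq_zero X hj (Ioo_subset_Icc_self hs)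
    · obtain ⟨h1, h2⟩ := S.kern_deriv_diag X hj hz
      have hne := (S.comparable hj).sq_sub_ne_zero z
      rw [S.kern_diag_eq_zero X hj (Ioo_subset_Icc_self hz), h1, h2]
      simp only [diagV, diagU, w]
      field_simp
      ring

/-! ### The kernel entries on the boundary `ζ = 0` -/

/-- The wave of column `j` arriving at the boundary `ζ = 0`. -/
def arriving (s : ℝ) : ℝ := ampP S.a (S.prof j) (S.diagU j) (S.source X j) s s

/-- The amplitude of column `j` on the boundary `ζ = 0`. -/
def boundaryAmp (s : ℝ) : ℝ :=
  ∫ t in 0..s, (S.arriving X j t + S.refl j * S.arriving X (S.partner j) t)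

variable {j} in
lemma kern_boundary (hj : S.row ≤ j) {z : ℝ} (hz : 0 ≤ z) :
    S.kern X j z 0 = w S.a (S.prof j) z 0 * S.boundaryAmp X j (S.a.y z) := by
  have hq : 0 ≤ q S.a (S.prof j) z 0 := by rw [q_zero_right]; exact S.y_nonneg hz
  rw [S.kern_below X hq, waveKernel, dataBelow, if_pos hj, q_zero_right, p_zero_right, dataP,
    waveSol_axisReflect_self (S.continuous_diagU j) (S.continuous_reflected X j)
      (S.continuous_source X j)]
  rfl

variable {j} in
lemma kernζ_boundary (hj : S.row ≤ j) {z : ℝ} (hz : 0 ≤ z) :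
    S.kernζ X j z 0 = -(3 * S.a.m z * (S.prof j).d 0 * ((S.prof j).m 0 ^ 4)⁻¹)
        * S.boundaryAmp X j (S.a.y z)
      + w S.a (S.prof j) z 0 * ((S.arriving X j (S.a.y z)
        - S.refl j * S.arriving X (S.partner j) (S.a.y z)) * ((S.prof j).m 0 ^ 2)⁻¹) := by
  have hq : 0 ≤ q S.a (S.prof j) z 0 := by rw [q_zero_right]; exact S.y_nonneg hz
  rw [S.kernζ_below X hq, waveKernelζ, dataBelow, if_pos hj, q_zero_right, p_zero_right, dataP,
    waveSol_axisReflect_self (S.continuous_diagU j) (S.continuous_reflected X j)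
      (S.continuous_source X j), waveP_axisP (S.continuous_source X j), waveQ_axisReflect_self]
  rfl

/-! ### The weak equation for the kernel entries -/

variable {X} in
/-- A fixed point of `step` solves the weak kernel equation. -/
lemma weak_equation (hX : S.step X = X) {φ : ℝ × ℝ → ℝ} (hφ : ContDiff ℝ ∞ φ)
    (hc : HasCompactSupport φ) (hT : tsupport φ ⊆ openTriangle) {lam lam' : ℝ → ℝ}
    (hlam : ∀ z ∈ Ioo (0 : ℝ) 1, lam z = S.a.m z ^ 4)
    (hlam' : ∀ z ∈ Ioo (0 : ℝ) 1, lam' z = (S.prof j).m z ^ 4) :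
    ∫ x in openTriangle, (S.kern X j x.1 x.2 *
          iteratedDeriv 2 (fun s => lam s * φ (s, x.2)) x.1
        - S.kern X j x.1 x.2 * lam' x.2 * iteratedDeriv 2 (fun s => φ (x.1, s)) x.2)
      = ∫ x in openTriangle, (∑ k, S.kern X k x.1 x.2 * S.react k j x.2) * φ x := by
  have hF := S.continuous_source X j
  have hA : Continuous fun p => ∫ t in 0..p, S.dataP X j t :=
    intervalIntegral.continuous_primitive (fun _ _ =>
      (S.continuous_dataP X j).intervalIntegrable _ _) 0
  let B : ℝ → ℝ := fun q =>
    if 0 ≤ q then ∫ t in 0..q, S.dataBelow X j t else ∫ t in 0..q, S.dataAbove X j t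
  have hB : Continuous B := by
    refine Continuous.if_le ?_ ?_ continuous_const continuous_id fun q hq => ?_
    · exact intervalIntegral.continuous_primitive (fun _ _ =>
        (S.continuous_dataBelow X j).intervalIntegrable _ _) 0
    · exact intervalIntegral.continuous_primitive (fun _ _ =>
        (S.continuous_dataAbove X j).intervalIntegrable _ _) 0
    · rw [← show (0 : ℝ) = q from hq]; simp
  have hu : Continuous (Function.uncurry fun p q => (∫ t in 0..p, S.dataP X j t) + B q
      + ∫ s in 0..p, ∫ t in 0..q, S.source X j s t) :=
    ((hA.comp continuous_fst).add (hB.comp continuous_snd)).add (continuous_doubleIntegral hF)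
  have hkern : ∀ z ζ, S.kern X j z ζ = w S.a (S.prof j) z ζ *
      ((∫ t in 0..(p S.a (S.prof j) z ζ), S.dataP X j t) + B (q S.a (S.prof j) z ζ)
      + ∫ s in 0..(p S.a (S.prof j) z ζ), ∫ t in 0..(q S.a (S.prof j) z ζ),
        S.source X j s t) := by
    intro z ζ
    simp only [B, kern, waveKernel, waveSol]
    split_ifs <;> rfl
  refine WeakWave.kernel_equation (S := fun z ζ => ∑ k, S.kern X k z ζ * S.react k j ζ) hφ hc hT
    hu hF (weakWave_sum hφ hc hT hA hB hF) hlam hlam' (fun x _ => hkern x.1 x.2) fun x hx => ?_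
  have hx' : x ∈ closedTriangle := ⟨hx.1.le, hx.2.1.le, hx.2.2.le⟩
  have hXk : ∀ k, X ⟨x, hx'⟩ k = S.kern X k x.1 x.2 := fun k => by
    conv_lhs => rw [← hX]
    rfl
  have hw := (w_pos S.a (S.prof j) x.1 x.2).ne'
  rw [mul_add, mul_left_comm, ← hkern, S.source_p_q X j hx']
  have e : w S.a (S.prof j) x.1 x.2 * (4 * ∑ k, S.coef j k x * X ⟨x, hx'⟩ k)
      = ∑ k, (S.kern X k x.1 x.2 * S.react k j x.2
        - if k = j then (S.a.c x.1 - (S.prof j).c x.2) * S.kern X k x.1 x.2 else 0) := by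
    rw [← mul_assoc, Finset.mul_sum]
    refine Finset.sum_congr rfl fun k _ => ?_
    rw [hXk, coef]
    split_ifs
    · field_simp
    · field_simp
      ring
  rw [e, Finset.sum_sub_distrib, Finset.sum_ite_eq' Finset.univ j, if_pos (Finset.mem_univ j)]
  ring

end RowSystem

/-! ### The folded system -/

/-- The profile of a positive diffusion coefficient of class `C²` on `[0, 1]`. -/
def Profile.ofDiffusion (f : ℝ → ℝ) (hf : ContDiffOn ℝ 2 f (Icc 0 1))
    (hpos : ∀ z ∈ Icc (0 : ℝ) 1, 0 < f z) : Profile :=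
  have hg : ContDiffOn ℝ 2 (fun z => √√(f z)) (Icc 0 1) :=
    (hf.sqrt fun z hz => (hpos z hz).ne').sqrt fun z hz => (Real.sqrt_pos.2 (hpos z hz)).ne'
  have hg1 : ContDiffOn ℝ 1 (derivWithin (fun z => √√(f z)) (Icc 0 1)) (Icc 0 1) :=
    hg.derivWithin (uniqueDiffOn_Icc zero_lt_one) (by norm_num)
  have hg2 : ContinuousOn (derivWithin (derivWithin (fun z => √√(f z)) (Icc 0 1)) (Icc 0 1))
      (Icc 0 1) :=
    hg1.continuousOn_derivWithin (uniqueDiffOn_Icc zero_lt_one) le_rfl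
  { m := fun z => √√(f (clamp z))
    d := fun z => derivWithin (fun z => √√(f z)) (Icc 0 1) (clamp z)
    d2 := fun z => derivWithin (derivWithin (fun z => √√(f z)) (Icc 0 1)) (Icc 0 1) (clamp z)
    continuous_m := hg.continuousOn.comp_continuous continuous_clamp clamp_mem
    continuous_d := hg1.continuousOn.comp_continuous continuous_clamp clamp_mem
    continuous_d2 := hg2.comp_continuous continuous_clamp clamp_mem
    pos := fun z => Real.sqrt_pos.2 (Real.sqrt_pos.2 (hpos _ (clamp_mem z)))
    clamp_eq := fun z => by rw [clamp_of_mem (clamp_mem z)]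
    hasDeriv := fun z hz => by
      rw [clamp_of_mem hz]
      refine ((hg.differentiableOn (by norm_num)) z hz).hasDerivWithinAt.congr
        (fun s hs => ?_) ?_
      · rw [clamp_of_mem hs]
      · rw [clamp_of_mem hz]
    hasDeriv2 := fun z hz => by
      rw [clamp_of_mem hz]
      refine ((hg1.differentiableOn (by norm_num)) z hz).hasDerivWithinAt.congr
        (fun s hs => ?_) ?_
      · rw [clamp_of_mem hs]
      · rw [clamp_of_mem hz] }

section ofDiffusion

variable {f : ℝ → ℝ} {hf : ContDiffOn ℝ 2 f (Icc 0 1)} {hpos : ∀ z ∈ Icc (0 : ℝ) 1, 0 < f z}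

lemma ofDiffusion_m (z : ℝ) : (Profile.ofDiffusion f hf hpos).m z = √√(f (clamp z)) := rfl

lemma ofDiffusion_m_pow {z : ℝ} (hz : z ∈ Icc (0 : ℝ) 1) :
    (Profile.ofDiffusion f hf hpos).m z ^ 4 = f z := by
  rw [ofDiffusion_m, clamp_of_mem hz, show 4 = 2 * 2 by norm_num, pow_mul,
    Real.sq_sqrt (Real.sqrt_nonneg _), Real.sq_sqrt (hpos z hz).le]

lemma derivWithin_ofDiffusion {z : ℝ} (hz : z ∈ Icc (0 : ℝ) 1) :
    derivWithin f (Icc 0 1) z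
      = 4 * (Profile.ofDiffusion f hf hpos).m z ^ 3 * (Profile.ofDiffusion f hf hpos).d z := by
  have h := ((Profile.ofDiffusion f hf hpos).hasDeriv z hz).pow 4
  have h' : HasDerivWithinAt f (4 * (Profile.ofDiffusion f hf hpos).m z ^ 3
      * (Profile.ofDiffusion f hf hpos).d z) (Icc 0 1) z :=
    (h.congr_deriv (by norm_num)).congr (fun s hs => (ofDiffusion_m_pow hs).symm)
      (ofDiffusion_m_pow hz).symm
  exact h'.derivWithin (uniqueDiffOn_Icc zero_lt_one z hz)

end ofDiffusion

section Folding

variable {n : ℕ} {z₀ : ℝ}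

lemma left_mem (hz₀ : z₀ ∈ Ioo (0 : ℝ) 1) {z : ℝ} (hz : z ∈ Icc (0 : ℝ) 1) :
    z₀ - z₀ * z ∈ Icc (0 : ℝ) 1 := by
  obtain ⟨h1, h2⟩ := hz₀
  obtain ⟨h3, h4⟩ := hz
  constructor <;> nlinarith

lemma right_mem (hz₀ : z₀ ∈ Ioo (0 : ℝ) 1) {z : ℝ} (hz : z ∈ Icc (0 : ℝ) 1) :
    z₀ + (1 - z₀) * z ∈ Icc (0 : ℝ) 1 := by
  obtain ⟨h1, h2⟩ := hz₀
  obtain ⟨h3, h4⟩ := hz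
  constructor <;> nlinarith

lemma foldedDiffusion_left (lam : Fin n → ℝ → ℝ) (j : Fin n) (z : ℝ) :
    foldedDiffusion z₀ lam (Fin.castAdd n j) z = lam j (z₀ - z₀ * z) / z₀ ^ 2 := by
  simp [foldedDiffusion]

lemma foldedDiffusion_right (lam : Fin n → ℝ → ℝ) (j : Fin n) (z : ℝ) :
    foldedDiffusion z₀ lam (Fin.natAdd n j) z = lam j (z₀ + (1 - z₀) * z) / (1 - z₀) ^ 2 := by
  -- `Fin.natAdd_eq_addNat` would hide the right columns from the lemmas on `Fin.addCases`
  simp [foldedDiffusion, -Fin.natAdd_eq_addNat]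

lemma contDiffOn_foldedDiffusion (hz₀ : z₀ ∈ Ioo (0 : ℝ) 1) {lam : Fin n → ℝ → ℝ}
    (hlam : ∀ i, ContDiffOn ℝ 2 (lam i) (Icc 0 1)) (i : Fin (n + n)) :
    ContDiffOn ℝ 2 (foldedDiffusion z₀ lam i) (Icc 0 1) := by
  induction i using Fin.addCases with
  | left j =>
    have h : ContDiffOn ℝ 2 (fun z => lam j (z₀ - z₀ * z)) (Icc 0 1) :=
      (hlam j).comp (t := Icc 0 1) (by fun_prop) fun z hz => left_mem hz₀ hz
    exact (h.div_const (z₀ ^ 2)).congr fun z _ => foldedDiffusion_left lam j z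
  | right j =>
    have h : ContDiffOn ℝ 2 (fun z => lam j (z₀ + (1 - z₀) * z)) (Icc 0 1) :=
      (hlam j).comp (t := Icc 0 1) (by fun_prop) fun z hz => right_mem hz₀ hz
    exact (h.div_const ((1 - z₀) ^ 2)).congr fun z _ => foldedDiffusion_right lam j z

lemma foldedDiffusion_pos (hz₀ : z₀ ∈ Ioo (0 : ℝ) 1) {lam : Fin n → ℝ → ℝ}
    (hpos : ∀ i, ∀ z ∈ Icc (0 : ℝ) 1, 0 < lam i z) (i : Fin (n + n)) :
    ∀ z ∈ Icc (0 : ℝ) 1, 0 < foldedDiffusion z₀ lam i z := by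
  intro z hz
  have h0 := hz₀.1
  have h1 : 0 < 1 - z₀ := sub_pos.2 hz₀.2
  induction i using Fin.addCases with
  | left j =>
    rw [foldedDiffusion_left]
    exact div_pos (hpos j _ (left_mem hz₀ hz)) (by positivity)
  | right j =>
    rw [foldedDiffusion_right]
    exact div_pos (hpos j _ (right_mem hz₀ hz)) (by positivity)

lemma continuousOn_foldedReaction (hz₀ : z₀ ∈ Ioo (0 : ℝ) 1)
    {Ac : ℝ → Matrix (Fin n) (Fin n) ℝ}
    (hAc : ∀ i j, ContinuousOn (fun z => Ac z i j) (Icc 0 1)) (k j : Fin (n + n)) :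
    ContinuousOn (fun z => foldedReaction z₀ Ac z k j) (Icc 0 1) := by
  have hl : ∀ i j, ContinuousOn (fun z => Ac (z₀ - z₀ * z) i j) (Icc 0 1) := fun i j =>
    (hAc i j).comp (t := Icc 0 1) (by fun_prop) fun z hz => left_mem hz₀ hz
  have hr : ∀ i j, ContinuousOn (fun z => Ac (z₀ + (1 - z₀) * z) i j) (Icc 0 1) := fun i j =>
    (hAc i j).comp (t := Icc 0 1) (by fun_prop) fun z hz => right_mem hz₀ hz
  induction k using Fin.addCases <;> induction j using Fin.addCases <;>
    simp [foldedReaction, continuousOn_const, hl, hr, -Fin.natAdd_eq_addNat]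

lemma mul_S₁_apply (M : Matrix (Fin (n + n)) (Fin (n + n)) ℝ) (i : Fin (n + n)) (j : Fin n) :
    (M * S₁ n z₀) i j
      = -(z₀ / (1 - z₀)) * M i (Fin.castAdd n j) + M i (Fin.natAdd n j) := by
  rw [Matrix.mul_apply, Fin.sum_univ_add]
  simp [S₁, Matrix.one_apply, mul_comm, -Fin.natAdd_eq_addNat]

lemma mul_S₂_apply (M : Matrix (Fin (n + n)) (Fin (n + n)) ℝ) (i : Fin (n + n)) (j : Fin n) :
    (M * S₂ n) i j = M i (Fin.castAdd n j) + M i (Fin.natAdd n j) := by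
  rw [Matrix.mul_apply, Fin.sum_univ_add]
  simp [S₂, Matrix.one_apply, -Fin.natAdd_eq_addNat]

variable (n) in
/-- The column in which a wave reflected at the boundary `ζ = 0` of row `i` arrives. The left and
right column of a pair exchange waves if the fold conditions of the pair are imposed in the row,
that is, if the row is not below the diagonal entry of the left column. -/
def foldPartner (i j : Fin (n + n)) : Fin (n + n) :=
  Fin.addCases (fun l => Fin.natAdd n l)
    (fun r => if i ≤ Fin.castAdd n r then Fin.castAdd n r else Fin.natAdd n r) j

variable (n) in
/-- The coefficient with which the wave arriving in column `foldPartner n i j` is sent back into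
column `j`; no wave is sent back into a right column if the fold conditions are not imposed. -/
def foldRefl (prof : Fin (n + n) → Profile) (i j : Fin (n + n)) : ℝ :=
  Fin.addCases (fun l => (prof (Fin.castAdd n l)).m 0 / (prof (Fin.natAdd n l)).m 0)
    (fun r => if i ≤ Fin.castAdd n r then
      (prof (Fin.natAdd n r)).m 0 / (prof (Fin.castAdd n r)).m 0 else 0) j

lemma le_foldPartner (i j : Fin (n + n)) (h : i ≤ j) : i ≤ foldPartner n i j := by
  induction j using Fin.addCases with
  | left l =>
    simp only [foldPartner, Fin.addCases_left]
    exact h.trans (by simp [Fin.le_def])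
  | right r =>
    simp only [foldPartner, Fin.addCases_right]
    split_ifs with h'
    · exact h'
    · exact h

/-- The kernel equations of row `i` of the folded system. The reaction coefficients are continued
as constants outside `[0, 1]`. -/
def foldedRow (hz₀ : z₀ ∈ Ioo (0 : ℝ) 1) {lam : Fin n → ℝ → ℝ}
    (hlam : ∀ i, ContDiffOn ℝ 2 (lam i) (Icc 0 1))
    (hpos : ∀ i, ∀ z ∈ Icc (0 : ℝ) 1, 0 < lam i z)
    (hfolded : ∀ z ∈ Icc (0 : ℝ) 1, StrictAnti fun i => foldedDiffusion z₀ lam i z)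
    {Ac : ℝ → Matrix (Fin n) (Fin n) ℝ}
    (hAc : ∀ i j, ContinuousOn (fun z => Ac z i j) (Icc 0 1)) (μ : ℝ) (i : Fin (n + n)) :
    RowSystem (n + n) where
  prof j := Profile.ofDiffusion (foldedDiffusion z₀ lam j) (contDiffOn_foldedDiffusion hz₀ hlam j)
    (foldedDiffusion_pos hz₀ hpos j)
  anti z j k h := Real.sqrt_lt_sqrt (Real.sqrt_nonneg _) (Real.sqrt_lt_sqrt
    (foldedDiffusion_pos hz₀ hpos k _ (clamp_mem z)).le (hfolded _ (clamp_mem z) h))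
  react k j ζ := (foldedReaction z₀ Ac (clamp ζ) + μ • 1) k j
  continuous_react k j := by
    have := (continuousOn_foldedReaction hz₀ hAc k j).comp_continuous continuous_clamp clamp_mem
    simp only [Matrix.add_apply]
    exact this.add continuous_const
  row := i
  partner := foldPartner n i
  le_partner := le_foldPartner i
  refl := foldRefl n (fun j => Profile.ofDiffusion (foldedDiffusion z₀ lam j)
    (contDiffOn_foldedDiffusion hz₀ hlam j) (foldedDiffusion_pos hz₀ hpos j)) i

/-- For `a` and `b` the values at `0` of the profiles of a pair of folded columns and `c` the
unfolded diffusion coefficient at `z₀`, both sides are `√c`. -/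
lemma sq_m_zero (hz₀ : z₀ ∈ Ioo (0 : ℝ) 1) {a b c : ℝ} (ha : 0 < a) (hb : 0 < b)
    (hac : a ^ 4 = c / z₀ ^ 2) (hbc : b ^ 4 = c / (1 - z₀) ^ 2) :
    a ^ 2 * z₀ = b ^ 2 * (1 - z₀) := by
  have h0 := hz₀.1
  have h1 : 0 < 1 - z₀ := sub_pos.2 hz₀.2
  have e : (a ^ 2 * z₀) ^ 2 = (b ^ 2 * (1 - z₀)) ^ 2 := by
    calc (a ^ 2 * z₀) ^ 2 = a ^ 4 * z₀ ^ 2 := by ring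
      _ = c := by rw [hac]; field_simp
      _ = b ^ 4 * (1 - z₀) ^ 2 := by rw [hbc]; field_simp
      _ = _ := by ring
  exact (sq_eq_sq₀ (by positivity) (by positivity)).1 e

lemma derivWithin_foldedDiffusion_left (hz₀ : z₀ ∈ Ioo (0 : ℝ) 1) {lam : Fin n → ℝ → ℝ}
    (hlam : ∀ i, ContDiffOn ℝ 2 (lam i) (Icc 0 1)) (j : Fin n) :
    derivWithin (foldedDiffusion z₀ lam (Fin.castAdd n j)) (Icc 0 1) 0
      = -deriv (lam j) z₀ / z₀ := by
  have h0 := hz₀.1.ne'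
  have hd : HasDerivAt (lam j) (deriv (lam j) z₀) (z₀ - z₀ * 0) := by
    rw [mul_zero, sub_zero]
    exact (((hlam j).differentiableOn (by norm_num)).differentiableAt
      (Icc_mem_nhds hz₀.1 hz₀.2)).hasDerivAt
  have ha : HasDerivAt (fun z => z₀ - z₀ * z) (-z₀) 0 := by
    simpa using ((hasDerivAt_id' (0 : ℝ)).const_mul z₀).const_sub z₀
  have h := ((hd.comp 0 ha).div_const (z₀ ^ 2)).hasDerivWithinAt (s := Icc 0 1)
  have h' := h.congr (fun z _ => foldedDiffusion_left lam j z) (foldedDiffusion_left lam j 0)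
  rw [h'.derivWithin (uniqueDiffOn_Icc zero_lt_one 0 ⟨le_rfl, zero_le_one⟩)]
  field_simp

lemma derivWithin_foldedDiffusion_right (hz₀ : z₀ ∈ Ioo (0 : ℝ) 1) {lam : Fin n → ℝ → ℝ}
    (hlam : ∀ i, ContDiffOn ℝ 2 (lam i) (Icc 0 1)) (j : Fin n) :
    derivWithin (foldedDiffusion z₀ lam (Fin.natAdd n j)) (Icc 0 1) 0
      = deriv (lam j) z₀ / (1 - z₀) := by
  have h0 : 1 - z₀ ≠ 0 := (sub_pos.2 hz₀.2).ne'
  have hd : HasDerivAt (lam j) (deriv (lam j) z₀) (z₀ + (1 - z₀) * 0) := by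
    rw [mul_zero, add_zero]
    exact (((hlam j).differentiableOn (by norm_num)).differentiableAt
      (Icc_mem_nhds hz₀.1 hz₀.2)).hasDerivAt
  have ha : HasDerivAt (fun z => z₀ + (1 - z₀) * z) (1 - z₀) 0 := by
    simpa using ((hasDerivAt_id' (0 : ℝ)).const_mul (1 - z₀)).const_add z₀
  have h := ((hd.comp 0 ha).div_const ((1 - z₀) ^ 2)).hasDerivWithinAt (s := Icc 0 1)
  have h' := h.congr (fun z _ => foldedDiffusion_right lam j z) (foldedDiffusion_right lam j 0)
  rw [h'.derivWithin (uniqueDiffOn_Icc zero_lt_one 0 ⟨le_rfl, zero_le_one⟩)]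
  field_simp

end Folding

/-! ### The fold conditions for a pair of columns -/

namespace RowSystem

open Profile

variable {N : ℕ} (S : RowSystem N) (X : C(closedTriangle, Fin N → ℝ))

/-- Two columns that send their arriving waves into each other with reciprocal coefficients
`κl / κr` and `κr / κl` have boundary amplitudes in the ratio of `κl` to `κr`. -/
lemma boundaryAmp_pair {l r : Fin N} {κl κr : ℝ} (hl : κl ≠ 0) (hr : κr ≠ 0)
    (pl : S.partner l = r) (pr : S.partner r = l) (rl : S.refl l = κl / κr)
    (rr : S.refl r = κr / κl) (s : ℝ) :
    S.boundaryAmp X l s = κl / κr * S.boundaryAmp X r s := by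
  rw [boundaryAmp, boundaryAmp, ← intervalIntegral.integral_const_mul, pl, pr, rl, rr]
  congr 1; funext t
  field_simp
  ring

/-- The fold conditions for a pair of columns: continuity of `K λ` up to the factor `ρ`, and
continuity of the flux `(K λ)_ζ`. -/
lemma fold_pair {l r : Fin N} (hl : S.row ≤ l) (hr : S.row ≤ r)
    (pl : S.partner l = r) (pr : S.partner r = l)
    (rl : S.refl l = (S.prof l).m 0 / (S.prof r).m 0)
    (rr : S.refl r = (S.prof r).m 0 / (S.prof l).m 0) {ρ : ℝ}
    (hρ : (S.prof r).m 0 ^ 2 = ρ * (S.prof l).m 0 ^ 2)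
    (hd : (S.prof l).m 0 * (S.prof l).d 0 + (S.prof r).m 0 * (S.prof r).d 0 = 0)
    {z : ℝ} (hz : 0 ≤ z) :
    -ρ * (S.kern X l z 0 * (S.prof l).m 0 ^ 4) + S.kern X r z 0 * (S.prof r).m 0 ^ 4 = 0 ∧
      S.kernζ X l z 0 * (S.prof l).m 0 ^ 4
        + S.kern X l z 0 * (4 * (S.prof l).m 0 ^ 3 * (S.prof l).d 0)
        + (S.kernζ X r z 0 * (S.prof r).m 0 ^ 4
        + S.kern X r z 0 * (4 * (S.prof r).m 0 ^ 3 * (S.prof r).d 0)) = 0 := by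
  have hl0 := (S.prof l).ne_zero 0
  have hr0 := (S.prof r).ne_zero 0
  rw [S.kern_boundary X hl hz, S.kern_boundary X hr hz, S.kernζ_boundary X hl hz,
    S.kernζ_boundary X hr hz, S.boundaryAmp_pair X hl0 hr0 pl pr rl rr, pl, pr, rl, rr]
  simp only [w]
  set κ := (S.prof l).m 0
  set κ' := (S.prof r).m 0
  set V := S.boundaryAmp X r (S.a.y z)
  constructor
  · have e : -ρ * (S.a.m z * (κ ^ 3)⁻¹ * (κ / κ' * V) * κ ^ 4) + S.a.m z * (κ' ^ 3)⁻¹ * V * κ' ^ 4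
        = S.a.m z * V / κ' * (κ' ^ 2 - ρ * κ ^ 2) := by
      field_simp
      ring
    rw [e, hρ, sub_self, mul_zero]
  · trans S.a.m z * V / κ' * (κ * (S.prof l).d 0 + κ' * (S.prof r).d 0)
    · field_simp
      ring
    · rw [hd, mul_zero]

end RowSystem

/-! ### The well-posedness terms -/

variable {n : ℕ} {z₀ : ℝ}

lemma piecewiseContinuousOnUnit_of_continuousOn {f : ℝ → ℝ} (hf : ContinuousOn f (Icc 0 1)) :
    PiecewiseContinuousOnUnit f := ⟨∅, by simpa using hf, by simp⟩

/-- The matrix that vanishes in the right columns, and whose column `j ≤ n` is `c i j` strictly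
below the diagonal. -/
def lowerLeft (c : Fin (n + n) → Fin n → ℝ) : Matrix (Fin (n + n)) (Fin (n + n)) ℝ :=
  Matrix.of fun i j => Fin.addCases (fun l => if Fin.castAdd n l < i then c i l else 0)
    (fun _ => 0) j

lemma lowerLeft_left (c : Fin (n + n) → Fin n → ℝ) (i : Fin (n + n)) (l : Fin n) :
    lowerLeft c i (Fin.castAdd n l) = if Fin.castAdd n l < i then c i l else 0 := by
  simp [lowerLeft]

lemma lowerLeft_right (c : Fin (n + n) → Fin n → ℝ) (i : Fin (n + n)) (r : Fin n) :
    lowerLeft c i (Fin.natAdd n r) = 0 := by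
  simp [lowerLeft, -Fin.natAdd_eq_addNat]

lemma isStrictlyLowerTriangular_lowerLeft (c : ℝ → Fin (n + n) → Fin n → ℝ) :
    IsStrictlyLowerTriangular fun z => lowerLeft (c z) := by
  intro z _ i j hij
  induction j using Fin.addCases with
  | left l => exact (lowerLeft_left _ _ _).trans (if_neg hij.not_gt)
  | right r => exact lowerLeft_right _ _ _

lemma piecewiseContinuousOnUnit_lowerLeft {c : ℝ → Fin (n + n) → Fin n → ℝ}
    (hc : ∀ i l, ContinuousOn (fun z => c z i l) (Icc 0 1)) (i j : Fin (n + n)) :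
    PiecewiseContinuousOnUnit fun z => lowerLeft (c z) i j := by
  refine piecewiseContinuousOnUnit_of_continuousOn ?_
  induction j using Fin.addCases with
  | left l =>
    simp only [lowerLeft_left]
    split_ifs
    · exact hc i l
    · exact continuousOn_const
  | right r =>
    simp only [lowerLeft_right]
    exact continuousOn_const

section Rows

variable (hz₀ : z₀ ∈ Ioo (0 : ℝ) 1) {lam : Fin n → ℝ → ℝ}
  (hlam : ∀ i, ContDiffOn ℝ 2 (lam i) (Icc 0 1))
  (hpos : ∀ i, ∀ z ∈ Icc (0 : ℝ) 1, 0 < lam i z)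
  (hfolded : ∀ z ∈ Icc (0 : ℝ) 1, StrictAnti fun i => foldedDiffusion z₀ lam i z)
  {Ac : ℝ → Matrix (Fin n) (Fin n) ℝ}
  (hAc : ∀ i j, ContinuousOn (fun z => Ac z i j) (Icc 0 1)) (μ : ℝ)

local notation "row" => foldedRow hz₀ hlam hpos hfolded hAc μ

lemma foldedRow_m_pow (i j : Fin (n + n)) {z : ℝ} (hz : z ∈ Icc (0 : ℝ) 1) :
    ((row i).prof j).m z ^ 4 = foldedDiffusion z₀ lam j z :=
  ofDiffusion_m_pow (hf := contDiffOn_foldedDiffusion hz₀ hlam j)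
    (hpos := foldedDiffusion_pos hz₀ hpos j) hz

lemma foldedRow_deriv (i j : Fin (n + n)) {z : ℝ} (hz : z ∈ Icc (0 : ℝ) 1) :
    4 * ((row i).prof j).m z ^ 3 * ((row i).prof j).d z
      = derivWithin (foldedDiffusion z₀ lam j) (Icc 0 1) z :=
  (derivWithin_ofDiffusion (hf := contDiffOn_foldedDiffusion hz₀ hlam j)
    (hpos := foldedDiffusion_pos hz₀ hpos j) hz).symm

/-- The fold conditions hold in row `i` for the columns `j` and `n + j` unless the left one is
strictly below the diagonal. -/
lemma foldedRow_fold {i : Fin (n + n)} {j : Fin n} (hij : i ≤ Fin.castAdd n j)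
    (X : C(closedTriangle, Fin (n + n) → ℝ)) {z : ℝ} (hz : 0 ≤ z) :
    -(z₀ / (1 - z₀)) * ((row i).kern X (Fin.castAdd n j) z 0
          * foldedDiffusion z₀ lam (Fin.castAdd n j) 0)
        + (row i).kern X (Fin.natAdd n j) z 0 * foldedDiffusion z₀ lam (Fin.natAdd n j) 0 = 0 ∧
      (row i).kernζ X (Fin.castAdd n j) z 0 * foldedDiffusion z₀ lam (Fin.castAdd n j) 0
        + (row i).kern X (Fin.castAdd n j) z 0
          * derivWithin (foldedDiffusion z₀ lam (Fin.castAdd n j)) (Icc 0 1) 0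
        + ((row i).kernζ X (Fin.natAdd n j) z 0 * foldedDiffusion z₀ lam (Fin.natAdd n j) 0
        + (row i).kern X (Fin.natAdd n j) z 0
          * derivWithin (foldedDiffusion z₀ lam (Fin.natAdd n j)) (Icc 0 1) 0) = 0 := by
  have h0 := hz₀.1
  have h1 : 0 < 1 - z₀ := sub_pos.2 hz₀.2
  have hmem : (0 : ℝ) ∈ Icc (0 : ℝ) 1 := ⟨le_rfl, zero_le_one⟩
  have el := foldedRow_m_pow hz₀ hlam hpos hfolded hAc μ i (Fin.castAdd n j) hmem
  have er := foldedRow_m_pow hz₀ hlam hpos hfolded hAc μ i (Fin.natAdd n j) hmem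
  have dl := foldedRow_deriv hz₀ hlam hpos hfolded hAc μ i (Fin.castAdd n j) hmem
  have dr := foldedRow_deriv hz₀ hlam hpos hfolded hAc μ i (Fin.natAdd n j) hmem
  have pl := ((row i).prof (Fin.castAdd n j)).pos 0
  have pr := ((row i).prof (Fin.natAdd n j)).pos 0
  have hsq := sq_m_zero hz₀ (c := lam j z₀) pl pr
    (by rw [el, foldedDiffusion_left, mul_zero, sub_zero])
    (by rw [er, foldedDiffusion_right, mul_zero, add_zero])
  rw [← el, ← er, ← dl, ← dr]
  refine (row i).fold_pair X hij (hij.trans (by simp [Fin.le_def])) ?_ ?_ ?_ ?_ ?_ ?_ hz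
  · simp only [foldedRow, foldPartner, Fin.addCases_left]
  · simp only [foldedRow, foldPartner, Fin.addCases_right, if_pos hij]
  · simp only [foldedRow, foldRefl, Fin.addCases_left]
  · simp only [foldedRow, foldRefl, Fin.addCases_right, if_pos hij]
  · field_simp
    linarith
  · rw [derivWithin_foldedDiffusion_left hz₀ hlam, eq_div_iff h0.ne'] at dl
    rw [derivWithin_foldedDiffusion_right hz₀ hlam, eq_div_iff h1.ne'] at dr
    set a := ((row i).prof (Fin.castAdd n j)).m 0
    set b := ((row i).prof (Fin.natAdd n j)).m 0
    set da := ((row i).prof (Fin.castAdd n j)).d 0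
    set db := ((row i).prof (Fin.natAdd n j)).d 0
    have e : 4 * (a ^ 2 * z₀) * (a * da + b * db) = 0 := by
      linear_combination dl + dr + 4 * b * db * hsq
    exact (mul_eq_zero.1 e).resolve_left (by positivity)

end Rows

end FoldedKernel

end

theorem mainTheorem2 (n : ℕ) (hn : 1 ≤ n)
    (z₀ : ℝ) (hz₀ : z₀ ∈ Set.Ioo (0 : ℝ) 1)
    (lam : Fin n → ℝ → ℝ)
    (hlam : ∀ i, ContDiffOn ℝ 2 (lam i) (Set.Icc 0 1))
    (hpos : ∀ i, ∀ z ∈ Set.Icc (0 : ℝ) 1, 0 < lam i z)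
    (hsorted : ∀ z ∈ Set.Icc (0 : ℝ) 1, StrictAnti fun i => lam i z)
    (hfolded : ∀ z ∈ Set.Icc (0 : ℝ) 1,
      StrictAnti fun i => FoldedKernel.foldedDiffusion z₀ lam i z)
    (Ac : ℝ → Matrix (Fin n) (Fin n) ℝ)
    (hAc : ∀ i j, ContinuousOn (fun z => Ac z i j) (Set.Icc 0 1))
    (μ : ℝ) :
    ∃ (At0 At1 : ℝ → Matrix (Fin (n + n)) (Fin (n + n)) ℝ)
      (K Kz Kζ : ℝ → ℝ → Matrix (Fin (n + n)) (Fin (n + n)) ℝ),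
      FoldedKernel.IsStrictlyLowerTriangular At0 ∧
      FoldedKernel.IsStrictlyLowerTriangular At1 ∧
      (∀ i j, FoldedKernel.PiecewiseContinuousOnUnit fun z => At0 z i j) ∧
      (∀ i j, FoldedKernel.PiecewiseContinuousOnUnit fun z => At1 z i j) ∧
      FoldedKernel.IsKernelSolution z₀ lam Ac μ At0 At1 K Kz Kζ := by
  open FoldedKernel in
  let sys := foldedRow hz₀ hlam hpos hfolded hAc μ
  choose X hX using fun i => (sys i).exists_step_fixed
  let K : ℝ → ℝ → Matrix (Fin (n + n)) (Fin (n + n)) ℝ :=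
    fun z ζ => Matrix.of fun i j => (sys i).kern (X i) j z ζ
  let Kz : ℝ → ℝ → Matrix (Fin (n + n)) (Fin (n + n)) ℝ :=
    fun z ζ => Matrix.of fun i j => (sys i).kernZ (X i) j z ζ
  let Kζ : ℝ → ℝ → Matrix (Fin (n + n)) (Fin (n + n)) ℝ :=
    fun z ζ => Matrix.of fun i j => (sys i).kernζ (X i) j z ζ
  let Λ₀ : Fin (n + n) → ℝ := fun j => foldedDiffusion z₀ lam j 0
  let Λ₁ : Fin (n + n) → ℝ := fun j => derivWithin (foldedDiffusion z₀ lam j) (Icc 0 1) 0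
  -- `c₀` and `c₁` are the defects of the two fold conditions; as only the left column of the
  -- well-posedness terms is used, `c₁` is divided by the factor `z₀ / (1 - z₀)` in `S₁`
  let c₀ : ℝ → Fin (n + n) → Fin n → ℝ := fun z i j =>
    Kζ z 0 i (Fin.castAdd n j) * Λ₀ (Fin.castAdd n j)
      + K z 0 i (Fin.castAdd n j) * Λ₁ (Fin.castAdd n j)
      + (Kζ z 0 i (Fin.natAdd n j) * Λ₀ (Fin.natAdd n j)
      + K z 0 i (Fin.natAdd n j) * Λ₁ (Fin.natAdd n j))
  let c₁ : ℝ → Fin (n + n) → Fin n → ℝ := fun z i j =>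
    (-(z₀ / (1 - z₀)) * (K z 0 i (Fin.castAdd n j) * Λ₀ (Fin.castAdd n j))
      + K z 0 i (Fin.natAdd n j) * Λ₀ (Fin.natAdd n j)) / (z₀ / (1 - z₀))
  have hK : ∀ i j, ContinuousOn (fun z => K z 0 i j) (Icc 0 1) := fun i j =>
    (sys i).continuousOn_kern_zero (X i) j
  have hKζ : ∀ i j, ContinuousOn (fun z => Kζ z 0 i j) (Icc 0 1) := fun i j =>
    (sys i).continuousOn_kernζ_zero (X i) j
  have hρ : z₀ / (1 - z₀) ≠ 0 := div_ne_zero hz₀.1.ne' (sub_pos.2 hz₀.2).ne'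
  have hm : ∀ i j z, z ∈ Icc (0 : ℝ) 1 → ((sys i).prof j).m z ^ 4 = foldedDiffusion z₀ lam j z :=
    fun i j z hz => foldedRow_m_pow hz₀ hlam hpos hfolded hAc μ i j hz
  have hd : ∀ i j z, z ∈ Icc (0 : ℝ) 1 → 4 * ((sys i).prof j).m z ^ 3 * ((sys i).prof j).d z
      = derivWithin (foldedDiffusion z₀ lam j) (Icc 0 1) z :=
    fun i j z hz => foldedRow_deriv hz₀ hlam hpos hfolded hAc μ i j hz
  refine ⟨fun z => lowerLeft (c₀ z), fun z => lowerLeft (c₁ z), K, Kz, Kζ,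
    isStrictlyLowerTriangular_lowerLeft c₀, isStrictlyLowerTriangular_lowerLeft c₁,
    piecewiseContinuousOnUnit_lowerLeft fun i l => ?_,
    piecewiseContinuousOnUnit_lowerLeft fun i l => ?_, ?_⟩
  · exact (((hKζ _ _).mul continuousOn_const).add ((hK _ _).mul continuousOn_const)).add
      (((hKζ _ _).mul continuousOn_const).add ((hK _ _).mul continuousOn_const))
  · exact ((continuousOn_const.mul ((hK _ _).mul continuousOn_const)).add
      ((hK _ _).mul continuousOn_const)).div_const _
  constructor
  case piecewise => exact fun i j => (sys i).piecewiseC1On_kern (X i) j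
  case pde =>
    intro i j φ hφ hc hT
    refine ((sys i).weak_equation j (hX i) hφ hc hT
      (fun z hz => (hm i i z (Ioo_subset_Icc_self hz)).symm)
      fun z hz => (hm i j z (Ioo_subset_Icc_self hz)).symm).trans ?_
    refine setIntegral_congr_fun Profile.isOpen_openTriangle.measurableSet fun x hx => ?_
    have hx2 : x.2 ∈ Icc (0 : ℝ) 1 := ⟨hx.1.le, hx.2.1.le.trans hx.2.2.le⟩
    simp only [Matrix.mul_apply, K, Matrix.of_apply, sys, foldedRow, clamp_of_mem hx2]
  case deriv_z_diag => exact fun z hz i j => (sys i).hasDerivWithinAt_kern_z_diag (X i) j hz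
  case deriv_ζ_diag => exact fun z hz i j => (sys i).hasDerivWithinAt_kern_ζ_diag (X i) j hz
  case deriv_ζ_zero => exact fun z hz i j => (sys i).hasDerivWithinAt_kern_ζ_zero (X i) j hz
  case diag_deriv =>
    intro z hz
    have hz' := Ioo_subset_Icc_self hz
    choose D hD hDe using fun i j => (sys i).exists_deriv_diag (X i) j hz
    refine ⟨Matrix.of D, hD, ?_⟩
    ext i j
    have h := hDe i j
    rw [show (sys i).a.m z ^ 4 = _ from hm i i z hz', hm i j z hz', hd i j z hz'] at h
    simp only [Lambda, LambdaDeriv, Matrix.add_apply, Matrix.neg_apply, Matrix.diagonal_mul,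
      Matrix.mul_diagonal, K, Kz, Kζ, Matrix.of_apply]
    rw [h]
    simp only [sys, foldedRow, clamp_of_mem hz', Matrix.add_apply]
  case diag_comm =>
    intro z hz
    ext i j
    simp only [Lambda, Matrix.sub_apply, Matrix.diagonal_mul, Matrix.mul_diagonal,
      Matrix.zero_apply]
    by_cases hij : j = i
    · subst hij; ring
    · rw [show K z z i j = 0 from (sys i).kern_diag_eq_zero (X i) hij hz]; ring
  case zero_zero =>
    ext i j
    exact (sys i).kern_zero_zero (X i) j
  case fold₁ =>
    intro z hz
    ext i j
    rw [Matrix.add_apply, mul_S₁_apply, mul_S₁_apply, lowerLeft_left, lowerLeft_right]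
    simp only [Lambda, Matrix.mul_diagonal, Matrix.zero_apply]
    split_ifs with hij
    · simp only [c₁, Λ₀]
      generalize z₀ / (1 - z₀) = ρ at hρ
      field_simp
      ring
    · rw [mul_zero, zero_add, add_zero]
      exact (foldedRow_fold hz₀ hlam hpos hfolded hAc μ (not_lt.1 hij) (X i) hz.1).1
  case fold₂ =>
    intro z hz
    ext i j
    rw [Matrix.sub_apply, Matrix.add_apply, mul_S₂_apply, mul_S₂_apply, mul_S₂_apply,
      lowerLeft_left, lowerLeft_right]
    simp only [Lambda, LambdaDeriv, Matrix.mul_diagonal, Matrix.zero_apply]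
    split_ifs with hij
    · simp only [c₀, Λ₀, Λ₁]
      ring
    · rw [add_zero, sub_zero]
      refine Eq.trans ?_
        (foldedRow_fold hz₀ hlam hpos hfolded hAc μ (not_lt.1 hij) (X i) hz.1.le).2
      simp only [K, Kζ, Matrix.of_apply, sys]
      ring
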